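/- **Theorem (Existence).** Let $p=p(\rho)$ be smooth on $(0,\infty)$ with $dp/d\rho>0$, let $\eta=\sqrt{dp/d\rho}$ be the sound speed, fix $r>0$ and put $\ell(\rho)=\int_r^\rho \eta(s)s^{-1}\,ds$. The Riemann invariants of a state $(\rho,w)$, $\rho>0$, are $\alpha=\ell(\rho)+w$, $\beta=\ell(\rho)-w$; conversely $w=(\alpha-\beta)/2$ and $\rho=\rho(\alpha,\beta)$ is the positive density with $\ell(\rho)=(\alpha+\beta)/2$. The characteristic speeds $c_{out}=w+\eta$, $c_{in}=w-\eta$ are regarded as functions of $(\alpha,\beta)$. Write $[f]=f_+-f_-$ and $$J(\alpha_+,\beta_+,\alpha_-,\beta_-)=[\rho w]^2-[\rho w^2+p]\,[\rho],\qquad V(\alpha_+,\beta_+,\alpha_-,\beta_-)=[\rho w]/[\rho],$$ with $\rho_\pm=\rho(\alpha_\pm,\beta_\pm)$, $w_\pm=(\alpha_\pm-\beta_\pm)/2$. *State ahead.* Let data $(\rho,w)$ be given at $t=0$, $x\ge0$, with a smooth future development $(\rho^*,w^*)$, $\rho^*>0$: a solution of $$\partial_t\rho+\partial_x(\rho w)=0,\qquad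 \partial_t w+w\,\partial_x w=-\tfrac1\rho\,\partial_x p(\rho),$$ smooth up to the boundary on $D=\{0\le t\le T,\ x\ge\xi(t)\}$ for some $T>0$, which agrees with the data at $t=0$, where $x=\xi(t)$ is the outgoing characteristic through the origin, $\xi(0)=0$, $\xi'=(w^*+\eta(\rho^*))(t,\xi)$. Let $\alpha^*,\beta^*$ be its Riemann invariants. *Reflection point.* Suppose $w^*(0,0)\ne0$ and that the jump conditions $[\rho]V=[\rho w]$, $[\rho w]V=[\rho w^2+p]$ with $\rho_-=\rho^*(0,0)$, $w_-=w^*(0,0)$, $w_+=0$ have a solution $\rho_+=\rho_0>0$, $V=V_0>0$ such that, with $\eta_0=\eta(\rho_0)$, $$w^*(0,0)+\eta(\rho^*(0,0))<V_0<\eta_0 .$$ *Constants.* Put $a=\frac{\eta_0-V_0}{\eta_0+V_0}\in(0,1)$, $\alpha_0=\beta_0=\ell(\rho_0)$ and $$\beta_0'=\frac{1}{1+a^3}\left(M_1\,b+M_2\,c\right),\quad M_1=-\frac{\partial J/\partial\beta_-}{\partial J/\partial\beta_+},\quad M_2=-\frac{\partial J/\partial\alpha_-}{\partial J/\partial\beta_+},$$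 with the derivatives of $J$ taken at $(\alpha_0,\beta_0,\alpha^*(0,0),\beta^*(0,0))$ and $$b=\tfrac{1+a}{\eta_0}\,\partial_t\beta^*(0,0)+(1-a)\,\partial_x\beta^*(0,0),\qquad c=\tfrac{1+a}{\eta_0}\,\partial_t\alpha^*(0,0)+(1-a)\,\partial_x\alpha^*(0,0).$$ For $\varepsilon>0$ let $T_\varepsilon=\{(u,v): 0\le u\le v\le u/a\le\varepsilon\}$. *Claim.* For all sufficiently small $\varepsilon>0$ there are $\alpha,\beta,t,x\in C^2(T_\varepsilon)$ (up to the boundary), with $(\alpha,\beta)$ everywhere the Riemann invariants of a state of positive density, such that: 1. on $T_\varepsilon$: $\partial_u x=c_{in}\,\partial_u t$, $\ \partial_v x=c_{out}\,\partial_v t$, $\ \partial_v\alpha=0$, $\ \partial_u\beta=0$; 2. on the wall $u=v$: $\alpha(u,u)=\beta(u,u)$ and $x(u,u)=0$; 3. on the shock $u=av$, $v\in[0,\varepsilon]$: with $t_+(v)=t(av,v)$, $x_+(v)=x(av,v)$, $\alpha_+(v)=\alpha(av,v)$, $\beta_+(v)=\beta(av,v)$, the point $(t_+,x_+)$ lies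 in $D$, and with $\alpha_-=\alpha^*(t_+,x_+)$, $\beta_-=\beta^*(t_+,x_+)$ one has $[\rho]\ne0$, $J(\alpha_+,\beta_+,\alpha_-,\beta_-)=0$, $\ \dfrac{dx_+}{dv}=V\,\dfrac{dt_+}{dv}$ for $V=[\rho w]/[\rho]$, and the determinism condition $c_{out}(\alpha_-,\beta_-)<V<c_{out}(\alpha_+,\beta_+)$; 4. at $(u,v)=(0,0)$: $t=x=0$, $\ \partial_v x=1$, $\ \beta=\beta_0$, $\ \partial_v\beta=\beta_0'$, $\ V=V_0$. Moreover the Jacobian determinant of $(u,v)\mapsto(t,x)$ vanishes nowhere on $T_\varepsilon$, and $\alpha,\beta$ are $C^2$ functions of $(t,x)$ on the image of $T_\varepsilon$ under this map. -/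

import Mathlib

open Set
open scoped ContDiff

noncomputable section

namespace ShockReflection

/-! ### Barotropic fluid and Riemann invariants -/

/-- Sound speed `η = √(dp/dρ)` of the barotropic fluid with pressure law `p`. -/
def soundSpeed (p : ℝ → ℝ) (ρ : ℝ) : ℝ := √(deriv p ρ)

/-- `∫_r^ρ η(s)/s ds`, with a fixed reference density `r > 0` as lower limit. -/
def potential (p : ℝ → ℝ) (r ρ : ℝ) : ℝ := ∫ s in r..ρ, soundSpeed p s / s

/-- The pair `(α, β)` comes from an actual fluid state, i.e. from a density `ρ > 0`. -/
def IsState (p : ℝ → ℝ) (r α β : ℝ) : Prop := (α + β) / 2 ∈ potential p r '' Ioi 0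

/-- The density as a function of the Riemann invariants: the `ρ > 0` whose potential is
`(α + β) / 2` (meaningful when `IsState p r α β`). -/
def density (p : ℝ → ℝ) (r α β : ℝ) : ℝ :=
  Function.invFunOn (potential p r) (Ioi 0) ((α + β) / 2)

/-- The velocity as a function of the Riemann invariants. -/
def velocity (α β : ℝ) : ℝ := (α - β) / 2

/-- Outgoing characteristic speed `w + η` as a function of the Riemann invariants. -/
def cOut (p : ℝ → ℝ) (r α β : ℝ) : ℝ := velocity α β + soundSpeed p (density p r α β)

/-- Incoming characteristic speed `w - η` as a function of the Riemann invariants. -/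
def cIn (p : ℝ → ℝ) (r α β : ℝ) : ℝ := velocity α β - soundSpeed p (density p r α β)

/-- Partial derivative in the first variable, on a (possibly closed) region `s` of the plane. -/
def partialFst (f : ℝ × ℝ → ℝ) (s : Set (ℝ × ℝ)) (q : ℝ × ℝ) : ℝ := fderivWithin ℝ f s q (1, 0)

/-- Partial derivative in the second variable, on a (possibly closed) region `s` of the plane. -/
def partialSnd (f : ℝ × ℝ → ℝ) (s : Set (ℝ × ℝ)) (q : ℝ × ℝ) : ℝ := fderivWithin ℝ f s q (0, 1)

/-! ### The state ahead -/

/-- The region of the `(t, x)`-plane with `0 ≤ t ≤ T`, to the right of the curve `x = ξ t`. -/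
def devRegion (T : ℝ) (ξ : ℝ → ℝ) : Set (ℝ × ℝ) := {q | 0 ≤ q.1 ∧ q.1 ≤ T ∧ ξ q.1 ≤ q.2}

/-- `(ρs, ws)`, as functions of `(t, x)`, is a smooth future development of the data
`(ρd, wd)` given at `t = 0`, `x ≥ 0`. It lives on the region bounded by `t = 0`, by `t = T`, and
on the left by the outgoing characteristic `x = ξ t` issuing from the origin. -/
structure IsFutureDevelopment (p ρd wd : ℝ → ℝ) (T : ℝ) (ξ : ℝ → ℝ) (ρs ws : ℝ × ℝ → ℝ) :
    Prop where
  time_pos : 0 < T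
  char_zero : ξ 0 = 0
  char_outgoing : ∀ t ∈ Icc 0 T,
    HasDerivWithinAt ξ (ws (t, ξ t) + soundSpeed p (ρs (t, ξ t))) (Icc 0 T) t
  density_pos : ∀ q ∈ devRegion T ξ, 0 < ρs q
  smooth_density : ContDiffOn ℝ ∞ ρs (devRegion T ξ)
  smooth_velocity : ContDiffOn ℝ ∞ ws (devRegion T ξ)
  mass : ∀ q ∈ devRegion T ξ,
    partialFst ρs (devRegion T ξ) q + partialSnd (fun y => ρs y * ws y) (devRegion T ξ) q = 0
  momentum : ∀ q ∈ devRegion T ξ,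
    partialFst ws (devRegion T ξ) q + ws q * partialSnd ws (devRegion T ξ) q =
      -(1 / ρs q) * partialSnd (fun y => p (ρs y)) (devRegion T ξ) q
  initial_density : ∀ x : ℝ, 0 ≤ x → ρs (0, x) = ρd x
  initial_velocity : ∀ x : ℝ, 0 ≤ x → ws (0, x) = wd x

/-- Riemann invariant `α*` of the state ahead. -/
def alphaStar (p : ℝ → ℝ) (r : ℝ) (ρs ws : ℝ × ℝ → ℝ) (q : ℝ × ℝ) : ℝ :=
  potential p r (ρs q) + ws q

/-- Riemann invariant `β*` of the state ahead. -/
def betaStar (p : ℝ → ℝ) (r : ℝ) (ρs ws : ℝ × ℝ → ℝ) (q : ℝ × ℝ) : ℝ :=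
  potential p r (ρs q) - ws q

/-- The conditions at the reflection point: with state `(ρm, wm)` ahead, `wm ≠ 0`, and state
`(ρ₀, 0)` behind, the jump conditions hold with shock speed `V₀ > 0` and the determinism condition
is satisfied. -/
structure IsReflectionPoint (p : ℝ → ℝ) (ρm wm ρ₀ V₀ : ℝ) : Prop where
  incompatible : wm ≠ 0
  density_pos : 0 < ρ₀
  mass_jump : (ρ₀ - ρm) * V₀ = ρ₀ * 0 - ρm * wm
  momentum_jump : (ρ₀ * 0 - ρm * wm) * V₀ = (ρ₀ * 0 ^ 2 + p ρ₀) - (ρm * wm ^ 2 + p ρm)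
  supersonic_ahead : wm + soundSpeed p ρm < V₀
  subsonic_behind : V₀ < soundSpeed p ρ₀
  speed_pos : 0 < V₀

/-! ### Jump conditions in terms of the Riemann invariants -/

/-- `I = [ρw]² - [ρw² + p][ρ]`. -/
def jumpI (p : ℝ → ℝ) (ρp ρm wp wm : ℝ) : ℝ :=
  (ρp * wp - ρm * wm) ^ 2 - ((ρp * wp ^ 2 + p ρp) - (ρm * wm ^ 2 + p ρm)) * (ρp - ρm)

/-- `J`, i.e. `I` as a function of the Riemann invariants behind and ahead of the shock. -/
def jumpJ (p : ℝ → ℝ) (r αp βp αm βm : ℝ) : ℝ :=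
  jumpI p (density p r αp βp) (density p r αm βm) (velocity αp βp) (velocity αm βm)

/-- Shock speed `[ρw] / [ρ]` as a function of the Riemann invariants behind and ahead. -/
def shockSpeed (p : ℝ → ℝ) (r αp βp αm βm : ℝ) : ℝ :=
  (density p r αp βp * velocity αp βp - density p r αm βm * velocity αm βm) /
    (density p r αp βp - density p r αm βm)

/-! ### The reflection problem in characteristic coordinates -/

/-- The constant `a = (η₀ - V₀) / (η₀ + V₀)`, with `η₀ = η(ρ₀)`. -/
def slope (p : ℝ → ℝ) (ρ₀ V₀ : ℝ) : ℝ := (soundSpeed p ρ₀ - V₀) / (soundSpeed p ρ₀ + V₀)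

/-- The triangle `0 ≤ u ≤ v ≤ u / a ≤ ε` in the `(u, v)`-plane. -/
def triangle (a ε : ℝ) : Set (ℝ × ℝ) := {q | 0 ≤ q.1 ∧ q.1 ≤ q.2 ∧ q.2 ≤ q.1 / a ∧ q.1 / a ≤ ε}

/-- The value `β₀ = α₀` of both Riemann invariants behind the shock at the reflection point
(the velocity vanishes there). -/
def beta₀ (p : ℝ → ℝ) (r ρ₀ : ℝ) : ℝ := potential p r ρ₀

/-- The value `β₀'` of `∂β/∂v` at the reflection point,
`β₀' = (M₁ β₋'(0) + M₂ α₋'(0)) / (1 + a³)`, where `M₁ = ∂H/∂β₋` and `M₂ = ∂H/∂α₋` for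
the implicit solution `β₊ = H(α₊, α₋, β₋)` of `J = 0`, i.e. `M₁ = -J_{β₋} / J_{β₊}` and
`M₂ = -J_{α₋} / J_{β₊}`, all taken at the reflection point. -/
def beta₀' (p : ℝ → ℝ) (r T : ℝ) (ξ : ℝ → ℝ) (ρs ws : ℝ × ℝ → ℝ) (ρ₀ V₀ : ℝ) : ℝ :=
  let a := slope p ρ₀ V₀
  let η₀ := soundSpeed p ρ₀
  let b := beta₀ p r ρ₀
  let αs := alphaStar p r ρs ws
  let βs := betaStar p r ρs ws
  let D := devRegion T ξ
  let Jβp := deriv (fun z => jumpJ p r b z (αs (0, 0)) (βs (0, 0))) b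
  let M₁ := -deriv (fun z => jumpJ p r b b (αs (0, 0)) z) (βs (0, 0)) / Jβp
  let M₂ := -deriv (fun z => jumpJ p r b b z (βs (0, 0))) (αs (0, 0)) / Jβp
  let dα := partialFst αs D (0, 0) * ((1 + a) / η₀) + partialSnd αs D (0, 0) * (1 - a)
  let dβ := partialFst βs D (0, 0) * ((1 + a) / η₀) + partialSnd βs D (0, 0) * (1 - a)
  (M₁ * dβ + M₂ * dα) / (1 + a ^ 3)

/-- `(t₊(v), x₊(v)) = (t(av, v), x(av, v))`, the shock curve. -/
def shockPt (a : ℝ) (t x : ℝ × ℝ → ℝ) (v : ℝ) : ℝ × ℝ := (t (a * v, v), x (a * v, v))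

/-- The shock speed `V(v) = [ρw] / [ρ]` along `u = av`. -/
def speedAlong (p : ℝ → ℝ) (r a : ℝ) (ρs ws α β t x : ℝ × ℝ → ℝ) (v : ℝ) : ℝ :=
  shockSpeed p r (α (a * v, v)) (β (a * v, v))
    (alphaStar p r ρs ws (shockPt a t x v)) (betaStar p r ρs ws (shockPt a t x v))

/-- `(α, β, t, x)`, as functions of `(u, v)`, is a `C²` solution on the triangle of the shock
reflection problem with state ahead `(ρs, ws)`. -/
structure IsReflectionSolution (p : ℝ → ℝ) (r T : ℝ) (ξ : ℝ → ℝ) (ρs ws : ℝ × ℝ → ℝ)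
    (ρ₀ V₀ a ε : ℝ) (α β t x : ℝ × ℝ → ℝ) : Prop where
  contDiff_α : ContDiffOn ℝ 2 α (triangle a ε)
  contDiff_β : ContDiffOn ℝ 2 β (triangle a ε)
  contDiff_t : ContDiffOn ℝ 2 t (triangle a ε)
  contDiff_x : ContDiffOn ℝ 2 x (triangle a ε)
  isState : ∀ q ∈ triangle a ε, IsState p r (α q) (β q)
  -- characteristic equations
  char_in : ∀ q ∈ triangle a ε,
    partialFst x (triangle a ε) q = cIn p r (α q) (β q) * partialFst t (triangle a ε) q
  char_out : ∀ q ∈ triangle a ε,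
    partialSnd x (triangle a ε) q = cOut p r (α q) (β q) * partialSnd t (triangle a ε) q
  invariant_α : ∀ q ∈ triangle a ε, partialSnd α (triangle a ε) q = 0
  invariant_β : ∀ q ∈ triangle a ε, partialFst β (triangle a ε) q = 0
  -- wall
  wall_velocity : ∀ u ∈ Icc 0 (a * ε), α (u, u) = β (u, u)
  wall_position : ∀ u ∈ Icc 0 (a * ε), x (u, u) = 0
  -- shock curve, lying inside the future development
  shock_mem : ∀ v ∈ Icc 0 ε, shockPt a t x v ∈ devRegion T ξ
  shock_speed : ∀ v ∈ Icc 0 ε,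
    derivWithin (fun s => x (a * s, s)) (Icc 0 ε) v =
      speedAlong p r a ρs ws α β t x v * derivWithin (fun s => t (a * s, s)) (Icc 0 ε) v
  density_jump : ∀ v ∈ Icc 0 ε, density p r (α (a * v, v)) (β (a * v, v)) ≠
    density p r (alphaStar p r ρs ws (shockPt a t x v)) (betaStar p r ρs ws (shockPt a t x v))
  jump : ∀ v ∈ Icc 0 ε, jumpJ p r (α (a * v, v)) (β (a * v, v))
    (alphaStar p r ρs ws (shockPt a t x v)) (betaStar p r ρs ws (shockPt a t x v)) = 0
  -- determinism condition
  supersonic_ahead : ∀ v ∈ Icc 0 ε,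
    cOut p r (alphaStar p r ρs ws (shockPt a t x v)) (betaStar p r ρs ws (shockPt a t x v)) <
      speedAlong p r a ρs ws α β t x v
  subsonic_behind : ∀ v ∈ Icc 0 ε,
    speedAlong p r a ρs ws α β t x v < cOut p r (α (a * v, v)) (β (a * v, v))
  -- reflection point and normalisation of the coordinates
  t_zero : t (0, 0) = 0
  x_zero : x (0, 0) = 0
  x_normalised : partialSnd x (triangle a ε) (0, 0) = 1
  β_zero : β (0, 0) = beta₀ p r ρ₀
  dβ_zero : partialSnd β (triangle a ε) (0, 0) = beta₀' p r T ξ ρs ws ρ₀ V₀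
  speed_zero : speedAlong p r a ρs ws α β t x 0 = V₀

/-- The Jacobian determinant `∂(t, x)/∂(u, v)` on the region `s`. -/
def jacobian (t x : ℝ × ℝ → ℝ) (s : Set (ℝ × ℝ)) (q : ℝ × ℝ) : ℝ :=
  partialFst t s q * partialSnd x s q - partialSnd t s q * partialFst x s q

end ShockReflection

end

/-!
The shock is a free boundary, and the state ahead of it is only known to its right. In the
coordinates `(u, v)` the shock is the fixed line `u = a v`, the wall is `u = v`, and the Riemann
invariants are `α(u, v) = b(u)`, `β(u, v) = b(v)` for a single function `b` of one variable, since
`α = β` on the wall. The functions `t` and `x` are also unknown. Extending everything to the square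
`[0, ε]²` by reflection in the wall, `t` becomes symmetric, so that `∂t/∂u = p(u, v)` and
`∂t/∂v = p(v, u)` for one function `p`, and the two characteristic equations for `x` are compatible
exactly if `∂p/∂v` is a certain function `w` of `b`, `b'` and `p`. On the shock, `dx = V dt` fixes
the ratio `γ` of `p(v, a v)` to `p(a v, v)`, and the jump condition `J = 0`, differentiated along
the shock, expresses `b'(v)` by `b'(a v)` and quantities of lower order. The outcome is a functional
integral system for `b`, `p` and the shock curve `(t₊, x₊)`, in which the values at `v` depend on
those at `a v`.

Since a solution of class `C²` is wanted, the system is solved for `b''` and the first derivatives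
of `p`. There the top order terms on the shock are multiplied by a number close to `a⁴` for `b''`
and to `a` for `∂p/∂u`: the coefficients `a³`
(because `∂J/∂α₊ = a² ∂J/∂β₊` at the reflection point) and `1` of the undifferentiated equations,
and a factor `a` from the chain rule. All other terms carry a factor `ε` or are of lower order, so
in a suitably weighted norm the iteration is a contraction for small `ε`
(`IsClose.step`, `exists_weights`, `SystemData.exists_fixed`). The iteration keeps `(t₊, x₊)` in a
cone strictly to the right of the outgoing characteristic, hence inside the development of the state
ahead (`devRegion_mem_nhdsWithin`). This is where `w* + η(ρ*) < V₀` enters.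

From the solution, `t` and `x` are recovered as primitives of closed forms
(`exists_primitive_of_closed`, `ReflectionData.exists_characteristicSolution`). As `t` increases in
both variables while `x` decreases in `u` and increases in `v`, the map `(u, v) ↦ (t, x)` is
injective, and its inverse is of class `C²` (`injOn_square`, `exists_contDiffOn_inverse`). The
computation at the reflection point that makes the general scheme apply to the gas is
`reflectionData`.
-/

noncomputable section

namespace ShockReflection

open Filter Topology MeasureTheory
open scoped BoundedContinuousFunction

/-! ### A fixed point principle -/

/-- Banach's fixed point theorem for a gauge `g` that is comparable to the distance without being
a metric; a weighted sum of distances of components is the case of interest. -/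
theorem exists_fixedPoint_of_gauge {E : Type*} [MetricSpace E] [CompleteSpace E] {S : Set E}
    (hS : IsClosed S) (hne : S.Nonempty) {Φ : E → E} (hΦ : MapsTo Φ S S) {g : E → E → ℝ}
    {q C : ℝ} (hq0 : 0 ≤ q) (hq : q < 1) (hC : 0 ≤ C)
    (hcontr : ∀ x ∈ S, ∀ y ∈ S, g (Φ x) (Φ y) ≤ q * g x y)
    (hdist : ∀ x ∈ S, ∀ y ∈ S, dist x y ≤ C * g x y)
    (hgauge : ∀ x ∈ S, ∀ y ∈ S, g x y ≤ C * dist x y) :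
    ∃ x ∈ S, Φ x = x := by
  obtain ⟨x₀, hx₀⟩ := hne
  have hmem : ∀ n, Φ^[n] x₀ ∈ S := fun n => (hΦ.iterate n) hx₀
  have hg : ∀ n, g (Φ^[n] x₀) (Φ^[n + 1] x₀) ≤ g x₀ (Φ x₀) * q ^ n := by
    intro n
    induction n with
    | zero => simp
    | succ n ih =>
      rw [Function.iterate_succ_apply' Φ n, Function.iterate_succ_apply' Φ (n + 1)]
      calc _ ≤ q * g (Φ^[n] x₀) (Φ^[n + 1] x₀) := hcontr _ (hmem n) _ (hmem (n + 1))
        _ ≤ q * (g x₀ (Φ x₀) * q ^ n) := by gcongr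
        _ = _ := by ring
  have hcau : CauchySeq fun n => Φ^[n] x₀ := by
    refine cauchySeq_of_le_geometric q (C * g x₀ (Φ x₀)) hq fun n => ?_
    calc _ ≤ C * g (Φ^[n] x₀) (Φ^[n + 1] x₀) := hdist _ (hmem n) _ (hmem (n + 1))
      _ ≤ C * (g x₀ (Φ x₀) * q ^ n) := by gcongr; exact hg n
      _ = _ := by ring
  obtain ⟨x, hx⟩ := cauchySeq_tendsto_of_complete hcau
  have hxS : x ∈ S := hS.mem_of_tendsto hx (Eventually.of_forall hmem)
  refine ⟨x, hxS, ?_⟩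
  have hx1 : Tendsto (fun n => Φ^[n + 1] x₀) atTop (𝓝 x) := (tendsto_add_atTop_iff_nat 1).2 hx
  refine tendsto_nhds_unique ?_ hx1
  rw [tendsto_iff_dist_tendsto_zero]
  have hlim : Tendsto (fun n => C * (q * (C * dist (Φ^[n] x₀) x))) atTop (𝓝 0) := by
    have := (tendsto_iff_dist_tendsto_zero.1 hx).const_mul (C * (q * C))
    simpa [mul_assoc] using this
  refine squeeze_zero (fun _ => dist_nonneg) (fun n => ?_) hlim
  rw [Function.iterate_succ_apply']
  calc _ ≤ C * g (Φ (Φ^[n] x₀)) (Φ x) := hdist _ (hΦ (hmem n)) _ (hΦ hxS)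
    _ ≤ C * (q * g (Φ^[n] x₀) x) := by gcongr; exact hcontr _ (hmem n) _ hxS
    _ ≤ _ := by gcongr; exact hgauge _ (hmem n) _ hxS

/-- Weights that turn a triangular system of estimates, with diagonal entries `0, q, q` up to
`O(ε)`, into a contraction for the weighted sum. -/
theorem exists_weights {q C : ℝ} (hq0 : 0 ≤ q) (hq : q < 1) (hC : 0 ≤ C) :
    ∃ K₀ K₁ q' ε₀ : ℝ, 1 ≤ K₀ ∧ 1 ≤ K₁ ∧ 0 ≤ q' ∧ q' < 1 ∧ 0 < ε₀ ∧
      ∀ ε d₀ d₁ d₂ e₀ e₁ e₂ : ℝ, 0 ≤ ε → ε ≤ ε₀ → 0 ≤ d₀ → 0 ≤ d₁ → 0 ≤ d₂ →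
        e₀ ≤ C * ε * (d₀ + d₁ + d₂) →
        e₁ ≤ q * d₁ + C * d₀ + C * ε * (d₀ + d₁ + d₂) →
        e₂ ≤ q * d₂ + C * (d₀ + d₁) + C * ε * (d₀ + d₁ + d₂) →
        K₀ * e₀ + K₁ * e₁ + e₂ ≤ q' * (K₀ * d₀ + K₁ * d₁ + d₂) := by
  set r := (1 - q) / 4 with hr
  have hr0 : 0 < r := by rw [hr]; linarith
  set K₁ := 1 + C / r with hK₁
  have hK₁1 : 1 ≤ K₁ := by have := div_nonneg hC hr0.le; linarith
  set K₀ := 1 + (K₁ * C + C) / r with hK₀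
  have hK₀1 : 1 ≤ K₀ := by
    have : 0 ≤ (K₁ * C + C) / r := by positivity
    linarith
  have h1 : C ≤ r * K₁ := by
    rw [hK₁, mul_add, mul_div_cancel₀ _ hr0.ne']; linarith
  have h0 : K₁ * C + C ≤ r * K₀ := by
    rw [hK₀, mul_add, mul_div_cancel₀ _ hr0.ne']; linarith
  set M := (K₀ + K₁ + 1) * C with hM
  have hM0 : 0 ≤ M := by positivity
  refine ⟨K₀, K₁, q + 2 * r, r / (M + 1), hK₀1, hK₁1, by positivity, by rw [hr]; linarith,
    by positivity, ?_⟩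
  intro ε d₀ d₁ d₂ e₀ e₁ e₂ hε hεle hd₀ hd₁ hd₂ he₀ he₁ he₂
  have hMε : M * ε ≤ r := by
    have : (M + 1) * ε ≤ r := by
      rw [le_div_iff₀ (by positivity)] at hεle; linarith
    nlinarith
  set D := d₀ + d₁ + d₂
  have hD : 0 ≤ D := by positivity
  have a0 := mul_le_mul_of_nonneg_left he₀ (by linarith : (0:ℝ) ≤ K₀)
  have a1 := mul_le_mul_of_nonneg_left he₁ (by linarith : (0:ℝ) ≤ K₁)
  have a2 : M * ε * D ≤ r * D := by gcongr
  have a3 : K₀ * (C * ε * D) + K₁ * (C * ε * D) + C * ε * D = M * ε * D := by rw [hM]; ring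
  have a4 : (K₁ * C + C) * d₀ ≤ r * K₀ * d₀ := by gcongr
  have a5 : C * d₁ ≤ r * K₁ * d₁ := by gcongr
  have a6 : r * D ≤ r * (K₀ * d₀ + K₁ * d₁ + d₂) := by
    gcongr
    simp only [D]
    nlinarith
  have a7 : 0 ≤ q * (K₀ * d₀) := by positivity
  have a8 : 0 ≤ r * d₂ := by positivity
  nlinarith

/-! ### Functions of class `C¹` on a square, in integrated form -/

/-- On the square `[0, ε]²`, `f` is a primitive of `P` in the first and of `W` in the second
variable. This form of `∂f/∂u = P`, `∂f/∂v = W` is closed under uniform convergence. -/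
def IsPrimitiveOnSquare (ε : ℝ) (f P W : ℝ → ℝ → ℝ) : Prop :=
  ∀ u ∈ Icc 0 ε, ∀ v ∈ Icc 0 ε,
    f u v = f 0 v + (∫ s in (0 : ℝ)..u, P s v) ∧ f u v = f u 0 + ∫ s in (0 : ℝ)..v, W u s

theorem abs_integral_sub_le {f : ℝ → ℝ} (hf : Continuous f) {a b m c : ℝ}
    (h : ∀ s ∈ uIcc a b, |f s - m| ≤ c) :
    |(∫ s in a..b, f s) - m * (b - a)| ≤ c * |b - a| := by
  have e : (∫ s in a..b, f s) - m * (b - a) = ∫ s in a..b, (f s - m) := by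
    rw [intervalIntegral.integral_sub (hf.intervalIntegrable _ _) (by simp)]
    simp [mul_comm]
  rw [e, ← Real.norm_eq_abs]
  exact intervalIntegral.norm_integral_le_of_norm_le_const
    fun s hs => h s (uIoc_subset_uIcc hs)

/-- The linear form `(du, dv) ↦ A du + B dv` on the plane. -/
noncomputable def planeForm (A B : ℝ) : ℝ × ℝ →L[ℝ] ℝ :=
  A • ContinuousLinearMap.fst ℝ ℝ ℝ + B • ContinuousLinearMap.snd ℝ ℝ ℝ

@[simp] theorem planeForm_apply (A B : ℝ) (y : ℝ × ℝ) :
    planeForm A B y = A * y.1 + B * y.2 := by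
  simp [planeForm]

theorem abs_fst_le_norm (y : ℝ × ℝ) : |y.1| ≤ ‖y‖ := by
  rw [← Real.norm_eq_abs]; exact norm_fst_le y

theorem abs_snd_le_norm (y : ℝ × ℝ) : |y.2| ≤ ‖y‖ := by
  rw [← Real.norm_eq_abs]; exact norm_snd_le y

theorem IsPrimitiveOnSquare.hasFDerivWithinAt {ε : ℝ} {f P W : ℝ → ℝ → ℝ}
    (h : IsPrimitiveOnSquare ε f P W) (hP : Continuous fun y : ℝ × ℝ => P y.1 y.2)
    (hW : Continuous fun y : ℝ × ℝ => W y.1 y.2) {z : ℝ × ℝ} (hz : z ∈ Icc 0 ε ×ˢ Icc 0 ε) :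
    HasFDerivWithinAt (fun y : ℝ × ℝ => f y.1 y.2) (planeForm (P z.1 z.2) (W z.1 z.2))
      (Icc 0 ε ×ˢ Icc 0 ε) z := by
  rw [hasFDerivWithinAt_iff_isLittleO, Asymptotics.isLittleO_iff]
  intro c hc
  obtain ⟨δ₁, hδ₁, h₁⟩ := Metric.continuousAt_iff.1 (hP.continuousAt (x := z)) (c / 2)
    (by positivity)
  obtain ⟨δ₂, hδ₂, h₂⟩ := Metric.continuousAt_iff.1 (hW.continuousAt (x := z)) (c / 2)
    (by positivity)
  filter_upwards [self_mem_nhdsWithin,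
    mem_nhdsWithin_of_mem_nhds (Metric.ball_mem_nhds z (lt_min hδ₁ hδ₂))] with y hy hyz
  obtain ⟨u, v⟩ := z
  obtain ⟨u', v'⟩ := y
  simp only [mem_prod] at hz hy
  have hd : |u' - u| < min δ₁ δ₂ ∧ |v' - v| < min δ₁ δ₂ := by
    have := Metric.mem_ball.1 hyz
    rw [Prod.dist_eq, max_lt_iff] at this
    simpa only [Real.dist_eq] using this
  have hPc (w : ℝ) : Continuous fun s => P s w := hP.comp (by fun_prop : Continuous fun s => (s, w))
  have hWc (w : ℝ) : Continuous fun s => W w s := hW.comp (by fun_prop : Continuous fun s => (w, s))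
  have e₁ : f u' v' - f u v' = ∫ s in u..u', P s v' := by
    rw [(h u' hy.1 v' hy.2).1, (h u hz.1 v' hy.2).1,
      ← intervalIntegral.integral_add_adjacent_intervals ((hPc v').intervalIntegrable 0 u)
        ((hPc v').intervalIntegrable u u')]
    ring
  have e₂ : f u v' - f u v = ∫ s in v..v', W u s := by
    rw [(h u hz.1 v' hy.2).2, (h u hz.1 v hz.2).2,
      ← intervalIntegral.integral_add_adjacent_intervals ((hWc u).intervalIntegrable 0 v)
        ((hWc u).intervalIntegrable v v')]
    ring
  have b₁ : |(∫ s in u..u', P s v') - P u v * (u' - u)| ≤ c / 2 * |u' - u| := by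
    refine abs_integral_sub_le (hPc v') fun s hs => ?_
    have := h₁ (x := (s, v')) ?_
    · exact (Real.dist_eq _ _ ▸ this).le
    · rw [Prod.dist_eq, Real.dist_eq, Real.dist_eq]
      exact max_lt ((abs_sub_left_of_mem_uIcc hs).trans_lt (hd.1.trans_le (min_le_left _ _)))
        (hd.2.trans_le (min_le_left _ _))
  have b₂ : |(∫ s in v..v', W u s) - W u v * (v' - v)| ≤ c / 2 * |v' - v| := by
    refine abs_integral_sub_le (hWc u) fun s hs => ?_
    have := h₂ (x := (u, s)) ?_
    · exact (Real.dist_eq _ _ ▸ this).le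
    · rw [Prod.dist_eq, Real.dist_eq, Real.dist_eq, sub_self, abs_zero]
      exact max_lt hδ₂ ((abs_sub_left_of_mem_uIcc hs).trans_lt (hd.2.trans_le (min_le_right _ _)))
  have n₁ : |u' - u| ≤ ‖((u', v') : ℝ × ℝ) - (u, v)‖ :=
    abs_fst_le_norm (((u', v') : ℝ × ℝ) - (u, v))
  have n₂ : |v' - v| ≤ ‖((u', v') : ℝ × ℝ) - (u, v)‖ :=
    abs_snd_le_norm (((u', v') : ℝ × ℝ) - (u, v))
  have key : f u' v' - f u v - planeForm (P u v) (W u v) ((u', v') - (u, v)) =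
      ((∫ s in u..u', P s v') - P u v * (u' - u)) +
        ((∫ s in v..v', W u s) - W u v * (v' - v)) := by
    rw [← e₁, ← e₂]; simp; ring
  change ‖f u' v' - f u v - planeForm (P u v) (W u v) ((u', v') - (u, v))‖ ≤ _
  rw [key, Real.norm_eq_abs]
  refine (abs_add_le _ _).trans ?_
  have := mul_le_mul_of_nonneg_left n₁ (by positivity : 0 ≤ c / 2)
  have := mul_le_mul_of_nonneg_left n₂ (by positivity : 0 ≤ c / 2)
  linarith

/-- The fundamental theorem of calculus for a function differentiable on a closed interval. -/
theorem eq_add_integral_of_hasDerivWithinAt {ε : ℝ} {f f' : ℝ → ℝ}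
    (hf : ∀ s ∈ Icc 0 ε, HasDerivWithinAt f (f' s) (Icc 0 ε) s) (hf' : ContinuousOn f' (Icc 0 ε))
    {v : ℝ} (hv : v ∈ Icc 0 ε) : f v = f 0 + ∫ s in (0 : ℝ)..v, f' s := by
  have hsub : Icc 0 v ⊆ Icc 0 ε := Icc_subset_Icc_right hv.2
  rw [intervalIntegral.integral_eq_sub_of_hasDerivAt_of_le hv.1
    (fun s hs => ((hf s (hsub hs)).continuousWithinAt).mono hsub)
    (fun s hs => (hf s (hsub (Ioo_subset_Icc_self hs))).hasDerivAt
      (Icc_mem_nhds hs.1 (hs.2.trans_le hv.2)))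
    ((hf'.mono hsub).intervalIntegrable_of_Icc hv.1)]
  ring

/-- Differentiation under the integral sign, in integrated form: if `N` is a primitive of `M` in
the first variable, `∫₀ᵛ N(u, s) ds` is `C¹` with derivatives `∫₀ᵛ M(u, s) ds` and `N`. -/
theorem isPrimitiveOnSquare_integral {ε : ℝ} {N M : ℝ → ℝ → ℝ}
    (hN : Continuous fun y : ℝ × ℝ => N y.1 y.2) (hM : Continuous fun y : ℝ × ℝ => M y.1 y.2)
    (h : ∀ u ∈ Icc 0 ε, ∀ s ∈ Icc 0 ε, N u s = N 0 s + ∫ σ in (0 : ℝ)..u, M σ s) :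
    IsPrimitiveOnSquare ε (fun u v => ∫ s in (0 : ℝ)..v, N u s)
      (fun u v => ∫ s in (0 : ℝ)..v, M u s) N := by
  intro u hu v hv
  refine ⟨?_, by simp⟩
  have hswap : ∫ σ in (0 : ℝ)..u, (∫ s in (0 : ℝ)..v, M σ s) =
      ∫ s in (0 : ℝ)..v, ∫ σ in (0 : ℝ)..u, M σ s := by
    refine intervalIntegral_intervalIntegral_swap ?_
    have hint : IntegrableOn (fun y : ℝ × ℝ => M y.1 y.2) (uIcc 0 u ×ˢ uIcc 0 v) :=
      hM.continuousOn.integrableOn_compact (isCompact_uIcc.prod isCompact_uIcc)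
    exact hint.mono_set (prod_mono uIoc_subset_uIcc uIoc_subset_uIcc)
  have hNc (w : ℝ) : Continuous fun s => N w s := hN.comp (by fun_prop : Continuous fun s => (w, s))
  have hcont : Continuous fun s => ∫ σ in (0 : ℝ)..u, M σ s :=
    intervalIntegral.continuous_parametric_intervalIntegral_of_continuous'
      (f := fun s σ => M σ s) (hM.comp continuous_swap) 0 u
  simp only [hswap]
  rw [← intervalIntegral.integral_add ((hNc 0).intervalIntegrable _ _)
    (hcont.intervalIntegrable _ _)]
  refine intervalIntegral.integral_congr fun s hs => ?_
  rw [uIcc_of_le hv.1] at hs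
  exact h u hu s ⟨hs.1, hs.2.trans hv.2⟩

/-! ### Quantitative smoothness at a boundary point of a convex set -/

/-- `f` is differentiable on `s` with derivative `f'`, and `f` and `f'` are bounded and Lipschitz,
all with the same constant `L`. -/
structure IsTameOn {E : Type*} [NormedAddCommGroup E] [NormedSpace ℝ E] (f : E → ℝ)
    (f' : E → E →L[ℝ] ℝ) (L : ℝ) (s : Set E) : Prop where
  abs_le : ∀ x ∈ s, |f x| ≤ L
  norm_le : ∀ x ∈ s, ‖f' x‖ ≤ L
  lip : ∀ x ∈ s, ∀ y ∈ s, |f x - f y| ≤ L * ‖x - y‖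
  lip' : ∀ x ∈ s, ∀ y ∈ s, ‖f' x - f' y‖ ≤ L * ‖x - y‖
  hasFDerivWithinAt : ∀ x ∈ s, HasFDerivWithinAt f (f' x) s x

theorem IsTameOn.mono {E : Type*} [NormedAddCommGroup E] [NormedSpace ℝ E] {f : E → ℝ}
    {f' : E → E →L[ℝ] ℝ} {L L' : ℝ} {s t : Set E} (h : IsTameOn f f' L s) (hL : L ≤ L')
    (hts : t ⊆ s) : IsTameOn f f' L' t where
  abs_le x hx := (h.abs_le x (hts hx)).trans hL
  norm_le x hx := (h.norm_le x (hts hx)).trans hL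
  lip x hx y hy := (h.lip x (hts hx) y (hts hy)).trans (by gcongr)
  lip' x hx y hy := (h.lip' x (hts hx) y (hts hy)).trans (by gcongr)
  hasFDerivWithinAt x hx := (h.hasFDerivWithinAt x (hts hx)).mono hts

theorem IsTameOn.continuousOn {E : Type*} [NormedAddCommGroup E] [NormedSpace ℝ E] {f : E → ℝ}
    {f' : E → E →L[ℝ] ℝ} {L : ℝ} {s : Set E} (h : IsTameOn f f' L s) : ContinuousOn f s :=
  fun x hx => (h.hasFDerivWithinAt x hx).continuousWithinAt

theorem IsTameOn.continuousOn_deriv {E : Type*} [NormedAddCommGroup E] [NormedSpace ℝ E]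
    {f : E → ℝ} {f' : E → E →L[ℝ] ℝ} {L : ℝ} {s : Set E} (h : IsTameOn f f' L s) :
    ContinuousOn f' s := by
  have : LipschitzOnWith (Real.toNNReal L) f' s :=
    LipschitzOnWith.of_dist_le_mul fun x hx y hy => by
      rw [dist_eq_norm, dist_eq_norm]
      refine (h.lip' x hx y hy).trans ?_
      gcongr
      exact Real.le_coe_toNNReal L
  exact this.continuousOn

/-- A function of class `C²` at a boundary point of a convex set is tame on all small pieces of the set
around the point, with one constant for all of them. -/
theorem eventually_isTameOn {E : Type*} [NormedAddCommGroup E] [NormedSpace ℝ E] {f : E → ℝ}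
    {C : Set E} {x₀ : E} (hf : ContDiffWithinAt ℝ 2 f C x₀) (hC : Convex ℝ C)
    (hC' : UniqueDiffOn ℝ C) (hx₀ : x₀ ∈ C) :
    ∃ L₀ : ℝ, ∀ L, L₀ ≤ L → ∀ᶠ s in (𝓝[C] x₀).smallSets,
      IsTameOn f (fderivWithin ℝ f C) L s := by
  have hf1 : ContDiffWithinAt ℝ 1 f C x₀ := hf.of_le (by norm_num)
  have hf' : ContDiffWithinAt ℝ 1 (fderivWithin ℝ f C) C x₀ :=
    hf.fderivWithin_right hC' (by norm_num) hx₀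
  obtain ⟨K₁, t₁, ht₁, h₁⟩ := hf1.exists_lipschitzOnWith hC
  obtain ⟨K₂, t₂, ht₂, h₂⟩ := hf'.exists_lipschitzOnWith hC
  have hc : ∀ᶠ x in 𝓝[C] x₀, |f x| < |f x₀| + 1 :=
    hf1.continuousWithinAt.abs.eventually_lt_const (lt_add_one _)
  have hc' : ∀ᶠ x in 𝓝[C] x₀, ‖fderivWithin ℝ f C x‖ < ‖fderivWithin ℝ f C x₀‖ + 1 :=
    hf'.continuousWithinAt.norm.eventually_lt_const (lt_add_one _)
  have hd : ∀ᶠ x in 𝓝[C] x₀, ContDiffWithinAt ℝ 1 f C x := by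
    have := hf1.eventually (by simp)
    rwa [insert_eq_of_mem hx₀] at this
  refine ⟨|f x₀| + 1 + (‖fderivWithin ℝ f C x₀‖ + 1) + K₁ + K₂, fun L hL => ?_⟩
  have p1 := abs_nonneg (f x₀)
  have p2 := norm_nonneg (fderivWithin ℝ f C x₀)
  have p3 := K₁.coe_nonneg
  have p4 := K₂.coe_nonneg
  have hall : ∀ᶠ x in 𝓝[C] x₀, x ∈ C ∧ x ∈ t₁ ∧ x ∈ t₂ ∧ |f x| < |f x₀| + 1 ∧
      ‖fderivWithin ℝ f C x‖ < ‖fderivWithin ℝ f C x₀‖ + 1 ∧ ContDiffWithinAt ℝ 1 f C x := by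
    filter_upwards [self_mem_nhdsWithin, ht₁, ht₂, hc, hc', hd] with x a1 a2 a3 a4 a5 a6
    exact ⟨a1, a2, a3, a4, a5, a6⟩
  filter_upwards [eventually_smallSets_subset.2 hall] with s hs
  have hK₁ : (K₁ : ℝ) ≤ L := by linarith
  have hK₂ : (K₂ : ℝ) ≤ L := by linarith
  refine ⟨fun x hx => ?_, fun x hx => ?_, fun x hx y hy => ?_, fun x hx y hy => ?_,
    fun x hx => ?_⟩
  · have := (hs hx).2.2.2.1; linarith
  · have := (hs hx).2.2.2.2.1; linarith
  · have := h₁.dist_le_mul x (hs hx).2.1 y (hs hy).2.1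
    rw [Real.dist_eq, dist_eq_norm] at this
    exact this.trans (by gcongr)
  · have := h₂.dist_le_mul x (hs hx).2.2.1 y (hs hy).2.2.1
    rw [dist_eq_norm, dist_eq_norm] at this
    exact this.trans (by gcongr)
  · exact (((hs hx).2.2.2.2.2.differentiableWithinAt (by norm_num)).hasFDerivWithinAt).mono
      fun y hy => (hs hy).1

/-! ### The functional integral system -/

/-- The variables `((β(v), β(a v), t₊(v), x₊(v)), β'(a v), ∂t/∂u (a v, v))` along the shock. -/
abbrev ShockVar := (ℝ × ℝ × ℝ × ℝ) × ℝ × ℝ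

/-- The variables `(β(u), β(v), β'(u), β'(v), ∂t/∂u (u, v), ∂t/∂u (v, u))` on the square. -/
abbrev BulkVar := ℝ × ℝ × ℝ × ℝ × ℝ × ℝ

/-- The shock variables whose position `(t, x)` lies in the cone `0 ≤ t`, `m₁ t ≤ x ≤ m₂ t`. -/
def shockCone (m₁ m₂ : ℝ) : Set ShockVar :=
  {X | 0 ≤ X.1.2.2.1 ∧ m₁ * X.1.2.2.1 ≤ X.1.2.2.2 ∧ X.1.2.2.2 ≤ m₂ * X.1.2.2.1}

/-- The coefficient functions of the system
`β' = Ψ(X)`, `t₊' = τ(X)`, `x₊' = χ(X)`, `p(v, a v) = G(X(v))`, `∂p/∂v = w(Z)`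
for `β`, `t₊`, `x₊` and `p = ∂t/∂u`, where `X` and `Z` are the shock and bulk variables, together
with the bounds near the base values that make it solvable. The decisive ones are `coeff_Ψ` and
`coeff_G`: the top order coefficients are at most `q₀ < 1 / a`. -/
structure SystemData where
  (a b₀ k₀ p₀ m₁ m₂ δ L q₀ : ℝ)
  (Ψ G τ χ : ShockVar → ℝ)
  (Ψ' G' τ' χ' : ShockVar → ShockVar →L[ℝ] ℝ)
  (w : BulkVar → ℝ)
  (w' : BulkVar → BulkVar →L[ℝ] ℝ)
  a_pos : 0 < a
  a_lt : a < 1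
  δ_pos : 0 < δ
  δ_le : δ ≤ 1
  L_nonneg : 0 ≤ L
  q₀_nonneg : 0 ≤ q₀
  q₀_lt : q₀ * a < 1
  tame_Ψ : IsTameOn Ψ Ψ' L
    (shockCone m₁ m₂ ∩ Metric.closedBall ((b₀, b₀, 0, 0), k₀, p₀) δ)
  tame_G : IsTameOn G G' L
    (shockCone m₁ m₂ ∩ Metric.closedBall ((b₀, b₀, 0, 0), k₀, p₀) δ)
  tame_τ : IsTameOn τ τ' L
    (shockCone m₁ m₂ ∩ Metric.closedBall ((b₀, b₀, 0, 0), k₀, p₀) δ)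
  tame_χ : IsTameOn χ χ' L
    (shockCone m₁ m₂ ∩ Metric.closedBall ((b₀, b₀, 0, 0), k₀, p₀) δ)
  tame_w : IsTameOn w w' L (Metric.closedBall (b₀, b₀, k₀, k₀, p₀, p₀) δ)
  coeff_Ψ : ∀ X ∈ shockCone m₁ m₂ ∩ Metric.closedBall ((b₀, b₀, 0, 0), k₀, p₀) δ,
    ∀ e : ShockVar, |Ψ' X e| ≤ q₀ * |e.2.1| + L * (‖e.1‖ + |e.2.2|)
  coeff_G : ∀ X ∈ shockCone m₁ m₂ ∩ Metric.closedBall ((b₀, b₀, 0, 0), k₀, p₀) δ,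
    ∀ e : ShockVar, |G' X e| ≤ q₀ * |e.2.2| + L * ‖e.1‖
  τ_nonneg : ∀ X ∈ shockCone m₁ m₂ ∩ Metric.closedBall ((b₀, b₀, 0, 0), k₀, p₀) δ, 0 ≤ τ X
  le_χ : ∀ X ∈ shockCone m₁ m₂ ∩ Metric.closedBall ((b₀, b₀, 0, 0), k₀, p₀) δ, m₁ * τ X ≤ χ X
  χ_le : ∀ X ∈ shockCone m₁ m₂ ∩ Metric.closedBall ((b₀, b₀, 0, 0), k₀, p₀) δ, χ X ≤ m₂ * τ X
  Ψ_base : Ψ ((b₀, b₀, 0, 0), k₀, p₀) = k₀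
  G_base : G ((b₀, b₀, 0, 0), k₀, p₀) = p₀

/-- The domain of the shock variables. -/
def SystemData.dom (𝒮 : SystemData) : Set ShockVar :=
  shockCone 𝒮.m₁ 𝒮.m₂ ∩ Metric.closedBall ((𝒮.b₀, 𝒮.b₀, 0, 0), 𝒮.k₀, 𝒮.p₀) 𝒮.δ

/-- The domain of the bulk variables. -/
def SystemData.bulkDom (𝒮 : SystemData) : Set BulkVar :=
  Metric.closedBall (𝒮.b₀, 𝒮.b₀, 𝒮.k₀, 𝒮.k₀, 𝒮.p₀, 𝒮.p₀) 𝒮.δ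

/-- The unknowns `κ = β''`, `dt = t₊'`, `dx = x₊'`, `p = ∂t/∂u`, `P = ∂p/∂u`, `W = ∂p/∂v`. -/
structure Fields where
  (κ dt dx : ℝ → ℝ)
  (p P W : ℝ → ℝ → ℝ)

section Iteration

variable (𝒮 : SystemData) (F : Fields)

namespace Fields

/-- `β'`. -/
def k (v : ℝ) : ℝ := 𝒮.k₀ + ∫ s in (0 : ℝ)..v, F.κ s

/-- `β`. -/
def b (v : ℝ) : ℝ := 𝒮.b₀ + ∫ s in (0 : ℝ)..v, F.k 𝒮 s

/-- `t₊`. -/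
def t (v : ℝ) : ℝ := ∫ s in (0 : ℝ)..v, F.dt s

/-- `x₊`. -/
def x (v : ℝ) : ℝ := ∫ s in (0 : ℝ)..v, F.dx s

/-- The shock variables at `(a v, v)`. -/
def X (v : ℝ) : ShockVar :=
  ((F.b 𝒮 v, F.b 𝒮 (𝒮.a * v), F.t v, F.x v), F.k 𝒮 (𝒮.a * v), F.p (𝒮.a * v) v)

/-- The derivative of the shock variables along the shock. -/
def dX (v : ℝ) : ShockVar :=
  ((F.k 𝒮 v, 𝒮.a * F.k 𝒮 (𝒮.a * v), F.dt v, F.dx v), 𝒮.a * F.κ (𝒮.a * v),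
    𝒮.a * F.P (𝒮.a * v) v + F.W (𝒮.a * v) v)

/-- The bulk variables. -/
def Z (u v : ℝ) : BulkVar :=
  (F.b 𝒮 u, F.b 𝒮 v, F.k 𝒮 u, F.k 𝒮 v, F.p u v, F.p v u)

/-- The derivative of the bulk variables in the first coordinate. -/
def dZ (u v : ℝ) : BulkVar := (F.k 𝒮 u, 0, F.κ u, 0, F.P u v, F.W v u)

end Fields

/-- The projection of the line to `[0, ε]`. Composing with it turns functions on `[0, ε]` into
functions on the line, so that all fields live in one space of bounded continuous functions. -/
def clamp (ε v : ℝ) : ℝ := max 0 (min ε v)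

theorem continuous_clamp (ε : ℝ) : Continuous (clamp ε) := by
  unfold clamp; fun_prop

theorem clamp_mem {ε : ℝ} (hε : 0 ≤ ε) (v : ℝ) : clamp ε v ∈ Icc 0 ε :=
  ⟨le_max_left _ _, max_le hε (min_le_left _ _)⟩

theorem clamp_of_mem {ε v : ℝ} (hv : v ∈ Icc 0 ε) : clamp ε v = v := by
  rw [clamp, min_eq_right hv.2, max_eq_right hv.1]

/-- Radii `R₀`, `R₁`, `R₂` for `(dt, dx, W)`, `P` and `κ`, and a size `ε` of the square, for which
the iteration maps the admissible fields to themselves. -/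
structure Radii (R₀ R₁ R₂ ε : ℝ) : Prop where
  L_le : 𝒮.L ≤ R₀
  k₀_le : |𝒮.k₀| + 1 ≤ R₀
  R₁_ge : 𝒮.q₀ * (𝒮.a * R₁ + R₀) + 𝒮.L * R₀ + 𝒮.a * R₀ + 1 ≤ R₁
  R₂_ge : 𝒮.q₀ * (𝒮.a * R₂) + 𝒮.L * (R₀ + (𝒮.a * R₁ + R₀)) ≤ R₂
  R₁_nonneg : 0 ≤ R₁
  R₂_nonneg : 0 ≤ R₂
  ε_pos : 0 < ε
  ε_le : ε ≤ 1
  ε_le_δ : (R₀ + R₁ + R₂) * ε ≤ 𝒮.δ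
  ε_le_L : 𝒮.L * (R₀ + R₁ + R₂) * ε ≤ 1

theorem Radii.R₀_nonneg {𝒮 : SystemData} {R₀ R₁ R₂ ε : ℝ} (hR : Radii 𝒮 R₀ R₁ R₂ ε) :
    0 ≤ R₀ := by
  have := hR.k₀_le; have := abs_nonneg 𝒮.k₀; linarith

/-- The fields among which the fixed point is sought. The last conditions say that they are
determined by their values on `[0, ε]` and `[0, ε]²`. -/
structure Admissible (R₀ R₁ R₂ ε : ℝ) : Prop where
  cont_κ : Continuous F.κ
  cont_dt : Continuous F.dt
  cont_dx : Continuous F.dx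
  cont_p : Continuous fun y : ℝ × ℝ => F.p y.1 y.2
  cont_P : Continuous fun y : ℝ × ℝ => F.P y.1 y.2
  cont_W : Continuous fun y : ℝ × ℝ => F.W y.1 y.2
  κ_le : ∀ v, |F.κ v| ≤ R₂
  dt_le : ∀ v, |F.dt v| ≤ R₀
  dx_le : ∀ v, |F.dx v| ≤ R₀
  P_le : ∀ u v, |F.P u v| ≤ R₁
  W_le : ∀ u v, |F.W u v| ≤ R₀
  dt_nonneg : ∀ v, 0 ≤ F.dt v
  le_dx : ∀ v, 𝒮.m₁ * F.dt v ≤ F.dx v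
  dx_le' : ∀ v, F.dx v ≤ 𝒮.m₂ * F.dt v
  primitive : IsPrimitiveOnSquare ε F.p F.P F.W
  p_zero : F.p 0 0 = 𝒮.p₀
  κ_clamp : ∀ v, F.κ (clamp ε v) = F.κ v
  dt_clamp : ∀ v, F.dt (clamp ε v) = F.dt v
  dx_clamp : ∀ v, F.dx (clamp ε v) = F.dx v
  p_clamp : ∀ u v, F.p (clamp ε u) (clamp ε v) = F.p u v
  P_clamp : ∀ u v, F.P (clamp ε u) (clamp ε v) = F.P u v
  W_clamp : ∀ u v, F.W (clamp ε u) (clamp ε v) = F.W u v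

theorem abs_integral_le {f : ℝ → ℝ} {u v c ε : ℝ} (hc : 0 ≤ c) (hu : u ∈ Icc 0 ε)
    (hv : v ∈ Icc 0 ε) (h : ∀ s ∈ Icc 0 ε, |f s| ≤ c) : |∫ s in u..v, f s| ≤ c * ε := by
  have h1 : |∫ s in u..v, f s| ≤ c * |v - u| := by
    rw [← Real.norm_eq_abs]
    refine intervalIntegral.norm_integral_le_of_norm_le_const fun s hs => h s ?_
    have := uIoc_subset_uIcc hs
    exact (uIcc_subset_Icc hu hv) this
  refine h1.trans (mul_le_mul_of_nonneg_left ?_ hc)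
  rw [abs_le]
  constructor <;> linarith [hu.1, hu.2, hv.1, hv.2]

theorem mul_mem_Icc {a ε v : ℝ} (ha : 0 < a) (ha' : a < 1) (hv : v ∈ Icc 0 ε) :
    a * v ∈ Icc 0 ε :=
  ⟨mul_nonneg ha.le hv.1, by nlinarith [hv.1, hv.2]⟩

theorem hasDerivAt_add_integral {f : ℝ → ℝ} (hf : Continuous f) (c v : ℝ) :
    HasDerivAt (fun v => c + ∫ s in (0 : ℝ)..v, f s) (f v) v :=
  ((hf.integral_hasStrictDerivAt 0 v).hasDerivAt).const_add c

namespace Admissible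

variable {𝒮 F} {R₀ R₁ R₂ ε : ℝ} (h : Admissible 𝒮 F R₀ R₁ R₂ ε) (hR : Radii 𝒮 R₀ R₁ R₂ ε)

include h

theorem hasDerivAt_k (v : ℝ) : HasDerivAt (F.k 𝒮) (F.κ v) v :=
  hasDerivAt_add_integral h.cont_κ _ _

theorem cont_k : Continuous (F.k 𝒮) :=
  continuous_iff_continuousAt.2 fun v => (h.hasDerivAt_k v).continuousAt

theorem hasDerivAt_b (v : ℝ) : HasDerivAt (F.b 𝒮) (F.k 𝒮 v) v :=
  hasDerivAt_add_integral h.cont_k _ _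

theorem cont_b : Continuous (F.b 𝒮) :=
  continuous_iff_continuousAt.2 fun v => (h.hasDerivAt_b v).continuousAt

theorem hasDerivAt_t (v : ℝ) : HasDerivAt F.t (F.dt v) v :=
  (h.cont_dt.integral_hasStrictDerivAt 0 v).hasDerivAt

theorem cont_t : Continuous F.t :=
  continuous_iff_continuousAt.2 fun v => (h.hasDerivAt_t v).continuousAt

theorem hasDerivAt_x (v : ℝ) : HasDerivAt F.x (F.dx v) v :=
  (h.cont_dx.integral_hasStrictDerivAt 0 v).hasDerivAt

theorem cont_x : Continuous F.x :=
  continuous_iff_continuousAt.2 fun v => (h.hasDerivAt_x v).continuousAt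

theorem cont_X : Continuous (F.X 𝒮) := by
  have h1 := h.cont_b
  have h2 := h.cont_k
  have h3 := h.cont_t
  have h4 := h.cont_x
  have h5 : Continuous fun v => F.p (𝒮.a * v) v :=
    h.cont_p.comp (by fun_prop : Continuous fun v : ℝ => (𝒮.a * v, v))
  unfold Fields.X
  fun_prop

theorem cont_dX : Continuous (F.dX 𝒮) := by
  have h1 := h.cont_κ
  have h2 := h.cont_k
  have h3 := h.cont_dt
  have h4 := h.cont_dx
  have h5 : Continuous fun v => F.P (𝒮.a * v) v :=
    h.cont_P.comp (by fun_prop : Continuous fun v : ℝ => (𝒮.a * v, v))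
  have h6 : Continuous fun v => F.W (𝒮.a * v) v :=
    h.cont_W.comp (by fun_prop : Continuous fun v : ℝ => (𝒮.a * v, v))
  unfold Fields.dX
  fun_prop

theorem cont_Z : Continuous fun y : ℝ × ℝ => F.Z 𝒮 y.1 y.2 := by
  have h1 := h.cont_b
  have h2 := h.cont_k
  have h3 := h.cont_p
  have h4 : Continuous fun y : ℝ × ℝ => F.p y.2 y.1 := h.cont_p.comp continuous_swap
  unfold Fields.Z
  fun_prop

theorem cont_dZ : Continuous fun y : ℝ × ℝ => F.dZ 𝒮 y.1 y.2 := by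
  have h1 := h.cont_κ
  have h2 := h.cont_k
  have h3 := h.cont_P
  have h4 : Continuous fun y : ℝ × ℝ => F.W y.2 y.1 := h.cont_W.comp continuous_swap
  unfold Fields.dZ
  fun_prop

theorem hasDerivWithinAt_X {v : ℝ} (hv : v ∈ Icc 0 ε) :
    HasDerivWithinAt (F.X 𝒮) (F.dX 𝒮 v) (Icc 0 ε) v := by
  have hav := mul_mem_Icc 𝒮.a_pos 𝒮.a_lt hv
  have hm : HasDerivAt (fun v : ℝ => 𝒮.a * v) 𝒮.a v := by
    simpa using (hasDerivAt_id v).const_mul 𝒮.a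
  have h1 : HasDerivAt (fun v => F.b 𝒮 (𝒮.a * v)) (𝒮.a * F.k 𝒮 (𝒮.a * v)) v := by
    rw [mul_comm 𝒮.a (F.k 𝒮 _)]
    exact (h.hasDerivAt_b (𝒮.a * v)).comp v hm
  have h2 : HasDerivAt (fun v => F.k 𝒮 (𝒮.a * v)) (𝒮.a * F.κ (𝒮.a * v)) v := by
    rw [mul_comm 𝒮.a (F.κ _)]
    exact (h.hasDerivAt_k (𝒮.a * v)).comp v hm
  have h3 : HasDerivWithinAt (fun v => F.p (𝒮.a * v) v)
      (𝒮.a * F.P (𝒮.a * v) v + F.W (𝒮.a * v) v) (Icc 0 ε) v := by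
    have hf := h.primitive.hasFDerivWithinAt h.cont_P h.cont_W (z := (𝒮.a * v, v))
      ⟨hav, hv⟩
    have hg : HasDerivWithinAt (fun v : ℝ => (𝒮.a * v, v)) (𝒮.a, 1) (Icc 0 ε) v :=
      (hm.prodMk (hasDerivAt_id v)).hasDerivWithinAt
    have := hf.comp_hasDerivWithinAt (f := fun v : ℝ => (𝒮.a * v, v)) v hg
      fun s hs => ⟨mul_mem_Icc 𝒮.a_pos 𝒮.a_lt hs, hs⟩
    simpa [Function.comp_def, mul_comm] using this
  exact ((h.hasDerivAt_b v).hasDerivWithinAt.prodMk (h1.hasDerivWithinAt.prodMk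
    ((h.hasDerivAt_t v).hasDerivWithinAt.prodMk (h.hasDerivAt_x v).hasDerivWithinAt))).prodMk
    (h2.hasDerivWithinAt.prodMk h3)

theorem hasDerivWithinAt_Z {u v : ℝ} (hu : u ∈ Icc 0 ε) (hv : v ∈ Icc 0 ε) :
    HasDerivWithinAt (fun u => F.Z 𝒮 u v) (F.dZ 𝒮 u v) (Icc 0 ε) u := by
  have h1 : HasDerivWithinAt (fun u => F.p u v) (F.P u v) (Icc 0 ε) u := by
    have hf := h.primitive.hasFDerivWithinAt h.cont_P h.cont_W (z := (u, v)) ⟨hu, hv⟩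
    have hg : HasDerivWithinAt (fun u : ℝ => (u, v)) (1, 0) (Icc 0 ε) u :=
      ((hasDerivAt_id u).prodMk (hasDerivAt_const u v)).hasDerivWithinAt
    have := hf.comp_hasDerivWithinAt (f := fun u : ℝ => (u, v)) u hg fun s hs => ⟨hs, hv⟩
    simpa [Function.comp_def] using this
  have h2 : HasDerivWithinAt (fun u => F.p v u) (F.W v u) (Icc 0 ε) u := by
    have hf := h.primitive.hasFDerivWithinAt h.cont_P h.cont_W (z := (v, u)) ⟨hv, hu⟩
    have hg : HasDerivWithinAt (fun u : ℝ => (v, u)) (0, 1) (Icc 0 ε) u :=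
      ((hasDerivAt_const u v).prodMk (hasDerivAt_id u)).hasDerivWithinAt
    have := hf.comp_hasDerivWithinAt (f := fun u : ℝ => (v, u)) u hg fun s hs => ⟨hv, hs⟩
    simpa [Function.comp_def] using this
  exact (h.hasDerivAt_b u).hasDerivWithinAt.prodMk ((hasDerivWithinAt_const u _ _).prodMk
    ((h.hasDerivAt_k u).hasDerivWithinAt.prodMk ((hasDerivWithinAt_const u _ _).prodMk
      (h1.prodMk h2))))

theorem p_sub (u : ℝ) (hu : u ∈ Icc 0 ε) (v : ℝ) (hv : v ∈ Icc 0 ε) :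
    F.p u v = 𝒮.p₀ + (∫ s in (0 : ℝ)..v, F.W 0 s) + ∫ s in (0 : ℝ)..u, F.P s v := by
  have hε : (0 : ℝ) ∈ Icc 0 ε := ⟨le_rfl, hu.1.trans hu.2⟩
  rw [(h.primitive u hu v hv).1, (h.primitive 0 hε v hv).2, h.p_zero]

theorem abs_dX_snd_fst_le (v : ℝ) : |(F.dX 𝒮 v).2.1| ≤ 𝒮.a * R₂ := by
  change |𝒮.a * F.κ (𝒮.a * v)| ≤ _
  rw [abs_mul, abs_of_pos 𝒮.a_pos]
  exact mul_le_mul_of_nonneg_left (h.κ_le _) 𝒮.a_pos.le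

theorem abs_dX_snd_snd_le (v : ℝ) : |(F.dX 𝒮 v).2.2| ≤ 𝒮.a * R₁ + R₀ := by
  change |𝒮.a * F.P (𝒮.a * v) v + F.W (𝒮.a * v) v| ≤ _
  refine (abs_add_le _ _).trans (add_le_add ?_ (h.W_le _ _))
  rw [abs_mul, abs_of_pos 𝒮.a_pos]
  exact mul_le_mul_of_nonneg_left (h.P_le _ _) 𝒮.a_pos.le

include hR

theorem abs_k_sub_le {v : ℝ} (hv : v ∈ Icc 0 ε) : |F.k 𝒮 v - 𝒮.k₀| ≤ R₂ * ε := by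
  rw [Fields.k, add_sub_cancel_left]
  exact abs_integral_le hR.R₂_nonneg ⟨le_rfl, hR.ε_pos.le⟩ hv fun s _ => h.κ_le s

theorem abs_k_le {v : ℝ} (hv : v ∈ Icc 0 ε) : |F.k 𝒮 v| ≤ R₀ := by
  have h1 := h.abs_k_sub_le hR hv
  have h2 := hR.ε_le_δ
  have h3 := 𝒮.δ_le
  have h4 := hR.k₀_le
  have h5 := mul_nonneg hR.R₀_nonneg hR.ε_pos.le
  have h6 := mul_nonneg hR.R₁_nonneg hR.ε_pos.le
  have h7 := abs_sub_abs_le_abs_sub (F.k 𝒮 v) 𝒮.k₀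
  nlinarith

theorem abs_b_sub_le {v : ℝ} (hv : v ∈ Icc 0 ε) : |F.b 𝒮 v - 𝒮.b₀| ≤ R₀ * ε := by
  rw [Fields.b, add_sub_cancel_left]
  exact abs_integral_le hR.R₀_nonneg ⟨le_rfl, hR.ε_pos.le⟩ hv fun s hs => h.abs_k_le hR hs

theorem abs_t_le {v : ℝ} (hv : v ∈ Icc 0 ε) : |F.t v| ≤ R₀ * ε :=
  abs_integral_le hR.R₀_nonneg ⟨le_rfl, hR.ε_pos.le⟩ hv fun s _ => h.dt_le s

theorem abs_x_le {v : ℝ} (hv : v ∈ Icc 0 ε) : |F.x v| ≤ R₀ * ε :=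
  abs_integral_le hR.R₀_nonneg ⟨le_rfl, hR.ε_pos.le⟩ hv fun s _ => h.dx_le s

theorem abs_p_sub_le {u v : ℝ} (hu : u ∈ Icc 0 ε) (hv : v ∈ Icc 0 ε) :
    |F.p u v - 𝒮.p₀| ≤ (R₀ + R₁) * ε := by
  have h0 : (0 : ℝ) ∈ Icc 0 ε := ⟨le_rfl, hR.ε_pos.le⟩
  have e : F.p u v - 𝒮.p₀ = (∫ s in (0 : ℝ)..v, F.W 0 s) + ∫ s in (0 : ℝ)..u, F.P s v := by
    rw [h.p_sub u hu v hv]; ring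
  rw [e, add_mul]
  exact (abs_add_le _ _).trans (add_le_add
    (abs_integral_le hR.R₀_nonneg h0 hv fun s _ => h.W_le _ _)
    (abs_integral_le hR.R₁_nonneg h0 hu fun s _ => h.P_le _ _))

theorem X_mem {v : ℝ} (hv : v ∈ Icc 0 ε) : F.X 𝒮 v ∈ 𝒮.dom := by
  have hav := mul_mem_Icc 𝒮.a_pos 𝒮.a_lt hv
  have hR0 := mul_nonneg hR.R₀_nonneg hR.ε_pos.le
  have hR1 := mul_nonneg hR.R₁_nonneg hR.ε_pos.le
  have hR2 := mul_nonneg hR.R₂_nonneg hR.ε_pos.le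
  have hδ := hR.ε_le_δ
  have b1 := h.abs_b_sub_le hR hv
  have b2 := h.abs_b_sub_le hR hav
  have b3 := h.abs_t_le hR hv
  have b4 := h.abs_x_le hR hv
  have b5 := h.abs_k_sub_le hR hav
  have b6 := h.abs_p_sub_le hR hav hv
  refine ⟨⟨?_, ?_, ?_⟩, ?_⟩
  · exact intervalIntegral.integral_nonneg hv.1 fun s _ => h.dt_nonneg s
  · change 𝒮.m₁ * (∫ s in (0 : ℝ)..v, F.dt s) ≤ ∫ s in (0 : ℝ)..v, F.dx s
    rw [← intervalIntegral.integral_const_mul]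
    exact intervalIntegral.integral_mono_on hv.1
      ((continuous_const.mul h.cont_dt).intervalIntegrable _ _)
      (h.cont_dx.intervalIntegrable _ _) fun s _ => h.le_dx s
  · change (∫ s in (0 : ℝ)..v, F.dx s) ≤ 𝒮.m₂ * (∫ s in (0 : ℝ)..v, F.dt s)
    rw [← intervalIntegral.integral_const_mul]
    exact intervalIntegral.integral_mono_on hv.1 (h.cont_dx.intervalIntegrable _ _)
      ((continuous_const.mul h.cont_dt).intervalIntegrable _ _) fun s _ => h.dx_le' s
  · simp only [Fields.X, Metric.mem_closedBall, Prod.dist_eq, Real.dist_eq, max_le_iff, sub_zero]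
    refine ⟨⟨?_, ?_, ?_, ?_⟩, ?_, ?_⟩ <;> linarith

theorem Z_mem {u v : ℝ} (hu : u ∈ Icc 0 ε) (hv : v ∈ Icc 0 ε) : F.Z 𝒮 u v ∈ 𝒮.bulkDom := by
  have hR0 := mul_nonneg hR.R₀_nonneg hR.ε_pos.le
  have hR1 := mul_nonneg hR.R₁_nonneg hR.ε_pos.le
  have hR2 := mul_nonneg hR.R₂_nonneg hR.ε_pos.le
  have hδ := hR.ε_le_δ
  have b1 := h.abs_b_sub_le hR hu
  have b2 := h.abs_b_sub_le hR hv
  have b3 := h.abs_k_sub_le hR hu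
  have b4 := h.abs_k_sub_le hR hv
  have b5 := h.abs_p_sub_le hR hu hv
  have b6 := h.abs_p_sub_le hR hv hu
  simp only [Fields.Z, SystemData.bulkDom, Metric.mem_closedBall, Prod.dist_eq, Real.dist_eq,
    max_le_iff]
  refine ⟨?_, ?_, ?_, ?_, ?_, ?_⟩ <;> linarith

theorem norm_dX_fst_le {v : ℝ} (hv : v ∈ Icc 0 ε) : ‖(F.dX 𝒮 v).1‖ ≤ R₀ := by
  have hav := mul_mem_Icc 𝒮.a_pos 𝒮.a_lt hv
  have h1 : |𝒮.a * F.k 𝒮 (𝒮.a * v)| ≤ R₀ := by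
    rw [abs_mul, abs_of_pos 𝒮.a_pos]
    nlinarith [h.abs_k_le hR hav, 𝒮.a_lt, 𝒮.a_pos, hR.R₀_nonneg]
  simp only [Fields.dX, Prod.norm_def, Real.norm_eq_abs, max_le_iff]
  exact ⟨h.abs_k_le hR hv, h1, h.dt_le v, h.dx_le v⟩

theorem norm_dX_le {v : ℝ} (hv : v ∈ Icc 0 ε) : ‖F.dX 𝒮 v‖ ≤ R₀ + R₁ + R₂ := by
  have h1 := h.norm_dX_fst_le hR hv
  have h2 := h.abs_dX_snd_fst_le v
  have h3 := h.abs_dX_snd_snd_le v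
  have h4 := hR.R₀_nonneg
  have h5 := hR.R₁_nonneg
  have h6 := hR.R₂_nonneg
  have h7 := 𝒮.a_lt
  rw [Prod.norm_def, Prod.norm_def (F.dX 𝒮 v).2, Real.norm_eq_abs, Real.norm_eq_abs]
  refine max_le (by linarith) (max_le (by nlinarith) (by nlinarith))

theorem norm_dZ_le {u v : ℝ} (hu : u ∈ Icc 0 ε) : ‖F.dZ 𝒮 u v‖ ≤ R₀ + R₁ + R₂ := by
  have h1 := h.abs_k_le hR hu
  have h2 := h.κ_le u
  have h3 := h.P_le u v
  have h3' := h.W_le v u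
  have h4 := hR.R₀_nonneg
  have h5 := hR.R₁_nonneg
  have h6 := hR.R₂_nonneg
  simp only [Fields.dZ, Prod.norm_def, Real.norm_eq_abs, max_le_iff, abs_zero]
  refine ⟨?_, ?_, ?_, ?_, ?_, ?_⟩ <;> linarith

end Admissible

/-! ### The iteration map -/

variable (ε : ℝ)

namespace Fields

/-- `w` along the bulk variables. -/
def wZ (u v : ℝ) : ℝ := 𝒮.w (F.Z 𝒮 (clamp ε u) (clamp ε v))

/-- The derivative of `w` along the bulk variables in the first coordinate. -/
def dwZ (u v : ℝ) : ℝ :=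
  𝒮.w' (F.Z 𝒮 (clamp ε u) (clamp ε v)) (F.dZ 𝒮 (clamp ε u) (clamp ε v))

/-- The iteration map: `β' = Ψ(X)` and `p(u, v) = G(X(u)) + ∫_{a u}^v w(Z(u, s)) ds`, together with
their derivatives, and `t₊' = τ(X)`, `x₊' = χ(X)`. -/
def step : Fields where
  κ v := 𝒮.Ψ' (F.X 𝒮 (clamp ε v)) (F.dX 𝒮 (clamp ε v))
  dt v := 𝒮.τ (F.X 𝒮 (clamp ε v))
  dx v := 𝒮.χ (F.X 𝒮 (clamp ε v))
  p u v := 𝒮.G (F.X 𝒮 (clamp ε u)) + ((∫ s in (0 : ℝ)..clamp ε v, F.wZ 𝒮 ε (clamp ε u) s) -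
    ∫ s in (0 : ℝ)..𝒮.a * clamp ε u, F.wZ 𝒮 ε (clamp ε u) s)
  P u v := 𝒮.G' (F.X 𝒮 (clamp ε u)) (F.dX 𝒮 (clamp ε u)) -
    𝒮.a * F.wZ 𝒮 ε (clamp ε u) (𝒮.a * clamp ε u) +
    ((∫ s in (0 : ℝ)..clamp ε v, F.dwZ 𝒮 ε (clamp ε u) s) -
      ∫ s in (0 : ℝ)..𝒮.a * clamp ε u, F.dwZ 𝒮 ε (clamp ε u) s)
  W u v := F.wZ 𝒮 ε u v

end Fields

theorem clamp_clamp {ε : ℝ} (hε : 0 ≤ ε) (v : ℝ) : clamp ε (clamp ε v) = clamp ε v :=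
  clamp_of_mem (clamp_mem hε v)

namespace Admissible

variable {𝒮 F ε} {R₀ R₁ R₂ : ℝ} (h : Admissible 𝒮 F R₀ R₁ R₂ ε) (hR : Radii 𝒮 R₀ R₁ R₂ ε)

include h

theorem X_zero : F.X 𝒮 0 = ((𝒮.b₀, 𝒮.b₀, 0, 0), 𝒮.k₀, 𝒮.p₀) := by
  simp [Fields.X, Fields.b, Fields.k, Fields.t, Fields.x, h.p_zero]

include hR

theorem cont_comp_X {E : Type*} [TopologicalSpace E] {f : ShockVar → E}
    (hf : ContinuousOn f 𝒮.dom) : Continuous fun v => f (F.X 𝒮 (clamp ε v)) :=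
  hf.comp_continuous (h.cont_X.comp (continuous_clamp ε))
    fun v => h.X_mem hR (clamp_mem hR.ε_pos.le v)

theorem cont_comp_Z {E : Type*} [TopologicalSpace E] {f : BulkVar → E}
    (hf : ContinuousOn f 𝒮.bulkDom) :
    Continuous fun y : ℝ × ℝ => f (F.Z 𝒮 (clamp ε y.1) (clamp ε y.2)) :=
  hf.comp_continuous (h.cont_Z.comp (((continuous_clamp ε).comp continuous_fst).prodMk
    ((continuous_clamp ε).comp continuous_snd)))
    fun y => h.Z_mem hR (clamp_mem hR.ε_pos.le y.1) (clamp_mem hR.ε_pos.le y.2)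

theorem cont_wZ : Continuous fun y : ℝ × ℝ => F.wZ 𝒮 ε y.1 y.2 :=
  h.cont_comp_Z hR 𝒮.tame_w.continuousOn

theorem cont_dwZ : Continuous fun y : ℝ × ℝ => F.dwZ 𝒮 ε y.1 y.2 :=
  (h.cont_comp_Z hR 𝒮.tame_w.continuousOn_deriv).clm_apply
    (h.cont_dZ.comp (((continuous_clamp ε).comp continuous_fst).prodMk
      ((continuous_clamp ε).comp continuous_snd)))

theorem abs_wZ_le (u v : ℝ) : |F.wZ 𝒮 ε u v| ≤ R₀ :=
  (𝒮.tame_w.abs_le _ (h.Z_mem hR (clamp_mem hR.ε_pos.le u) (clamp_mem hR.ε_pos.le v))).trans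
    hR.L_le

theorem abs_dwZ_le (u v : ℝ) : |F.dwZ 𝒮 ε u v| ≤ 𝒮.L * (R₀ + R₁ + R₂) := by
  have hu := clamp_mem hR.ε_pos.le u
  have hv := clamp_mem hR.ε_pos.le v
  rw [← Real.norm_eq_abs]
  refine ((𝒮.w' _).le_opNorm _).trans (mul_le_mul (𝒮.tame_w.norm_le _ (h.Z_mem hR hu hv))
    (h.norm_dZ_le hR hu) (norm_nonneg _) 𝒮.L_nonneg)

theorem wZ_eq_add_integral {u : ℝ} (hu : u ∈ Icc 0 ε) {s : ℝ} (hs : s ∈ Icc 0 ε) :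
    F.wZ 𝒮 ε u s = F.wZ 𝒮 ε 0 s + ∫ σ in (0 : ℝ)..u, F.dwZ 𝒮 ε σ s := by
  refine eq_add_integral_of_hasDerivWithinAt (f := fun u => F.wZ 𝒮 ε u s)
    (f' := fun σ => F.dwZ 𝒮 ε σ s) (fun σ hσ => ?_) ?_ hu
  · have h1 := (𝒮.tame_w.hasFDerivWithinAt _ (h.Z_mem hR hσ hs)).comp_hasDerivWithinAt
      (f := fun u => F.Z 𝒮 u s) σ (h.hasDerivWithinAt_Z hσ hs) fun y hy => h.Z_mem hR hy hs
    have e : F.dwZ 𝒮 ε σ s = 𝒮.w' (F.Z 𝒮 σ s) (F.dZ 𝒮 σ s) := by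
      rw [Fields.dwZ, clamp_of_mem hσ, clamp_of_mem hs]
    rw [e]
    refine h1.congr_of_mem (fun y hy => ?_) hσ
    rw [Fields.wZ, clamp_of_mem hy, clamp_of_mem hs]
    rfl
  · exact ((h.cont_dwZ hR).comp (by fun_prop : Continuous fun σ : ℝ => (σ, s))).continuousOn

/-- The equation for `p` is differentiated under the integral sign. -/
theorem step_p_hasDerivWithinAt {u v : ℝ} (hu : u ∈ Icc 0 ε) (hv : v ∈ Icc 0 ε) :
    HasDerivWithinAt (fun u => (F.step 𝒮 ε).p u v) ((F.step 𝒮 ε).P u v) (Icc 0 ε) u := by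
  have hau := mul_mem_Icc 𝒮.a_pos 𝒮.a_lt hu
  have hprim : IsPrimitiveOnSquare ε (fun u v => ∫ s in (0 : ℝ)..v, F.wZ 𝒮 ε u s)
      (fun u v => ∫ s in (0 : ℝ)..v, F.dwZ 𝒮 ε u s) (F.wZ 𝒮 ε) :=
    isPrimitiveOnSquare_integral (h.cont_wZ hR) (h.cont_dwZ hR)
      fun u hu s hs => h.wZ_eq_add_integral hR hu hs
  have hcont : Continuous fun y : ℝ × ℝ => ∫ s in (0 : ℝ)..y.2, F.dwZ 𝒮 ε y.1 s :=
    intervalIntegral.continuous_parametric_intervalIntegral_of_continuous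
      (f := fun (y : ℝ × ℝ) s => F.dwZ 𝒮 ε y.1 s)
      ((h.cont_dwZ hR).comp (by fun_prop : Continuous fun z : (ℝ × ℝ) × ℝ => (z.1.1, z.2)))
      continuous_snd
  have d1 : HasDerivWithinAt (fun u => 𝒮.G (F.X 𝒮 u)) (𝒮.G' (F.X 𝒮 u) (F.dX 𝒮 u))
      (Icc 0 ε) u :=
    (𝒮.tame_G.hasFDerivWithinAt _ (h.X_mem hR hu)).comp_hasDerivWithinAt u
      (h.hasDerivWithinAt_X hu) fun y hy => h.X_mem hR hy
  have d2 : HasDerivWithinAt (fun u => ∫ s in (0 : ℝ)..v, F.wZ 𝒮 ε u s)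
      (∫ s in (0 : ℝ)..v, F.dwZ 𝒮 ε u s) (Icc 0 ε) u := by
    have hg : HasDerivWithinAt (fun u : ℝ => (u, v)) (1, 0) (Icc 0 ε) u :=
      ((hasDerivAt_id u).prodMk (hasDerivAt_const u v)).hasDerivWithinAt
    have := (hprim.hasFDerivWithinAt hcont (h.cont_wZ hR) (z := (u, v))
      ⟨hu, hv⟩).comp_hasDerivWithinAt (f := fun u : ℝ => (u, v)) u hg fun s hs => ⟨hs, hv⟩
    simpa [Function.comp_def] using this
  have d3 : HasDerivWithinAt (fun u => ∫ s in (0 : ℝ)..𝒮.a * u, F.wZ 𝒮 ε u s)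
      ((∫ s in (0 : ℝ)..𝒮.a * u, F.dwZ 𝒮 ε u s) + F.wZ 𝒮 ε u (𝒮.a * u) * 𝒮.a)
      (Icc 0 ε) u := by
    have hm : HasDerivAt (fun v : ℝ => 𝒮.a * v) 𝒮.a u := by
      simpa using (hasDerivAt_id u).const_mul 𝒮.a
    have hg : HasDerivWithinAt (fun u : ℝ => (u, 𝒮.a * u)) (1, 𝒮.a) (Icc 0 ε) u :=
      ((hasDerivAt_id u).prodMk hm).hasDerivWithinAt
    have := (hprim.hasFDerivWithinAt hcont (h.cont_wZ hR) (z := (u, 𝒮.a * u))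
      ⟨hu, hau⟩).comp_hasDerivWithinAt (f := fun u : ℝ => (u, 𝒮.a * u)) u hg
        fun s hs => ⟨hs, mul_mem_Icc 𝒮.a_pos 𝒮.a_lt hs⟩
    simpa [Function.comp_def] using this
  have d := d1.add (d2.sub d3)
  have e : (F.step 𝒮 ε).P u v = 𝒮.G' (F.X 𝒮 u) (F.dX 𝒮 u) +
      ((∫ s in (0 : ℝ)..v, F.dwZ 𝒮 ε u s) -
        ((∫ s in (0 : ℝ)..𝒮.a * u, F.dwZ 𝒮 ε u s) + F.wZ 𝒮 ε u (𝒮.a * u) * 𝒮.a)) := by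
    simp only [Fields.step, clamp_of_mem hu, clamp_of_mem hv]
    ring
  rw [e]
  refine d.congr_of_mem (fun y hy => ?_) hu
  simp only [Fields.step, clamp_of_mem hy, clamp_of_mem hv]
  rfl

theorem cont_step_p : Continuous fun y : ℝ × ℝ => (F.step 𝒮 ε).p y.1 y.2 := by
  have c1 : Continuous fun y : ℝ × ℝ => clamp ε y.1 := (continuous_clamp ε).comp continuous_fst
  have c2 : Continuous fun y : ℝ × ℝ => clamp ε y.2 := (continuous_clamp ε).comp continuous_snd
  have c3 : Continuous fun z : (ℝ × ℝ) × ℝ => F.wZ 𝒮 ε (clamp ε z.1.1) z.2 :=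
    (h.cont_wZ hR).comp ((c1.comp continuous_fst).prodMk continuous_snd)
  exact ((h.cont_comp_X hR 𝒮.tame_G.continuousOn).comp continuous_fst).add
    ((intervalIntegral.continuous_parametric_intervalIntegral_of_continuous
      (f := fun (y : ℝ × ℝ) s => F.wZ 𝒮 ε (clamp ε y.1) s) c3 c2).sub
    (intervalIntegral.continuous_parametric_intervalIntegral_of_continuous
      (f := fun (y : ℝ × ℝ) s => F.wZ 𝒮 ε (clamp ε y.1) s) c3 (continuous_const.mul c1)))

theorem cont_step_P : Continuous fun y : ℝ × ℝ => (F.step 𝒮 ε).P y.1 y.2 := by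
  have c1 : Continuous fun y : ℝ × ℝ => clamp ε y.1 := (continuous_clamp ε).comp continuous_fst
  have c2 : Continuous fun y : ℝ × ℝ => clamp ε y.2 := (continuous_clamp ε).comp continuous_snd
  have c3 : Continuous fun z : (ℝ × ℝ) × ℝ => F.dwZ 𝒮 ε (clamp ε z.1.1) z.2 :=
    (h.cont_dwZ hR).comp ((c1.comp continuous_fst).prodMk continuous_snd)
  have c4 : Continuous fun y : ℝ × ℝ => F.wZ 𝒮 ε (clamp ε y.1) (𝒮.a * clamp ε y.1) :=
    (h.cont_wZ hR).comp (c1.prodMk (continuous_const.mul c1))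
  have c5 : Continuous fun y : ℝ × ℝ => 𝒮.G' (F.X 𝒮 (clamp ε y.1)) (F.dX 𝒮 (clamp ε y.1)) :=
    ((h.cont_comp_X hR 𝒮.tame_G.continuousOn_deriv).clm_apply
      (h.cont_dX.comp (continuous_clamp ε))).comp continuous_fst
  exact (c5.sub (continuous_const.mul c4)).add
    ((intervalIntegral.continuous_parametric_intervalIntegral_of_continuous
      (f := fun (y : ℝ × ℝ) s => F.dwZ 𝒮 ε (clamp ε y.1) s) c3 c2).sub
    (intervalIntegral.continuous_parametric_intervalIntegral_of_continuous
      (f := fun (y : ℝ × ℝ) s => F.dwZ 𝒮 ε (clamp ε y.1) s) c3 (continuous_const.mul c1)))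

theorem abs_step_κ_le (v : ℝ) : |(F.step 𝒮 ε).κ v| ≤ R₂ := by
  have hv := clamp_mem hR.ε_pos.le v
  refine (𝒮.coeff_Ψ _ (h.X_mem hR hv) (F.dX 𝒮 (clamp ε v))).trans (le_trans ?_ hR.R₂_ge)
  have h0 := 𝒮.q₀_nonneg
  have h1 := 𝒮.L_nonneg
  gcongr
  · exact h.abs_dX_snd_fst_le _
  · exact h.norm_dX_fst_le hR hv
  · exact h.abs_dX_snd_snd_le _

theorem abs_step_P_le (u v : ℝ) : |(F.step 𝒮 ε).P u v| ≤ R₁ := by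
  have hu := clamp_mem hR.ε_pos.le u
  have hv := clamp_mem hR.ε_pos.le v
  have hau := mul_mem_Icc 𝒮.a_pos 𝒮.a_lt hu
  have h0 := 𝒮.q₀_nonneg
  have h1 := 𝒮.L_nonneg
  have hc : Continuous fun s => F.dwZ 𝒮 ε (clamp ε u) s :=
    (h.cont_dwZ hR).comp (by fun_prop : Continuous fun s : ℝ => (clamp ε u, s))
  have b1 : |𝒮.G' (F.X 𝒮 (clamp ε u)) (F.dX 𝒮 (clamp ε u))| ≤
      𝒮.q₀ * (𝒮.a * R₁ + R₀) + 𝒮.L * R₀ := by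
    refine (𝒮.coeff_G _ (h.X_mem hR hu) (F.dX 𝒮 (clamp ε u))).trans ?_
    gcongr
    · exact h.abs_dX_snd_snd_le _
    · exact h.norm_dX_fst_le hR hu
  have b2 : |𝒮.a * F.wZ 𝒮 ε (clamp ε u) (𝒮.a * clamp ε u)| ≤ 𝒮.a * R₀ := by
    rw [abs_mul, abs_of_pos 𝒮.a_pos]
    exact mul_le_mul_of_nonneg_left (h.abs_wZ_le hR _ _) 𝒮.a_pos.le
  have b3 : |(∫ s in (0 : ℝ)..clamp ε v, F.dwZ 𝒮 ε (clamp ε u) s) -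
      ∫ s in (0 : ℝ)..𝒮.a * clamp ε u, F.dwZ 𝒮 ε (clamp ε u) s| ≤ 1 := by
    rw [intervalIntegral.integral_interval_sub_left (hc.intervalIntegrable _ _)
      (hc.intervalIntegrable _ _)]
    refine le_trans (abs_integral_le (c := 𝒮.L * (R₀ + R₁ + R₂)) ?_ hau hv
      fun s _ => h.abs_dwZ_le hR _ _) hR.ε_le_L
    have := hR.R₀_nonneg
    have := hR.R₁_nonneg
    have := hR.R₂_nonneg
    positivity
  have hb := hR.R₁_ge
  simp only [Fields.step]
  refine (abs_add_le _ _).trans ?_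
  have := abs_sub (𝒮.G' (F.X 𝒮 (clamp ε u)) (F.dX 𝒮 (clamp ε u)))
    (𝒮.a * F.wZ 𝒮 ε (clamp ε u) (𝒮.a * clamp ε u))
  linarith

theorem step_admissible : Admissible 𝒮 (F.step 𝒮 ε) R₀ R₁ R₂ ε where
  cont_κ := (h.cont_comp_X hR 𝒮.tame_Ψ.continuousOn_deriv).clm_apply
      (h.cont_dX.comp (continuous_clamp ε))
  cont_dt := h.cont_comp_X hR 𝒮.tame_τ.continuousOn
  cont_dx := h.cont_comp_X hR 𝒮.tame_χ.continuousOn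
  cont_p := h.cont_step_p hR
  cont_P := h.cont_step_P hR
  cont_W := h.cont_wZ hR
  κ_le := h.abs_step_κ_le hR
  dt_le v := (𝒮.tame_τ.abs_le _ (h.X_mem hR (clamp_mem hR.ε_pos.le v))).trans hR.L_le
  dx_le v := (𝒮.tame_χ.abs_le _ (h.X_mem hR (clamp_mem hR.ε_pos.le v))).trans hR.L_le
  P_le := h.abs_step_P_le hR
  W_le := h.abs_wZ_le hR
  dt_nonneg v := 𝒮.τ_nonneg _ (h.X_mem hR (clamp_mem hR.ε_pos.le v))
  le_dx v := 𝒮.le_χ _ (h.X_mem hR (clamp_mem hR.ε_pos.le v))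
  dx_le' v := 𝒮.χ_le _ (h.X_mem hR (clamp_mem hR.ε_pos.le v))
  primitive u hu v hv := by
    refine ⟨eq_add_integral_of_hasDerivWithinAt (f := fun u => (F.step 𝒮 ε).p u v)
      (f' := fun u => (F.step 𝒮 ε).P u v)
      (fun s hs => h.step_p_hasDerivWithinAt hR hs hv) ?_ hu, ?_⟩
    · exact ((h.cont_step_P hR).comp (by fun_prop : Continuous fun s : ℝ => (s, v))).continuousOn
    · have h0 : clamp ε 0 = 0 := clamp_of_mem ⟨le_rfl, hR.ε_pos.le⟩
      simp only [Fields.step, clamp_of_mem hu, clamp_of_mem hv, h0,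
        intervalIntegral.integral_same]
      ring
  p_zero := by
    have h0 : clamp ε 0 = 0 := clamp_of_mem ⟨le_rfl, hR.ε_pos.le⟩
    simp [Fields.step, h0, h.X_zero, 𝒮.G_base]
  κ_clamp v := by simp only [Fields.step, clamp_clamp hR.ε_pos.le]
  dt_clamp v := by simp only [Fields.step, clamp_clamp hR.ε_pos.le]
  dx_clamp v := by simp only [Fields.step, clamp_clamp hR.ε_pos.le]
  p_clamp u v := by simp only [Fields.step, clamp_clamp hR.ε_pos.le]
  P_clamp u v := by simp only [Fields.step, clamp_clamp hR.ε_pos.le]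
  W_clamp u v := by simp only [Fields.step, Fields.wZ, clamp_clamp hR.ε_pos.le]

end Admissible

end Iteration

/-! ### The contraction estimate -/

/-- `F₁` and `F₂` differ by at most `d₀` in `dt`, `dx` and `W`, `d₁` in `P` and `d₂` in `κ`. -/
structure IsClose (F₁ F₂ : Fields) (d₀ d₁ d₂ : ℝ) : Prop where
  κ : ∀ v, |F₁.κ v - F₂.κ v| ≤ d₂
  dt : ∀ v, |F₁.dt v - F₂.dt v| ≤ d₀
  dx : ∀ v, |F₁.dx v - F₂.dx v| ≤ d₀
  P : ∀ u v, |F₁.P u v - F₂.P u v| ≤ d₁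
  W : ∀ u v, |F₁.W u v - F₂.W u v| ≤ d₀

theorem abs_integral_sub_integral_le {f g : ℝ → ℝ} (hf : Continuous f) (hg : Continuous g)
    {u v c ε : ℝ} (hc : 0 ≤ c) (hu : u ∈ Icc 0 ε) (hv : v ∈ Icc 0 ε)
    (h : ∀ s ∈ Icc 0 ε, |f s - g s| ≤ c) :
    |(∫ s in u..v, f s) - ∫ s in u..v, g s| ≤ c * ε := by
  rw [← intervalIntegral.integral_sub (hf.intervalIntegrable _ _) (hg.intervalIntegrable _ _)]
  exact abs_integral_le hc hu hv h

theorem IsClose.nonneg {F₁ F₂ : Fields} {d₀ d₁ d₂ : ℝ} (hd : IsClose F₁ F₂ d₀ d₁ d₂) :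
    0 ≤ d₀ ∧ 0 ≤ d₁ ∧ 0 ≤ d₂ :=
  ⟨(abs_nonneg _).trans (hd.dt 0), (abs_nonneg _).trans (hd.P 0 0), (abs_nonneg _).trans (hd.κ 0)⟩

/-- The Lipschitz constant of the iteration map. -/
def SystemData.stepConst (𝒮 : SystemData) (R₀ R₁ R₂ : ℝ) : ℝ :=
  1 + 𝒮.q₀ + 5 * 𝒮.L + 2 * 𝒮.L * (R₀ + R₁ + R₂)

theorem abs_apply_sub_apply_le {E : Type*} [NormedAddCommGroup E] [NormedSpace ℝ E]
    {A B : E →L[ℝ] ℝ} {x y : E} {c r s : ℝ} (h₁ : |A (x - y)| ≤ c) (h₂ : ‖A - B‖ ≤ r)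
    (h₃ : ‖y‖ ≤ s) : |A x - B y| ≤ c + r * s := by
  have e : A x - B y = A (x - y) + (A - B) y := by simp
  rw [e]
  refine (abs_add_le _ _).trans (add_le_add h₁ ?_)
  rw [← Real.norm_eq_abs]
  exact ((A - B).le_opNorm y).trans
    (mul_le_mul h₂ h₃ (norm_nonneg _) ((norm_nonneg _).trans h₂))

namespace IsClose

variable {𝒮 : SystemData} {F₁ F₂ : Fields} {R₀ R₁ R₂ ε d₀ d₁ d₂ : ℝ}
  (hd : IsClose F₁ F₂ d₀ d₁ d₂) (h₁ : Admissible 𝒮 F₁ R₀ R₁ R₂ ε)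
  (h₂ : Admissible 𝒮 F₂ R₀ R₁ R₂ ε) (hR : Radii 𝒮 R₀ R₁ R₂ ε)

include hd h₁ h₂ hR

theorem abs_k_sub_le {v : ℝ} (hv : v ∈ Icc 0 ε) : |F₁.k 𝒮 v - F₂.k 𝒮 v| ≤ d₂ * ε := by
  rw [Fields.k, Fields.k, add_sub_add_left_eq_sub]
  exact abs_integral_sub_integral_le h₁.cont_κ h₂.cont_κ hd.nonneg.2.2 ⟨le_rfl, hR.ε_pos.le⟩ hv
    fun s _ => hd.κ s

theorem abs_b_sub_le {v : ℝ} (hv : v ∈ Icc 0 ε) : |F₁.b 𝒮 v - F₂.b 𝒮 v| ≤ d₂ * ε := by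
  rw [Fields.b, Fields.b, add_sub_add_left_eq_sub]
  have h0 := mul_nonneg hd.nonneg.2.2 hR.ε_pos.le
  refine (abs_integral_sub_integral_le h₁.cont_k h₂.cont_k h0 ⟨le_rfl, hR.ε_pos.le⟩ hv
    fun s hs => hd.abs_k_sub_le h₁ h₂ hR hs).trans ?_
  nlinarith [hR.ε_le]

theorem abs_t_sub_le {v : ℝ} (hv : v ∈ Icc 0 ε) : |F₁.t v - F₂.t v| ≤ d₀ * ε :=
  abs_integral_sub_integral_le h₁.cont_dt h₂.cont_dt hd.nonneg.1 ⟨le_rfl, hR.ε_pos.le⟩ hv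
    fun s _ => hd.dt s

theorem abs_x_sub_le {v : ℝ} (hv : v ∈ Icc 0 ε) : |F₁.x v - F₂.x v| ≤ d₀ * ε :=
  abs_integral_sub_integral_le h₁.cont_dx h₂.cont_dx hd.nonneg.1 ⟨le_rfl, hR.ε_pos.le⟩ hv
    fun s _ => hd.dx s

theorem abs_p_sub_le {u v : ℝ} (hu : u ∈ Icc 0 ε) (hv : v ∈ Icc 0 ε) :
    |F₁.p u v - F₂.p u v| ≤ (d₀ + d₁) * ε := by
  have h0 : (0 : ℝ) ∈ Icc 0 ε := ⟨le_rfl, hR.ε_pos.le⟩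
  have cW {F : Fields} (h : Admissible 𝒮 F R₀ R₁ R₂ ε) : Continuous fun s => F.W 0 s :=
    h.cont_W.comp (by fun_prop : Continuous fun s : ℝ => ((0 : ℝ), s))
  have cP {F : Fields} (h : Admissible 𝒮 F R₀ R₁ R₂ ε) : Continuous fun s => F.P s v :=
    h.cont_P.comp (by fun_prop : Continuous fun s : ℝ => (s, v))
  have e : F₁.p u v - F₂.p u v = ((∫ s in (0 : ℝ)..v, F₁.W 0 s) - ∫ s in (0 : ℝ)..v, F₂.W 0 s) +
      ((∫ s in (0 : ℝ)..u, F₁.P s v) - ∫ s in (0 : ℝ)..u, F₂.P s v) := by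
    rw [h₁.p_sub u hu v hv, h₂.p_sub u hu v hv]; ring
  rw [e, add_mul]
  exact (abs_add_le _ _).trans (add_le_add
    (abs_integral_sub_integral_le (cW h₁) (cW h₂) hd.nonneg.1 h0 hv fun s _ => hd.W _ _)
    (abs_integral_sub_integral_le (cP h₁) (cP h₂) hd.nonneg.2.1 h0 hu fun s _ => hd.P _ _))

theorem norm_X_sub_le {v : ℝ} (hv : v ∈ Icc 0 ε) :
    ‖F₁.X 𝒮 v - F₂.X 𝒮 v‖ ≤ (d₀ + d₁ + d₂) * ε := by
  have hav := mul_mem_Icc 𝒮.a_pos 𝒮.a_lt hv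
  have n0 := mul_nonneg hd.nonneg.1 hR.ε_pos.le
  have n1 := mul_nonneg hd.nonneg.2.1 hR.ε_pos.le
  have n2 := mul_nonneg hd.nonneg.2.2 hR.ε_pos.le
  have b1 := hd.abs_b_sub_le h₁ h₂ hR hv
  have b2 := hd.abs_b_sub_le h₁ h₂ hR hav
  have b3 := hd.abs_t_sub_le h₁ h₂ hR hv
  have b4 := hd.abs_x_sub_le h₁ h₂ hR hv
  have b5 := hd.abs_k_sub_le h₁ h₂ hR hav
  have b6 := hd.abs_p_sub_le h₁ h₂ hR hav hv
  simp only [Fields.X, Prod.mk_sub_mk, Prod.norm_def, Real.norm_eq_abs, max_le_iff]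
  refine ⟨⟨?_, ?_, ?_, ?_⟩, ?_, ?_⟩ <;> linarith

theorem norm_Z_sub_le {u v : ℝ} (hu : u ∈ Icc 0 ε) (hv : v ∈ Icc 0 ε) :
    ‖F₁.Z 𝒮 u v - F₂.Z 𝒮 u v‖ ≤ (d₀ + d₁ + d₂) * ε := by
  have n0 := mul_nonneg hd.nonneg.1 hR.ε_pos.le
  have n1 := mul_nonneg hd.nonneg.2.1 hR.ε_pos.le
  have n2 := mul_nonneg hd.nonneg.2.2 hR.ε_pos.le
  have b1 := hd.abs_b_sub_le h₁ h₂ hR hu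
  have b2 := hd.abs_b_sub_le h₁ h₂ hR hv
  have b3 := hd.abs_k_sub_le h₁ h₂ hR hu
  have b4 := hd.abs_k_sub_le h₁ h₂ hR hv
  have b5 := hd.abs_p_sub_le h₁ h₂ hR hu hv
  have b6 := hd.abs_p_sub_le h₁ h₂ hR hv hu
  simp only [Fields.Z, Prod.mk_sub_mk, Prod.norm_def, Real.norm_eq_abs, max_le_iff]
  refine ⟨?_, ?_, ?_, ?_, ?_, ?_⟩ <;> linarith

theorem norm_dX_sub_fst_le {v : ℝ} (hv : v ∈ Icc 0 ε) :
    ‖(F₁.dX 𝒮 v - F₂.dX 𝒮 v).1‖ ≤ d₀ + (d₀ + d₁ + d₂) * ε := by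
  have hav := mul_mem_Icc 𝒮.a_pos 𝒮.a_lt hv
  have n0 := mul_nonneg hd.nonneg.1 hR.ε_pos.le
  have n1 := mul_nonneg hd.nonneg.2.1 hR.ε_pos.le
  have n2 := mul_nonneg hd.nonneg.2.2 hR.ε_pos.le
  have n0' := hd.nonneg.1
  have b1 := hd.abs_k_sub_le h₁ h₂ hR hv
  have b2 : |𝒮.a * F₁.k 𝒮 (𝒮.a * v) - 𝒮.a * F₂.k 𝒮 (𝒮.a * v)| ≤ d₂ * ε := by
    rw [← mul_sub, abs_mul, abs_of_pos 𝒮.a_pos]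
    nlinarith [hd.abs_k_sub_le h₁ h₂ hR hav, 𝒮.a_lt, 𝒮.a_pos]
  have b3 := hd.dt v
  have b4 := hd.dx v
  simp only [Fields.dX, Prod.mk_sub_mk, Prod.norm_def, Real.norm_eq_abs, max_le_iff]
  refine ⟨?_, ?_, ?_, ?_⟩ <;> linarith

omit h₁ h₂ hR in
theorem abs_dX_sub_snd_fst_le (v : ℝ) :
    |(F₁.dX 𝒮 v - F₂.dX 𝒮 v).2.1| ≤ 𝒮.a * d₂ := by
  change |𝒮.a * F₁.κ (𝒮.a * v) - 𝒮.a * F₂.κ (𝒮.a * v)| ≤ _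
  rw [← mul_sub, abs_mul, abs_of_pos 𝒮.a_pos]
  exact mul_le_mul_of_nonneg_left (hd.κ _) 𝒮.a_pos.le

omit h₁ h₂ hR in
theorem abs_dX_sub_snd_snd_le (v : ℝ) :
    |(F₁.dX 𝒮 v - F₂.dX 𝒮 v).2.2| ≤ 𝒮.a * d₁ + d₀ := by
  have e : (F₁.dX 𝒮 v - F₂.dX 𝒮 v).2.2 = 𝒮.a * (F₁.P (𝒮.a * v) v - F₂.P (𝒮.a * v) v) +
      (F₁.W (𝒮.a * v) v - F₂.W (𝒮.a * v) v) := by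
    simp only [Fields.dX, Prod.mk_sub_mk]; ring
  rw [e]
  refine (abs_add_le _ _).trans (add_le_add ?_ (hd.W _ _))
  rw [abs_mul, abs_of_pos 𝒮.a_pos]
  exact mul_le_mul_of_nonneg_left (hd.P _ _) 𝒮.a_pos.le

theorem norm_dZ_sub_le {u v : ℝ} (hu : u ∈ Icc 0 ε) :
    ‖F₁.dZ 𝒮 u v - F₂.dZ 𝒮 u v‖ ≤ d₀ + d₁ + d₂ := by
  obtain ⟨n0, n1, n2⟩ := hd.nonneg
  have b1 : |F₁.k 𝒮 u - F₂.k 𝒮 u| ≤ d₂ :=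
    (hd.abs_k_sub_le h₁ h₂ hR hu).trans (mul_le_of_le_one_right n2 hR.ε_le)
  have b2 := hd.κ u
  have b3 := hd.P u v
  have b4 := hd.W v u
  simp only [Fields.dZ, Prod.mk_sub_mk, Prod.norm_def, Real.norm_eq_abs, max_le_iff, sub_self,
    abs_zero]
  refine ⟨?_, ?_, ?_, ?_, ?_, ?_⟩ <;> linarith

theorem abs_wZ_sub_le (u v : ℝ) :
    |F₁.wZ 𝒮 ε u v - F₂.wZ 𝒮 ε u v| ≤ 𝒮.L * ((d₀ + d₁ + d₂) * ε) := by
  have hu := clamp_mem hR.ε_pos.le u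
  have hv := clamp_mem hR.ε_pos.le v
  exact (𝒮.tame_w.lip _ (h₁.Z_mem hR hu hv) _ (h₂.Z_mem hR hu hv)).trans
    (mul_le_mul_of_nonneg_left (hd.norm_Z_sub_le h₁ h₂ hR hu hv) 𝒮.L_nonneg)

theorem abs_dwZ_sub_le (u v : ℝ) :
    |F₁.dwZ 𝒮 ε u v - F₂.dwZ 𝒮 ε u v| ≤
      𝒮.L * (d₀ + d₁ + d₂) + 𝒮.L * ((d₀ + d₁ + d₂) * ε) * (R₀ + R₁ + R₂) := by
  have hu := clamp_mem hR.ε_pos.le u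
  have hv := clamp_mem hR.ε_pos.le v
  refine abs_apply_sub_apply_le ?_ ((𝒮.tame_w.lip' _ (h₁.Z_mem hR hu hv) _
    (h₂.Z_mem hR hu hv)).trans (mul_le_mul_of_nonneg_left (hd.norm_Z_sub_le h₁ h₂ hR hu hv)
      𝒮.L_nonneg)) (h₂.norm_dZ_le hR hu)
  rw [← Real.norm_eq_abs]
  exact ((𝒮.w' _).le_opNorm _).trans (mul_le_mul (𝒮.tame_w.norm_le _ (h₁.Z_mem hR hu hv))
    (hd.norm_dZ_sub_le h₁ h₂ hR hu) (norm_nonneg _) 𝒮.L_nonneg)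

/-- The iteration gains a factor `ε` on every quantity of lower order; on the top order ones it
acts with the coefficient `q₀ a < 1`, up to terms of triangular shape. -/
theorem step {C : ℝ} (hC : 𝒮.stepConst R₀ R₁ R₂ ≤ C) :
    IsClose (F₁.step 𝒮 ε) (F₂.step 𝒮 ε) (C * ε * (d₀ + d₁ + d₂))
      (𝒮.q₀ * 𝒮.a * d₁ + C * d₀ + C * ε * (d₀ + d₁ + d₂))
      (𝒮.q₀ * 𝒮.a * d₂ + C * (d₀ + d₁) + C * ε * (d₀ + d₁ + d₂)) := by
  obtain ⟨n0, n1, n2⟩ := hd.nonneg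
  have hL := 𝒮.L_nonneg
  have hq := 𝒮.q₀_nonneg
  have hε := hR.ε_pos.le
  have hR0 := hR.R₀_nonneg
  have hR1 := hR.R₁_nonneg
  have hR2 := hR.R₂_nonneg
  set D := d₀ + d₁ + d₂ with hD
  set R := R₀ + R₁ + R₂ with hRdef
  have hD0 : 0 ≤ D := by positivity
  have hRn : 0 ≤ R := by positivity
  have hDε : 0 ≤ D * ε := by positivity
  have hLR : 0 ≤ 𝒮.L * R := by positivity
  simp only [SystemData.stepConst, ← hRdef] at hC
  have hLC : 𝒮.L * (D * ε) ≤ C * ε * D := by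
    have : 𝒮.L * (D * ε) ≤ C * (D * ε) := mul_le_mul_of_nonneg_right (by nlinarith) hDε
    linarith
  refine ⟨fun v => ?_, fun v => ?_, fun v => ?_, fun u v => ?_, fun u v => ?_⟩
  · have hv := clamp_mem hε v
    have hX := hd.norm_X_sub_le h₁ h₂ hR hv
    refine (abs_apply_sub_apply_le (𝒮.coeff_Ψ _ (h₁.X_mem hR hv) _)
      ((𝒮.tame_Ψ.lip' _ (h₁.X_mem hR hv) _ (h₂.X_mem hR hv)).trans
        (mul_le_mul_of_nonneg_left hX hL)) (h₂.norm_dX_le hR hv)).trans ?_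
    have b1 := mul_le_mul_of_nonneg_left (hd.abs_dX_sub_snd_fst_le (𝒮 := 𝒮) (clamp ε v)) hq
    have b2 := mul_le_mul_of_nonneg_left (add_le_add (hd.norm_dX_sub_fst_le h₁ h₂ hR hv)
      (hd.abs_dX_sub_snd_snd_le (𝒮 := 𝒮) (clamp ε v))) hL
    have c1 : 2 * 𝒮.L * d₀ ≤ C * d₀ := mul_le_mul_of_nonneg_right (by nlinarith) n0
    have c2 : 𝒮.L * 𝒮.a * d₁ ≤ C * d₁ :=
      mul_le_mul_of_nonneg_right (by nlinarith [𝒮.a_lt, 𝒮.a_pos]) n1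
    have c3 : (𝒮.L + 𝒮.L * R) * (D * ε) ≤ C * (D * ε) :=
      mul_le_mul_of_nonneg_right (by nlinarith) hDε
    simp only [← hD, ← hRdef] at b1 b2 ⊢
    linarith
  · have hv := clamp_mem hε v
    exact ((𝒮.tame_τ.lip _ (h₁.X_mem hR hv) _ (h₂.X_mem hR hv)).trans
      (mul_le_mul_of_nonneg_left (hd.norm_X_sub_le h₁ h₂ hR hv) hL)).trans hLC
  · have hv := clamp_mem hε v
    exact ((𝒮.tame_χ.lip _ (h₁.X_mem hR hv) _ (h₂.X_mem hR hv)).trans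
      (mul_le_mul_of_nonneg_left (hd.norm_X_sub_le h₁ h₂ hR hv) hL)).trans hLC
  · have hu := clamp_mem hε u
    have hv := clamp_mem hε v
    have hau := mul_mem_Icc 𝒮.a_pos 𝒮.a_lt hu
    have hX := hd.norm_X_sub_le h₁ h₂ hR hu
    have b0 := abs_apply_sub_apply_le (𝒮.coeff_G _ (h₁.X_mem hR hu)
      (F₁.dX 𝒮 (clamp ε u) - F₂.dX 𝒮 (clamp ε u)))
      ((𝒮.tame_G.lip' _ (h₁.X_mem hR hu) _ (h₂.X_mem hR hu)).trans
        (mul_le_mul_of_nonneg_left hX hL)) (h₂.norm_dX_le hR hu)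
    have b1 := mul_le_mul_of_nonneg_left (hd.abs_dX_sub_snd_snd_le (𝒮 := 𝒮) (clamp ε u)) hq
    have b2 := mul_le_mul_of_nonneg_left (hd.norm_dX_sub_fst_le h₁ h₂ hR hu) hL
    have b3 : |𝒮.a * F₁.wZ 𝒮 ε (clamp ε u) (𝒮.a * clamp ε u) -
        𝒮.a * F₂.wZ 𝒮 ε (clamp ε u) (𝒮.a * clamp ε u)| ≤ 𝒮.L * (D * ε) := by
      rw [← mul_sub, abs_mul, abs_of_pos 𝒮.a_pos]
      have := hd.abs_wZ_sub_le h₁ h₂ hR (clamp ε u) (𝒮.a * clamp ε u)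
      exact (mul_le_of_le_one_left (abs_nonneg _) 𝒮.a_lt.le).trans this
    have hc {F : Fields} (h : Admissible 𝒮 F R₀ R₁ R₂ ε) :
        Continuous fun s => F.dwZ 𝒮 ε (clamp ε u) s :=
      (h.cont_dwZ hR).comp (by fun_prop : Continuous fun s : ℝ => (clamp ε u, s))
    have b4 : |((∫ s in (0 : ℝ)..clamp ε v, F₁.dwZ 𝒮 ε (clamp ε u) s) -
          ∫ s in (0 : ℝ)..𝒮.a * clamp ε u, F₁.dwZ 𝒮 ε (clamp ε u) s) -
        ((∫ s in (0 : ℝ)..clamp ε v, F₂.dwZ 𝒮 ε (clamp ε u) s) -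
          ∫ s in (0 : ℝ)..𝒮.a * clamp ε u, F₂.dwZ 𝒮 ε (clamp ε u) s)| ≤
        (𝒮.L * D + 𝒮.L * D * R) * ε := by
      rw [intervalIntegral.integral_interval_sub_left ((hc h₁).intervalIntegrable _ _)
        ((hc h₁).intervalIntegrable _ _),
        intervalIntegral.integral_interval_sub_left ((hc h₂).intervalIntegrable _ _)
        ((hc h₂).intervalIntegrable _ _)]
      refine abs_integral_sub_integral_le (hc h₁) (hc h₂) (by positivity) hau hv fun s _ =>
        (hd.abs_dwZ_sub_le h₁ h₂ hR _ _).trans ?_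
      have : 𝒮.L * D * R * ε ≤ 𝒮.L * D * R := mul_le_of_le_one_right (by positivity) hR.ε_le
      simp only [← hD, ← hRdef]
      linarith
    have c1 : (𝒮.q₀ + 𝒮.L) * d₀ ≤ C * d₀ := mul_le_mul_of_nonneg_right (by nlinarith) n0
    have c3 : (3 * 𝒮.L + 2 * (𝒮.L * R)) * (D * ε) ≤ C * (D * ε) :=
      mul_le_mul_of_nonneg_right (by nlinarith) hDε
    have split (x₁ y₁ z₁ x₂ y₂ z₂ : ℝ) : |x₁ - y₁ + z₁ - (x₂ - y₂ + z₂)| ≤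
        |x₁ - x₂| + |y₁ - y₂| + |z₁ - z₂| := by
      have e : x₁ - y₁ + z₁ - (x₂ - y₂ + z₂) = (x₁ - x₂) - (y₁ - y₂) + (z₁ - z₂) := by ring
      rw [e]
      exact (abs_add_le _ _).trans (by gcongr; exact abs_sub _ _)
    refine (split _ _ _ _ _ _).trans ((add_le_add (add_le_add b0 b3) b4).trans ?_)
    simp only [← hD, ← hRdef] at b1 b2 ⊢
    linarith
  · exact (hd.abs_wZ_sub_le h₁ h₂ hR u v).trans hLC

end IsClose

/-! ### Existence for the functional integral system -/

/-- The bounds for `P` and `κ` reproduce themselves up to the factor `q₀ a < 1`, so `R₀`, `R₁` and `R₂`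
can be chosen in turn, and then `ε`. -/
theorem SystemData.exists_radii (𝒮 : SystemData) :
    ∃ R₀ R₁ R₂ ε₀ : ℝ, 0 < ε₀ ∧ ∀ ε, 0 < ε → ε ≤ ε₀ → Radii 𝒮 R₀ R₁ R₂ ε := by
  have hq : 0 < 1 - 𝒮.q₀ * 𝒮.a := sub_pos.2 𝒮.q₀_lt
  have hq₀ := 𝒮.q₀_nonneg
  have hL := 𝒮.L_nonneg
  have ha := 𝒮.a_pos.le
  have hδ := 𝒮.δ_pos
  have hk := abs_nonneg 𝒮.k₀
  set R₀ := 𝒮.L + (|𝒮.k₀| + 1) with hR₀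
  have h0 : 0 ≤ R₀ := by positivity
  set B₁ := 𝒮.q₀ * R₀ + 𝒮.L * R₀ + 𝒮.a * R₀ + 1 with hB₁
  have hB₁0 : 0 ≤ B₁ := by positivity
  set R₁ := B₁ / (1 - 𝒮.q₀ * 𝒮.a) with hR₁
  have h1 : 0 ≤ R₁ := by positivity
  have e1 : (1 - 𝒮.q₀ * 𝒮.a) * R₁ = B₁ := mul_div_cancel₀ _ hq.ne'
  set B₂ := 𝒮.L * (R₀ + (𝒮.a * R₁ + R₀)) with hB₂
  have hB₂0 : 0 ≤ B₂ := by positivity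
  set R₂ := B₂ / (1 - 𝒮.q₀ * 𝒮.a) with hR₂
  have h2 : 0 ≤ R₂ := by positivity
  have e2 : (1 - 𝒮.q₀ * 𝒮.a) * R₂ = B₂ := mul_div_cancel₀ _ hq.ne'
  have hS : 0 ≤ R₀ + R₁ + R₂ := by positivity
  refine ⟨R₀, R₁, R₂, min 1 (min (𝒮.δ / (R₀ + R₁ + R₂ + 1)) (1 / (𝒮.L * (R₀ + R₁ + R₂) + 1))),
    by positivity, fun ε hε hεle => ?_⟩
  have hε1 := hεle.trans (min_le_left _ _)
  have hε2 := hεle.trans ((min_le_right _ _).trans (min_le_left _ _))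
  have hε3 := hεle.trans ((min_le_right _ _).trans (min_le_right _ _))
  rw [le_div_iff₀ (by positivity)] at hε2 hε3
  refine ⟨by linarith, by linarith, ?_, ?_, h1, h2, hε, hε1, by nlinarith, by nlinarith⟩
  · rw [hB₁] at e1; nlinarith
  · rw [hB₂] at e2; nlinarith

/-- The complete metric space of the bounded continuous fields `(κ, dt, dx, p, P, W)`. -/
abbrev FieldSpace := (ℝ →ᵇ ℝ) × (ℝ →ᵇ ℝ) × (ℝ →ᵇ ℝ) × ((ℝ × ℝ) →ᵇ ℝ) × ((ℝ × ℝ) →ᵇ ℝ) ×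
  ((ℝ × ℝ) →ᵇ ℝ)

/-- The underlying functions. -/
def FieldSpace.toFields (s : FieldSpace) : Fields where
  κ := s.1
  dt := s.2.1
  dx := s.2.2.1
  p u v := s.2.2.2.1 (u, v)
  P u v := s.2.2.2.2.1 (u, v)
  W u v := s.2.2.2.2.2 (u, v)

/-- Admissible fields are bounded: `p` is controlled by its values on the square. -/
theorem Admissible.exists_toFields {𝒮 : SystemData} {F : Fields} {R₀ R₁ R₂ ε : ℝ}
    (h : Admissible 𝒮 F R₀ R₁ R₂ ε) (hR : Radii 𝒮 R₀ R₁ R₂ ε) :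
    ∃ s : FieldSpace, s.toFields = F := by
  refine ⟨⟨.ofNormedAddCommGroup F.κ h.cont_κ R₂ h.κ_le,
    .ofNormedAddCommGroup F.dt h.cont_dt R₀ h.dt_le,
    .ofNormedAddCommGroup F.dx h.cont_dx R₀ h.dx_le,
    .ofNormedAddCommGroup (fun y => F.p y.1 y.2) h.cont_p (|𝒮.p₀| + (R₀ + R₁) * ε) fun y => ?_,
    .ofNormedAddCommGroup (fun y => F.P y.1 y.2) h.cont_P R₁ fun y => h.P_le _ _,
    .ofNormedAddCommGroup (fun y => F.W y.1 y.2) h.cont_W R₀ fun y => h.W_le _ _⟩, rfl⟩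
  rw [← h.p_clamp, Real.norm_eq_abs]
  have h1 := h.abs_p_sub_le hR (clamp_mem hR.ε_pos.le y.1) (clamp_mem hR.ε_pos.le y.2)
  have h2 := abs_sub_abs_le_abs_sub (F.p (clamp ε y.1) (clamp ε y.2)) 𝒮.p₀
  linarith

theorem continuous_integral_comp {c : ℝ → ℝ × ℝ} (hc : Continuous c) (u v : ℝ) :
    Continuous fun f : (ℝ × ℝ) →ᵇ ℝ => ∫ s in u..v, f (c s) := by
  refine (LipschitzWith.of_dist_le_mul (K := Real.toNNReal |v - u|) fun f g => ?_).continuous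
  rw [Real.dist_eq, Real.coe_toNNReal _ (abs_nonneg _), ← intervalIntegral.integral_sub
    (f := fun s => f (c s)) (g := fun s => g (c s)) ((f.continuous.comp hc).intervalIntegrable _ _)
    ((g.continuous.comp hc).intervalIntegrable _ _), ← Real.norm_eq_abs, mul_comm]
  exact intervalIntegral.norm_integral_le_of_norm_le_const fun s _ => by
    rw [← dist_eq_norm]; exact f.dist_coe_le_dist _

/-- The relations between `p`, `P` and `W` are in integrated form, so they survive uniform limits, as do
the pointwise inequalities. -/
theorem isClosed_admissible (𝒮 : SystemData) (R₀ R₁ R₂ ε : ℝ) :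
    IsClosed {s : FieldSpace | Admissible 𝒮 s.toFields R₀ R₁ R₂ ε} := by
  have eκ (v : ℝ) : Continuous fun s : FieldSpace => s.toFields.κ v :=
    (continuous_eval_const v).comp continuous_fst
  have et (v : ℝ) : Continuous fun s : FieldSpace => s.toFields.dt v :=
    (continuous_eval_const v).comp
      (continuous_fst.comp continuous_snd)
  have ex (v : ℝ) : Continuous fun s : FieldSpace => s.toFields.dx v :=
    (continuous_eval_const v).comp
      (continuous_fst.comp (continuous_snd.comp continuous_snd))
  have πp : Continuous fun s : FieldSpace => s.2.2.2.1 := by fun_prop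
  have πP : Continuous fun s : FieldSpace => s.2.2.2.2.1 := by fun_prop
  have πW : Continuous fun s : FieldSpace => s.2.2.2.2.2 := by fun_prop
  have ep (u v : ℝ) : Continuous fun s : FieldSpace => s.toFields.p u v :=
    (continuous_eval_const (u, v)).comp πp
  have eP (u v : ℝ) : Continuous fun s : FieldSpace => s.toFields.P u v :=
    (continuous_eval_const (u, v)).comp πP
  have eW (u v : ℝ) : Continuous fun s : FieldSpace => s.toFields.W u v :=
    (continuous_eval_const (u, v)).comp πW
  have iP (u v : ℝ) : Continuous fun s : FieldSpace => ∫ σ in (0 : ℝ)..u, s.toFields.P σ v :=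
    (continuous_integral_comp (c := fun σ => (σ, v)) (by fun_prop) 0 u).comp πP
  have iW (u v : ℝ) : Continuous fun s : FieldSpace => ∫ σ in (0 : ℝ)..v, s.toFields.W u σ :=
    (continuous_integral_comp (c := fun σ => (u, σ)) (by fun_prop) 0 v).comp πW
  refine IsSeqClosed.isClosed fun s s' hs hlim => ?_
  have lim {f : FieldSpace → ℝ} (hf : Continuous f) :
      Tendsto (fun n => f (s n)) atTop (𝓝 (f s')) := (hf.tendsto s').comp hlim
  refine
    { cont_κ := s'.1.continuous
      cont_dt := s'.2.1.continuous
      cont_dx := s'.2.2.1.continuous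
      cont_p := s'.2.2.2.1.continuous
      cont_P := s'.2.2.2.2.1.continuous
      cont_W := s'.2.2.2.2.2.continuous
      κ_le := fun v => le_of_tendsto' (lim (eκ v)).abs fun n => (hs n).κ_le v
      dt_le := fun v => le_of_tendsto' (lim (et v)).abs fun n => (hs n).dt_le v
      dx_le := fun v => le_of_tendsto' (lim (ex v)).abs fun n => (hs n).dx_le v
      P_le := fun u v => le_of_tendsto' (lim (eP u v)).abs fun n => (hs n).P_le u v
      W_le := fun u v => le_of_tendsto' (lim (eW u v)).abs fun n => (hs n).W_le u v
      dt_nonneg := fun v => ge_of_tendsto' (lim (et v)) fun n => (hs n).dt_nonneg v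
      le_dx := fun v => le_of_tendsto_of_tendsto' ((lim (et v)).const_mul _) (lim (ex v))
        fun n => (hs n).le_dx v
      dx_le' := fun v => le_of_tendsto_of_tendsto' (lim (ex v)) ((lim (et v)).const_mul _)
        fun n => (hs n).dx_le' v
      primitive := fun u hu v hv => ⟨?_, ?_⟩
      p_zero := tendsto_nhds_unique (lim (ep 0 0)) ?_
      κ_clamp := fun v => tendsto_nhds_unique (lim (eκ _)) ?_
      dt_clamp := fun v => tendsto_nhds_unique (lim (et _)) ?_
      dx_clamp := fun v => tendsto_nhds_unique (lim (ex _)) ?_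
      p_clamp := fun u v => tendsto_nhds_unique (lim (ep _ _)) ?_
      P_clamp := fun u v => tendsto_nhds_unique (lim (eP _ _)) ?_
      W_clamp := fun u v => tendsto_nhds_unique (lim (eW _ _)) ?_ }
  · refine tendsto_nhds_unique (lim (ep u v)) ?_
    simp only [fun n => ((hs n).primitive u hu v hv).1]
    exact (lim (ep 0 v)).add (lim (iP u v))
  · refine tendsto_nhds_unique (lim (ep u v)) ?_
    simp only [fun n => ((hs n).primitive u hu v hv).2]
    exact (lim (ep u 0)).add (lim (iW u v))
  · simp only [fun n => (hs n).p_zero]; exact tendsto_const_nhds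
  · simp only [fun n => (hs n).κ_clamp]; exact lim (eκ v)
  · simp only [fun n => (hs n).dt_clamp]; exact lim (et v)
  · simp only [fun n => (hs n).dx_clamp]; exact lim (ex v)
  · simp only [fun n => (hs n).p_clamp]; exact lim (ep u v)
  · simp only [fun n => (hs n).P_clamp]; exact lim (eP u v)
  · simp only [fun n => (hs n).W_clamp]; exact lim (eW u v)

theorem admissible_const {𝒮 : SystemData} {R₀ R₁ R₂ ε : ℝ} (hR : Radii 𝒮 R₀ R₁ R₂ ε) :
    Admissible 𝒮 ⟨fun _ => 0, fun _ => 0, fun _ => 0, fun _ _ => 𝒮.p₀, fun _ _ => 0,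
      fun _ _ => 0⟩ R₀ R₁ R₂ ε := by
  have h0 := hR.R₀_nonneg
  have h1 := hR.R₁_nonneg
  have h2 := hR.R₂_nonneg
  constructor <;> first | (intros; simp; done) | (intros; simpa using ‹_›) | skip
  all_goals first | exact continuous_const | skip
  intro u _ v _
  simp

/-- The functional integral system has a solution on every sufficiently small interval. -/
theorem SystemData.exists_fixed (𝒮 : SystemData) :
    ∃ R₀ R₁ R₂ ε₀ : ℝ, 0 < ε₀ ∧ ∀ ε, 0 < ε → ε ≤ ε₀ →
      Radii 𝒮 R₀ R₁ R₂ ε ∧ ∃ F : Fields, Admissible 𝒮 F R₀ R₁ R₂ ε ∧ F.step 𝒮 ε = F := by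
  obtain ⟨R₀, R₁, R₂, ε₁, hε₁, hrad⟩ := 𝒮.exists_radii
  have hC₁ : 0 ≤ 𝒮.stepConst R₀ R₁ R₂ := by
    have hR := hrad ε₁ hε₁ le_rfl
    have := hR.R₀_nonneg
    have := hR.R₁_nonneg
    have := hR.R₂_nonneg
    have := 𝒮.L_nonneg
    have := 𝒮.q₀_nonneg
    unfold SystemData.stepConst
    positivity
  set C := 𝒮.stepConst R₀ R₁ R₂ with hCdef
  obtain ⟨K₀, K₁, q, ε₂, hK₀, hK₁, hq0, hq1, hε₂, hw⟩ := exists_weights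
    (mul_nonneg 𝒮.q₀_nonneg 𝒮.a_pos.le) 𝒮.q₀_lt (by positivity : 0 ≤ 3 * C)
  -- the factor `3`: the gauge below adds up the distances of `dt`, `dx` and `W`
  refine ⟨R₀, R₁, R₂, min ε₁ ε₂, lt_min hε₁ hε₂, fun ε hε hεle => ?_⟩
  have hR := hrad ε hε (hεle.trans (min_le_left _ _))
  refine ⟨hR, ?_⟩
  set S := {s : FieldSpace | Admissible 𝒮 s.toFields R₀ R₁ R₂ ε} with hS
  have hex : ∀ s : FieldSpace, ∃ s' : FieldSpace,
      s ∈ S → s'.toFields = s.toFields.step 𝒮 ε := by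
    intro s
    by_cases hs : s ∈ S
    · obtain ⟨s', hs'⟩ := (Admissible.step_admissible hs hR).exists_toFields hR
      exact ⟨s', fun _ => hs'⟩
    · exact ⟨s, fun h => absurd h hs⟩
  choose Φ hΦ using hex
  have hmaps : MapsTo Φ S S := fun s hs => by
    change Admissible 𝒮 (Φ s).toFields R₀ R₁ R₂ ε
    rw [hΦ s hs]
    exact Admissible.step_admissible hs hR
  have hne : S.Nonempty := by
    obtain ⟨s, hs⟩ := (admissible_const hR).exists_toFields hR
    refine ⟨s, ?_⟩
    change Admissible 𝒮 s.toFields R₀ R₁ R₂ ε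
    rw [hs]
    exact admissible_const hR
  have hclose (s s' : FieldSpace) : IsClose s.toFields s'.toFields
      (dist s.2.1 s'.2.1 + dist s.2.2.1 s'.2.2.1 + dist s.2.2.2.2.2 s'.2.2.2.2.2)
      (dist s.2.2.2.2.1 s'.2.2.2.2.1) (dist s.1 s'.1) := by
    have h1 : 0 ≤ dist s.2.1 s'.2.1 := dist_nonneg
    have h2 : 0 ≤ dist s.2.2.1 s'.2.2.1 := dist_nonneg
    have h3 : 0 ≤ dist s.2.2.2.2.2 s'.2.2.2.2.2 := dist_nonneg
    refine ⟨fun v => ?_, fun v => ?_, fun v => ?_, fun u v => ?_, fun u v => ?_⟩ <;>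
      rw [← Real.dist_eq]
    · exact BoundedContinuousFunction.dist_coe_le_dist v
    · have : dist (s.toFields.dt v) (s'.toFields.dt v) ≤ dist s.2.1 s'.2.1 :=
        BoundedContinuousFunction.dist_coe_le_dist v
      linarith
    · have : dist (s.toFields.dx v) (s'.toFields.dx v) ≤ dist s.2.2.1 s'.2.2.1 :=
        BoundedContinuousFunction.dist_coe_le_dist v
      linarith
    · exact BoundedContinuousFunction.dist_coe_le_dist (u, v)
    · have : dist (s.toFields.W u v) (s'.toFields.W u v) ≤ dist s.2.2.2.2.2 s'.2.2.2.2.2 :=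
        BoundedContinuousFunction.dist_coe_le_dist (u, v)
      linarith
  suffices hfix : ∃ s ∈ S, Φ s = s by
    obtain ⟨s, hsS, hs⟩ := hfix
    exact ⟨s.toFields, hsS, by rw [← hΦ s hsS, hs]⟩
  -- the gauge leaves out `p`, which for admissible fields is controlled by `P` and `W`
  refine exists_fixedPoint_of_gauge (isClosed_admissible 𝒮 R₀ R₁ R₂ ε) hne hmaps
    (g := fun s s' => K₀ * (dist s.2.1 s'.2.1 + dist s.2.2.1 s'.2.2.1 +
      dist s.2.2.2.2.2 s'.2.2.2.2.2) + K₁ * dist s.2.2.2.2.1 s'.2.2.2.2.1 + dist s.1 s'.1)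
    (C := 3 * K₀ + K₁ + 1) hq0 hq1 (by positivity) ?_ ?_ ?_
  · intro s hs s' hs'
    have hc := (hclose s s').step hs hs' hR le_rfl
    rw [← hΦ s hs, ← hΦ s' hs', ← hCdef] at hc
    obtain ⟨n0, n1, n2⟩ := hc.nonneg
    obtain ⟨m0, m1, m2⟩ := (hclose s s').nonneg
    refine hw ε _ _ _ _ _ _ hε.le (hεle.trans (min_le_right _ _)) m0 m1 m2 ?_ ?_ ?_
    · have b1 : dist (Φ s).2.1 (Φ s').2.1 ≤ _ :=
        (BoundedContinuousFunction.dist_le n0).2 fun v => (Real.dist_eq _ _).trans_le (hc.dt v)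
      have b2 : dist (Φ s).2.2.1 (Φ s').2.2.1 ≤ _ :=
        (BoundedContinuousFunction.dist_le n0).2 fun v => (Real.dist_eq _ _).trans_le (hc.dx v)
      have b3 : dist (Φ s).2.2.2.2.2 (Φ s').2.2.2.2.2 ≤ _ :=
        (BoundedContinuousFunction.dist_le n0).2
          fun v => (Real.dist_eq _ _).trans_le (hc.W v.1 v.2)
      linarith
    · have b1 : dist (Φ s).2.2.2.2.1 (Φ s').2.2.2.2.1 ≤ _ :=
        (BoundedContinuousFunction.dist_le n1).2
          fun v => (Real.dist_eq _ _).trans_le (hc.P v.1 v.2)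
      refine b1.trans ?_
      gcongr <;> linarith
    · have b1 : dist (Φ s).1 (Φ s').1 ≤ _ :=
        (BoundedContinuousFunction.dist_le n2).2 fun v => (Real.dist_eq _ _).trans_le (hc.κ v)
      refine b1.trans ?_
      gcongr <;> linarith
  · intro s hs s' hs'
    have h1 : 0 ≤ dist s.2.1 s'.2.1 := dist_nonneg
    have h2 : 0 ≤ dist s.2.2.1 s'.2.2.1 := dist_nonneg
    have h3 : 0 ≤ dist s.2.2.2.2.2 s'.2.2.2.2.2 := dist_nonneg
    have h4 : 0 ≤ dist s.2.2.2.2.1 s'.2.2.2.2.1 := dist_nonneg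
    have h5 : 0 ≤ dist s.1 s'.1 := dist_nonneg
    have hp : dist s.2.2.2.1 s'.2.2.2.1 ≤ dist s.2.1 s'.2.1 + dist s.2.2.1 s'.2.2.1 +
        dist s.2.2.2.2.2 s'.2.2.2.2.2 + dist s.2.2.2.2.1 s'.2.2.2.2.1 := by
      refine (BoundedContinuousFunction.dist_le (by positivity)).2 fun y => ?_
      have hp := (hclose s s').abs_p_sub_le hs hs' hR (clamp_mem hε.le y.1) (clamp_mem hε.le y.2)
      rw [Admissible.p_clamp hs, Admissible.p_clamp hs'] at hp
      exact (Real.dist_eq _ _).trans_le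
        (hp.trans (mul_le_of_le_one_right (by positivity) hR.ε_le))
    have hg : dist s s' ≤ dist s.2.1 s'.2.1 + dist s.2.2.1 s'.2.2.1 +
        dist s.2.2.2.2.2 s'.2.2.2.2.2 + dist s.2.2.2.2.1 s'.2.2.2.2.1 + dist s.1 s'.1 := by
      simp only [Prod.dist_eq, max_le_iff]
      refine ⟨?_, ?_, ?_, ?_, ?_, ?_⟩ <;> linarith
    refine hg.trans (le_trans ?_ (le_mul_of_one_le_left (by positivity) (by linarith)))
    have := mul_le_mul_of_nonneg_right hK₀ (by positivity : 0 ≤ dist s.2.1 s'.2.1 +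
      dist s.2.2.1 s'.2.2.1 + dist s.2.2.2.2.2 s'.2.2.2.2.2)
    have := mul_le_mul_of_nonneg_right hK₁ h4
    linarith
  · intro s _ s' _
    have h1 : dist s.1 s'.1 ≤ dist s s' := by simp [Prod.dist_eq]
    have h2 : dist s.2.1 s'.2.1 ≤ dist s s' := by simp [Prod.dist_eq]
    have h3 : dist s.2.2.1 s'.2.2.1 ≤ dist s s' := by simp [Prod.dist_eq]
    have h4 : dist s.2.2.2.2.1 s'.2.2.2.2.1 ≤ dist s s' := by simp [Prod.dist_eq]
    have h5 : dist s.2.2.2.2.2 s'.2.2.2.2.2 ≤ dist s s' := by simp [Prod.dist_eq]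
    have : K₀ * (dist s.2.1 s'.2.1 + dist s.2.2.1 s'.2.2.1 + dist s.2.2.2.2.2 s'.2.2.2.2.2) ≤
        K₀ * (3 * dist s s') := by gcongr; linarith
    have : K₁ * dist s.2.2.2.2.1 s'.2.2.2.2.1 ≤ K₁ * dist s s' := by gcongr
    linarith

/-- A solution on `[0, ε]` of the system
`β' = Ψ(X)`, `t₊' = τ(X)`, `x₊' = χ(X)`, `p(v, a v) = G(X(v))`, `∂p/∂v = w(Z)`. -/
structure IsSystemSolution (a b₀ k₀ p₀ : ℝ) (Ψ G τ χ : ShockVar → ℝ) (w : BulkVar → ℝ) (ε : ℝ)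
    (b k κ t x : ℝ → ℝ) (p P W : ℝ → ℝ → ℝ) : Prop where
  hasDerivAt_b : ∀ v, HasDerivAt b (k v) v
  hasDerivAt_k : ∀ v, HasDerivAt k (κ v) v
  cont_κ : Continuous κ
  b_zero : b 0 = b₀
  k_zero : k 0 = k₀
  t_zero : t 0 = 0
  x_zero : x 0 = 0
  p_zero : p 0 0 = p₀
  k_eq : ∀ v ∈ Icc 0 ε, k v = Ψ ((b v, b (a * v), t v, x v), k (a * v), p (a * v) v)
  p_eq : ∀ v ∈ Icc 0 ε, p v (a * v) = G ((b v, b (a * v), t v, x v), k (a * v), p (a * v) v)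
  hasDerivAt_t : ∀ v ∈ Icc 0 ε,
    HasDerivAt t (τ ((b v, b (a * v), t v, x v), k (a * v), p (a * v) v)) v
  hasDerivAt_x : ∀ v ∈ Icc 0 ε,
    HasDerivAt x (χ ((b v, b (a * v), t v, x v), k (a * v), p (a * v) v)) v
  hasFDerivWithinAt_p : ∀ z ∈ Icc 0 ε ×ˢ Icc 0 ε, HasFDerivWithinAt (fun y : ℝ × ℝ => p y.1 y.2)
    (planeForm (P z.1 z.2) (W z.1 z.2)) (Icc 0 ε ×ˢ Icc 0 ε) z
  cont_P : Continuous fun y : ℝ × ℝ => P y.1 y.2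
  cont_W : Continuous fun y : ℝ × ℝ => W y.1 y.2
  W_eq : ∀ u ∈ Icc 0 ε, ∀ v ∈ Icc 0 ε, W u v = w (b u, b v, k u, k v, p u v, p v u)

/-- Two functions with the same derivative on `[0, ε]` and the same value at `0` agree. -/
theorem eq_of_hasDerivWithinAt_Icc {ε : ℝ} {f g f' : ℝ → ℝ}
    (hf : ∀ s ∈ Icc 0 ε, HasDerivWithinAt f (f' s) (Icc 0 ε) s)
    (hg : ∀ s ∈ Icc 0 ε, HasDerivWithinAt g (f' s) (Icc 0 ε) s) (h0 : f 0 = g 0) :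
    ∀ v ∈ Icc 0 ε, f v = g v := by
  intro v hv
  have hd : ∀ s ∈ Icc 0 ε, HasDerivWithinAt (fun s => f s - g s) 0 (Icc 0 ε) s := fun s hs => by
    simpa using (hf s hs).fun_sub (hg s hs)
  have := eq_add_integral_of_hasDerivWithinAt (f' := fun _ => 0) hd continuousOn_const hv
  simp only [h0, sub_self, intervalIntegral.integral_zero, add_zero] at this
  linarith

theorem SystemData.exists_solution (𝒮 : SystemData) :
    ∃ ε₀ : ℝ, 0 < ε₀ ∧ ∀ ε, 0 < ε → ε ≤ ε₀ →
      ∃ (b k κ t x : ℝ → ℝ) (p P W : ℝ → ℝ → ℝ),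
        IsSystemSolution 𝒮.a 𝒮.b₀ 𝒮.k₀ 𝒮.p₀ 𝒮.Ψ 𝒮.G 𝒮.τ 𝒮.χ 𝒮.w ε b k κ t x p P W ∧
        (∀ v ∈ Icc 0 ε,
          ((b v, b (𝒮.a * v), t v, x v), k (𝒮.a * v), p (𝒮.a * v) v) ∈ 𝒮.dom) ∧
        ∀ u ∈ Icc 0 ε, ∀ v ∈ Icc 0 ε, (b u, b v, k u, k v, p u v, p v u) ∈ 𝒮.bulkDom := by
  obtain ⟨R₀, R₁, R₂, ε₀, hε₀, hfix⟩ := 𝒮.exists_fixed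
  refine ⟨ε₀, hε₀, fun ε hε hεle => ?_⟩
  obtain ⟨hR, F, h, hF⟩ := hfix ε hε hεle
  refine ⟨F.b 𝒮, F.k 𝒮, F.κ, F.t, F.x, F.p, F.P, F.W, ?_, fun v hv => h.X_mem hR hv,
    fun u hu v hv => h.Z_mem hR hu hv⟩
  have h0 : (0 : ℝ) ∈ Icc 0 ε := ⟨le_rfl, hε.le⟩
  refine
    { hasDerivAt_b := h.hasDerivAt_b
      hasDerivAt_k := h.hasDerivAt_k
      cont_κ := h.cont_κ
      b_zero := by simp [Fields.b]
      k_zero := by simp [Fields.k]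
      t_zero := by simp [Fields.t]
      x_zero := by simp [Fields.x]
      p_zero := h.p_zero
      k_eq := ?_
      p_eq := fun v hv => ?_
      hasDerivAt_t := fun v hv => ?_
      hasDerivAt_x := fun v hv => ?_
      hasFDerivWithinAt_p := fun z hz => h.primitive.hasFDerivWithinAt h.cont_P h.cont_W hz
      cont_P := h.cont_P
      cont_W := h.cont_W
      W_eq := fun u hu v hv => ?_ }
  · refine eq_of_hasDerivWithinAt_Icc (g := fun v => 𝒮.Ψ (F.X 𝒮 v)) (f' := F.κ)
      (fun s _ => (h.hasDerivAt_k s).hasDerivWithinAt) (fun s hs => ?_) ?_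
    · have e : F.κ s = 𝒮.Ψ' (F.X 𝒮 s) (F.dX 𝒮 s) := by
        conv_lhs => rw [← hF]
        simp only [Fields.step, clamp_of_mem hs]
      rw [e]
      exact (𝒮.tame_Ψ.hasFDerivWithinAt _ (h.X_mem hR hs)).comp_hasDerivWithinAt s
        (h.hasDerivWithinAt_X hs) fun y hy => h.X_mem hR hy
    · rw [h.X_zero, 𝒮.Ψ_base]; simp [Fields.k]
  · have hav := mul_mem_Icc 𝒮.a_pos 𝒮.a_lt hv
    conv_lhs => rw [← hF]
    simp only [Fields.step, clamp_of_mem hv, clamp_of_mem hav, sub_self, add_zero]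
    rfl
  · have e : F.dt v = 𝒮.τ (F.X 𝒮 v) := by
      conv_lhs => rw [← hF]
      simp only [Fields.step, clamp_of_mem hv]
    exact e ▸ h.hasDerivAt_t v
  · have e : F.dx v = 𝒮.χ (F.X 𝒮 v) := by
      conv_lhs => rw [← hF]
      simp only [Fields.step, clamp_of_mem hv]
    exact e ▸ h.hasDerivAt_x v
  · conv_lhs => rw [← hF]
    simp only [Fields.step, Fields.wZ, clamp_of_mem hu, clamp_of_mem hv]
    rfl

theorem convex_shockCone (m₁ m₂ : ℝ) : Convex ℝ (shockCone m₁ m₂) := by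
  intro X hX Y hY s r hs hr _
  obtain ⟨h1, h2, h3⟩ := hX
  obtain ⟨g1, g2, g3⟩ := hY
  refine ⟨?_, ?_, ?_⟩ <;> simp only [Prod.fst_add, Prod.snd_add, Prod.smul_fst, Prod.smul_snd,
    smul_eq_mul]
  · positivity
  · nlinarith [mul_le_mul_of_nonneg_left h2 hs, mul_le_mul_of_nonneg_left g2 hr]
  · nlinarith [mul_le_mul_of_nonneg_left h3 hs, mul_le_mul_of_nonneg_left g3 hr]

theorem uniqueDiffOn_shockCone {m₁ m₂ : ℝ} (hm : m₁ < m₂) :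
    UniqueDiffOn ℝ (shockCone m₁ m₂) := by
  refine uniqueDiffOn_convex (convex_shockCone m₁ m₂)
    ⟨((0, 0, 1, (m₁ + m₂) / 2), 0, 0), mem_interior.2 ⟨{X : ShockVar | 0 < X.1.2.2.1 ∧
      m₁ * X.1.2.2.1 < X.1.2.2.2 ∧ X.1.2.2.2 < m₂ * X.1.2.2.1}, ?_, ?_, ?_⟩⟩
  · exact fun X hX => ⟨hX.1.le, hX.2.1.le, hX.2.2.le⟩
  · have o1 : IsOpen {X : ShockVar | 0 < X.1.2.2.1} := isOpen_lt (by fun_prop) (by fun_prop)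
    have o2 : IsOpen {X : ShockVar | m₁ * X.1.2.2.1 < X.1.2.2.2} :=
      isOpen_lt (by fun_prop) (by fun_prop)
    have o3 : IsOpen {X : ShockVar | X.1.2.2.2 < m₂ * X.1.2.2.1} :=
      isOpen_lt (by fun_prop) (by fun_prop)
    exact o1.inter (o2.inter o3)
  · refine ⟨one_pos, ?_, ?_⟩ <;> simp only <;> linarith

/-- The derivative within a set in the direction of a line contained in the set. -/
theorem fderivWithin_apply_of_line {E : Type*} [NormedAddCommGroup E] [NormedSpace ℝ E] {f : E → ℝ}
    {s : Set E} {x e : E} {d : ℝ} (hf : DifferentiableWithinAt ℝ f s x)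
    (hline : ∀ r : ℝ, x + r • e ∈ s) (hd : HasDerivAt (fun r : ℝ => f (x + r • e)) d 0) :
    fderivWithin ℝ f s x e = d := by
  have h0 : HasDerivAt (fun r : ℝ => x + r • e) e 0 := by
    simpa using ((hasDerivAt_id (0 : ℝ)).smul_const e).const_add x
  have h1 := HasFDerivWithinAt.comp_hasDerivWithinAt (f := fun r : ℝ => x + r • e)
    (s := univ) (t := s) 0 (by simpa using hf.hasFDerivWithinAt) h0.hasDerivWithinAt
    (fun r _ => hline r)
  rw [hasDerivWithinAt_univ] at h1
  exact h1.unique hd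

/-- Existence for the system, with hypotheses at the base point only. The shock variables stay in any
prescribed neighbourhood `U` of the base point relative to the cone, the bulk variables in `U'`. -/
theorem exists_isSystemSolution {a b₀ k₀ p₀ m₁ m₂ : ℝ} {Ψ G τ χ : ShockVar → ℝ}
    {w : BulkVar → ℝ} (ha : 0 < a) (ha' : a < 1) (hm : m₁ < m₂)
    (hΨ : ContDiffWithinAt ℝ 2 Ψ (shockCone m₁ m₂) ((b₀, b₀, 0, 0), k₀, p₀))
    (hG : ContDiffWithinAt ℝ 2 G (shockCone m₁ m₂) ((b₀, b₀, 0, 0), k₀, p₀))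
    (hτ : ContDiffWithinAt ℝ 2 τ (shockCone m₁ m₂) ((b₀, b₀, 0, 0), k₀, p₀))
    (hχ : ContDiffWithinAt ℝ 2 χ (shockCone m₁ m₂) ((b₀, b₀, 0, 0), k₀, p₀))
    (hw : ContDiffAt ℝ 2 w (b₀, b₀, k₀, k₀, p₀, p₀))
    (hΨk : |fderivWithin ℝ Ψ (shockCone m₁ m₂) ((b₀, b₀, 0, 0), k₀, p₀) (0, 1, 0)| ≤ 1)
    (hGp : |fderivWithin ℝ G (shockCone m₁ m₂) ((b₀, b₀, 0, 0), k₀, p₀) (0, 0, 1)| ≤ 1)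
    (hGk : ∀ q k k' p, G (q, k, p) = G (q, k', p))
    (hτ0 : 0 < τ ((b₀, b₀, 0, 0), k₀, p₀))
    (hχ1 : m₁ * τ ((b₀, b₀, 0, 0), k₀, p₀) < χ ((b₀, b₀, 0, 0), k₀, p₀))
    (hχ2 : χ ((b₀, b₀, 0, 0), k₀, p₀) < m₂ * τ ((b₀, b₀, 0, 0), k₀, p₀))
    (hΨ0 : Ψ ((b₀, b₀, 0, 0), k₀, p₀) = k₀) (hG0 : G ((b₀, b₀, 0, 0), k₀, p₀) = p₀)
    {U : Set ShockVar} (hU : U ∈ 𝓝[shockCone m₁ m₂] ((b₀, b₀, 0, 0), k₀, p₀))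
    {U' : Set BulkVar} (hU' : U' ∈ 𝓝 (b₀, b₀, k₀, k₀, p₀, p₀)) :
    ∃ ε₀ : ℝ, 0 < ε₀ ∧ ∀ ε, 0 < ε → ε ≤ ε₀ →
      ∃ (b k κ t x : ℝ → ℝ) (p P W : ℝ → ℝ → ℝ),
        IsSystemSolution a b₀ k₀ p₀ Ψ G τ χ w ε b k κ t x p P W ∧
        (∀ v ∈ Icc 0 ε, ((b v, b (a * v), t v, x v), k (a * v), p (a * v) v) ∈
          U ∩ shockCone m₁ m₂) ∧
        ∀ u ∈ Icc 0 ε, ∀ v ∈ Icc 0 ε, (b u, b v, k u, k v, p u v, p v u) ∈ U' := by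
  set X₀ : ShockVar := ((b₀, b₀, 0, 0), k₀, p₀) with hX₀
  set Z₀ : BulkVar := (b₀, b₀, k₀, k₀, p₀, p₀) with hZ₀
  set C := shockCone m₁ m₂ with hC
  have hX₀C : X₀ ∈ C := by simp [hX₀, hC, shockCone]
  have hconv := convex_shockCone m₁ m₂
  have huniq := uniqueDiffOn_shockCone hm
  obtain ⟨L₁, hL₁⟩ := eventually_isTameOn hΨ hconv huniq hX₀C
  obtain ⟨L₂, hL₂⟩ := eventually_isTameOn hG hconv huniq hX₀C
  obtain ⟨L₃, hL₃⟩ := eventually_isTameOn hτ hconv huniq hX₀C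
  obtain ⟨L₄, hL₄⟩ := eventually_isTameOn hχ hconv huniq hX₀C
  obtain ⟨L₅, hL₅⟩ := eventually_isTameOn hw.contDiffWithinAt convex_univ uniqueDiffOn_univ
    (mem_univ Z₀)
  set L := max 0 (max L₁ (max L₂ (max L₃ (max L₄ L₅)))) with hL
  -- strictly between `1` and `1 / a`: the bounds `≤ 1` at the base point become `< q₀` nearby
  set q₀ := (1 + 1 / a) / 2 with hq₀
  have h1a : 1 < 1 / a := by rw [lt_div_iff₀ ha]; linarith
  have hq1 : 1 < q₀ := by rw [hq₀]; linarith
  have hcont {f : ShockVar → ℝ} (hf : ContDiffWithinAt ℝ 2 f C X₀) (e : ShockVar) :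
      ContinuousWithinAt (fun X => |fderivWithin ℝ f C X e|) C X₀ :=
    ((hf.fderivWithin_right huniq (m := 1) (by norm_num) hX₀C).continuousWithinAt.clm_apply
      continuousWithinAt_const).abs
  have hdiffG : ∀ᶠ X in 𝓝[C] X₀, DifferentiableWithinAt ℝ G C X := by
    have := hG.eventually (by simp)
    rw [insert_eq_of_mem hX₀C] at this
    exact this.mono fun X hX => hX.differentiableWithinAt (by norm_num)
  have hev : ∀ᶠ X in 𝓝[C] X₀, X ∈ C ∧ |fderivWithin ℝ Ψ C X (0, 1, 0)| < q₀ ∧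
      |fderivWithin ℝ G C X (0, 0, 1)| < q₀ ∧ 0 < τ X ∧ 0 < χ X - m₁ * τ X ∧
      0 < m₂ * τ X - χ X ∧ DifferentiableWithinAt ℝ G C X ∧ X ∈ U := by
    filter_upwards [self_mem_nhdsWithin,
      (hcont hΨ (0, 1, 0)).eventually_lt_const (hΨk.trans_lt hq1),
      (hcont hG (0, 0, 1)).eventually_lt_const (hGp.trans_lt hq1),
      hτ.continuousWithinAt.eventually_const_lt hτ0,
      (hχ.continuousWithinAt.sub (hτ.continuousWithinAt.const_mul m₁)).eventually_const_lt
        (sub_pos.2 hχ1),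
      ((hτ.continuousWithinAt.const_mul m₂).sub hχ.continuousWithinAt).eventually_const_lt
        (sub_pos.2 hχ2), hdiffG, hU] with X c1 c2 c3 c4 c5 c6 c7 c8
    exact ⟨c1, c2, c3, c4, c5, c6, c7, c8⟩
  have hS : ∀ᶠ s in (𝓝[C] X₀).smallSets, IsTameOn Ψ (fderivWithin ℝ Ψ C) L s ∧
      IsTameOn G (fderivWithin ℝ G C) L s ∧ IsTameOn τ (fderivWithin ℝ τ C) L s ∧
      IsTameOn χ (fderivWithin ℝ χ C) L s ∧ s ⊆ {X | X ∈ C ∧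
        |fderivWithin ℝ Ψ C X (0, 1, 0)| < q₀ ∧
      |fderivWithin ℝ G C X (0, 0, 1)| < q₀ ∧ 0 < τ X ∧ 0 < χ X - m₁ * τ X ∧
      0 < m₂ * τ X - χ X ∧ DifferentiableWithinAt ℝ G C X ∧ X ∈ U} := by
    filter_upwards [hL₁ L (by simp [hL]), hL₂ L (by simp [hL]), hL₃ L (by simp [hL]),
      hL₄ L (by simp [hL]), eventually_smallSets_subset.2 hev] with s c1 c2 c3 c4 c5
    exact ⟨c1, c2, c3, c4, c5⟩
  have hS' : ∀ᶠ s in (𝓝[univ] Z₀).smallSets, IsTameOn w (fderivWithin ℝ w univ) L s ∧ s ⊆ U' := by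
    filter_upwards [hL₅ L (by simp [hL]), eventually_smallSets_subset.2
      (mem_nhdsWithin_of_mem_nhds hU')] with s c1 c2
    exact ⟨c1, c2⟩
  obtain ⟨N, hN, hNs⟩ := eventually_smallSets.1 hS
  obtain ⟨N', hN', hNs'⟩ := eventually_smallSets.1 hS'
  rw [nhdsWithin_univ] at hN'
  obtain ⟨r, hr, hrN⟩ := Metric.mem_nhdsWithin_iff.1 hN
  obtain ⟨r', hr', hrN'⟩ := Metric.mem_nhds_iff.1 hN'
  set δ := min 1 (min (r / 2) (r' / 2)) with hδ
  have hδ0 : 0 < δ := by positivity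
  have hsub : C ∩ Metric.closedBall X₀ δ ⊆ N := fun X hX => hrN
    ⟨Metric.closedBall_subset_ball (((min_le_right _ _).trans (min_le_left _ _)).trans_lt
      (half_lt_self hr)) hX.2, hX.1⟩
  have hsub' : Metric.closedBall Z₀ δ ⊆ N' := fun X hX => hrN'
    (Metric.closedBall_subset_ball (((min_le_right _ _).trans (min_le_right _ _)).trans_lt
      (half_lt_self hr')) hX)
  obtain ⟨tΨ, tG, tτ, tχ, hin⟩ := hNs _ hsub
  obtain ⟨tw, hin'⟩ := hNs' _ hsub'
  let 𝒮 : SystemData :=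
    { a := a, b₀ := b₀, k₀ := k₀, p₀ := p₀, m₁ := m₁, m₂ := m₂, δ := δ, L := L, q₀ := q₀
      Ψ := Ψ, G := G, τ := τ, χ := χ, w := w
      Ψ' := fderivWithin ℝ Ψ C, G' := fderivWithin ℝ G C, τ' := fderivWithin ℝ τ C
      χ' := fderivWithin ℝ χ C, w' := fderivWithin ℝ w univ
      a_pos := ha
      a_lt := ha'
      δ_pos := hδ0
      δ_le := min_le_left _ _
      L_nonneg := le_max_left _ _
      q₀_nonneg := by linarith
      q₀_lt := by rw [hq₀]; field_simp; linarith
      tame_Ψ := tΨ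
      tame_G := tG
      tame_τ := tτ
      tame_χ := tχ
      tame_w := tw
      coeff_Ψ := fun X hX e => by
        have e1 : e = (e.1, 0, e.2.2) + e.2.1 • ((0, 1, 0) : ShockVar) := by
          ext <;> simp
        have b1 : |fderivWithin ℝ Ψ C X (e.1, 0, e.2.2)| ≤ L * (‖e.1‖ + |e.2.2|) := by
          rw [← Real.norm_eq_abs]
          refine ((fderivWithin ℝ Ψ C X).le_opNorm _).trans
            (mul_le_mul (tΨ.norm_le X hX) ?_ (norm_nonneg _) (le_max_left _ _))
          rw [Prod.norm_mk e.1, Prod.norm_mk (0 : ℝ), norm_zero, Real.norm_eq_abs]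
          have := norm_nonneg e.1
          have := abs_nonneg e.2.2
          exact max_le (by linarith) (max_le (by linarith) (by linarith))
        have b2 := (hin hX).2.1
        conv_lhs => rw [e1, map_add, map_smul, smul_eq_mul]
        refine (abs_add_le _ _).trans ?_
        rw [abs_mul, add_comm]
        refine add_le_add ?_ b1
        rw [mul_comm]
        gcongr
      coeff_G := fun X hX e => by
        have e1 : e = (e.1, 0, 0) + e.2.1 • ((0, 1, 0) : ShockVar) +
          e.2.2 • ((0, 0, 1) : ShockVar) := by ext <;> simp
        have b1 : |fderivWithin ℝ G C X (e.1, 0, 0)| ≤ L * ‖e.1‖ := by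
          rw [← Real.norm_eq_abs]
          refine ((fderivWithin ℝ G C X).le_opNorm _).trans
            (mul_le_mul (tG.norm_le X hX) ?_ (norm_nonneg _) (le_max_left _ _))
          simp [Prod.norm_mk]
        have b2 := (hin hX).2.2.1
        -- `G` does not depend on the slope
        have b3 : fderivWithin ℝ G C X (0, 1, 0) = 0 :=
          fderivWithin_apply_of_line (hin hX).2.2.2.2.2.2.1
            (fun s => by simpa [hC, shockCone] using hX.1)
            (by
              have h2 : (fun s : ℝ => G (X + s • ((0, 1, 0) : ShockVar))) = fun _ => G X := by
                funext s
                obtain ⟨q, k, p⟩ := X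
                simpa using hGk q (k + s) k p
              rw [h2]
              exact hasDerivAt_const 0 _)
        conv_lhs => rw [e1, map_add, map_add, map_smul, map_smul, b3, smul_zero, add_zero,
          smul_eq_mul]
        refine (abs_add_le _ _).trans ?_
        rw [abs_mul, add_comm]
        refine add_le_add ?_ b1
        rw [mul_comm]
        gcongr
      τ_nonneg := fun X hX => (hin hX).2.2.2.1.le
      le_χ := fun X hX => by have := (hin hX).2.2.2.2.1; linarith
      χ_le := fun X hX => by have := (hin hX).2.2.2.2.2.1; linarith
      Ψ_base := hΨ0
      G_base := hG0 }
  obtain ⟨ε₀, hε₀, hsol⟩ := 𝒮.exists_solution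
  refine ⟨ε₀, hε₀, fun ε hε hεle => ?_⟩
  obtain ⟨b, k, κ, t, x, p, P, W, h1, h2, h3⟩ := hsol ε hε hεle
  exact ⟨b, k, κ, t, x, p, P, W, h1, fun v hv => ⟨(hin (h2 v hv)).2.2.2.2.2.2.2, (h2 v hv).1⟩,
    fun u hu v hv => hin' (h3 u hu v hv)⟩

/-! ### Primitives on convex sets of the plane -/

theorem contDiffOn_succ_of_hasFDerivWithinAt {E G : Type*} [NormedAddCommGroup E]
    [NormedSpace ℝ E] [NormedAddCommGroup G] [NormedSpace ℝ G] {f : E → G} {f' : E → E →L[ℝ] G}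
    {s : Set E} (n : ℕ) (hf : ∀ x ∈ s, HasFDerivWithinAt f (f' x) s x) (hf' : ContDiffOn ℝ n f' s) :
    ContDiffOn ℝ (n + 1) f s := by
  rw [contDiffOn_succ_iff_hasFDerivWithinAt (by simp)]
  refine fun x hx => ⟨s, ?_, by simp, f', hf, hf'⟩
  rw [insert_eq_of_mem hx]
  exact self_mem_nhdsWithin

theorem contDiffOn_planeForm {n : WithTop ℕ∞} {A B : ℝ × ℝ → ℝ} {s : Set (ℝ × ℝ)}
    (hA : ContDiffOn ℝ n A s) (hB : ContDiffOn ℝ n B s) :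
    ContDiffOn ℝ n (fun z => planeForm (A z) (B z)) s := by
  unfold planeForm
  exact (hA.smul contDiffOn_const).add (hB.smul contDiffOn_const)

/-- The Poincaré lemma in the plane: a closed form `M du + N dv` of class `C¹` on a convex set has
a primitive of class `C²`. -/
theorem exists_primitive_of_closed {s : Set (ℝ × ℝ)} (hs : Convex ℝ s)
    {M N Mu Mv Nv : ℝ × ℝ → ℝ}
    (hM : ∀ z ∈ s, HasFDerivWithinAt M (planeForm (Mu z) (Mv z)) s z)
    (hN : ∀ z ∈ s, HasFDerivWithinAt N (planeForm (Mv z) (Nv z)) s z)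
    (hM1 : ContDiffOn ℝ 1 M s) (hN1 : ContDiffOn ℝ 1 N s) (z₀ : ℝ × ℝ) :
    ∃ f : ℝ × ℝ → ℝ, f z₀ = 0 ∧ ContDiffOn ℝ 2 f s ∧
      ∀ z ∈ s, HasFDerivWithinAt f (planeForm (M z) (N z)) s z := by
  have hform : ∀ z ∈ s, HasFDerivWithinAt (fun z => planeForm (M z) (N z))
      ((planeForm (Mu z) (Mv z)).smulRight (ContinuousLinearMap.fst ℝ ℝ ℝ) +
        (planeForm (Mv z) (Nv z)).smulRight (ContinuousLinearMap.snd ℝ ℝ ℝ)) s z := fun z hz =>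
    ((hM z hz).smul_const (ContinuousLinearMap.fst ℝ ℝ ℝ)).add
      ((hN z hz).smul_const (ContinuousLinearMap.snd ℝ ℝ ℝ))
  obtain ⟨f, hf⟩ := hs.exists_forall_hasFDerivWithinAt_of_hasFDerivWithinAt_symmetric hform
    (fun z _ x _ y _ => by simp; ring)
  have hf' : ∀ z ∈ s, HasFDerivWithinAt (fun z => f z - f z₀) (planeForm (M z) (N z)) s z :=
    fun z hz => (hf z hz).sub_const _
  refine ⟨fun z => f z - f z₀, sub_self _, ?_, hf'⟩
  have := contDiffOn_succ_of_hasFDerivWithinAt 1 hf' (contDiffOn_planeForm hM1 hN1)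
  simpa [one_add_one_eq_two] using this

/-! ### Smoothness of the equation of state in the Riemann invariants -/

section Gas

variable {p : ℝ → ℝ} {r : ℝ} (hp : ContDiffOn ℝ ∞ p (Ioi 0)) (hp' : ∀ ρ : ℝ, 0 < ρ → 0 < deriv p ρ)
  (hr : 0 < r)

include hp' in
theorem soundSpeed_pos {ρ : ℝ} (hρ : 0 < ρ) : 0 < soundSpeed p ρ :=
  Real.sqrt_pos.2 (hp' ρ hρ)

include hp' in
theorem soundSpeed_sq {ρ : ℝ} (hρ : 0 < ρ) : soundSpeed p ρ ^ 2 = deriv p ρ :=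
  Real.sq_sqrt (hp' ρ hρ).le

include hp in
theorem hasDerivAt_pressure {ρ : ℝ} (hρ : 0 < ρ) : HasDerivAt p (deriv p ρ) ρ :=
  ((hp.contDiffAt (Ioi_mem_nhds hρ)).differentiableAt (by simp)).hasDerivAt

include hp hp'

theorem contDiffOn_soundSpeed : ContDiffOn ℝ ∞ (soundSpeed p) (Ioi 0) :=
  (hp.deriv_of_isOpen isOpen_Ioi (by simp)).sqrt fun ρ hρ => (hp' ρ hρ).ne'

theorem contDiffOn_soundSpeed_div : ContDiffOn ℝ ∞ (fun s => soundSpeed p s / s) (Ioi 0) :=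
  (contDiffOn_soundSpeed hp hp').div contDiffOn_id fun _ hs => ne_of_gt hs

include hr

theorem hasDerivAt_potential {ρ : ℝ} (hρ : 0 < ρ) :
    HasDerivAt (potential p r) (soundSpeed p ρ / ρ) ρ := by
  have hc := (contDiffOn_soundSpeed_div hp hp').continuousOn
  have hsub : uIcc r ρ ⊆ Ioi 0 := fun s hs => lt_of_lt_of_le (lt_min hr hρ) hs.1
  exact intervalIntegral.integral_hasDerivAt_right ((hc.mono hsub).intervalIntegrable)
    (hc.stronglyMeasurableAtFilter isOpen_Ioi ρ hρ) (hc.continuousAt (Ioi_mem_nhds hρ))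

theorem contDiffOn_potential : ContDiffOn ℝ ∞ (potential p r) (Ioi 0) := by
  rw [contDiffOn_infty_iff_deriv_of_isOpen isOpen_Ioi]
  refine ⟨fun ρ hρ => (hasDerivAt_potential hp hp' hr hρ).differentiableAt.differentiableWithinAt,
    (contDiffOn_soundSpeed_div hp hp').congr fun ρ hρ => (hasDerivAt_potential hp hp' hr hρ).deriv⟩

theorem strictMonoOn_potential : StrictMonoOn (potential p r) (Ioi 0) := by
  refine strictMonoOn_of_deriv_pos (convex_Ioi 0) (contDiffOn_potential hp hp' hr).continuousOn ?_
  intro ρ hρ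
  rw [interior_Ioi] at hρ
  rw [(hasDerivAt_potential hp hp' hr hρ).deriv]
  exact div_pos (soundSpeed_pos hp' hρ) hρ

end Gas

/-- The density as a function of the value of the potential. -/
def densityOf (p : ℝ → ℝ) (r σ : ℝ) : ℝ := Function.invFunOn (potential p r) (Ioi 0) σ

/-- The sound speed as a function of the value of the potential. -/
def speedOf (p : ℝ → ℝ) (r σ : ℝ) : ℝ := soundSpeed p (densityOf p r σ)

theorem density_eq (p : ℝ → ℝ) (r α β : ℝ) : density p r α β = densityOf p r ((α + β) / 2) := rfl

theorem cOut_eq (p : ℝ → ℝ) (r α β : ℝ) :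
    cOut p r α β = (α - β) / 2 + speedOf p r ((α + β) / 2) := rfl

section Gas

variable {p : ℝ → ℝ} {r : ℝ} (hp : ContDiffOn ℝ ∞ p (Ioi 0)) (hp' : ∀ ρ : ℝ, 0 < ρ → 0 < deriv p ρ)
  (hr : 0 < r)

include hp hp' hr

theorem densityOf_potential {ρ : ℝ} (hρ : 0 < ρ) : densityOf p r (potential p r ρ) = ρ :=
  (strictMonoOn_potential hp hp' hr).injOn.leftInvOn_invFunOn hρ

theorem exists_local_inverse_potential {ρ : ℝ} (hρ : 0 < ρ) :
    ∃ g : ℝ → ℝ, ContDiffAt ℝ ∞ g (potential p r ρ) ∧ g (potential p r ρ) = ρ ∧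
      ∀ᶠ σ in 𝓝 (potential p r ρ), potential p r (g σ) = σ := by
  have h1 : ContDiffAt ℝ ∞ (potential p r) ρ :=
    (contDiffOn_potential hp hp' hr).contDiffAt (Ioi_mem_nhds hρ)
  have h2 := hasDerivAt_potential hp hp' hr hρ
  have hne : soundSpeed p ρ / ρ ≠ 0 := (div_pos (soundSpeed_pos hp' hρ) hρ).ne'
  have h3 : HasFDerivAt (potential p r)
      ((ContinuousLinearEquiv.unitsEquivAut ℝ (Units.mk0 _ hne) : ℝ ≃L[ℝ] ℝ) : ℝ →L[ℝ] ℝ) ρ :=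
    h2.hasFDerivAt_equiv hne
  refine ⟨h1.localInverse h3 (by simp), h1.to_localInverse h3 (by simp),
    h1.localInverse_apply_image h3 (by simp), ?_⟩
  exact (h1.hasStrictFDerivAt' h3 (by simp)).eventually_right_inverse

/-- Near the potential of a positive density, `densityOf` is a smooth inverse of the potential. -/
theorem densityOf_eventually {ρ : ℝ} (hρ : 0 < ρ) :
    ContDiffAt ℝ ∞ (densityOf p r) (potential p r ρ) ∧
      ∀ᶠ σ in 𝓝 (potential p r ρ), 0 < densityOf p r σ ∧ potential p r (densityOf p r σ) = σ := by
  obtain ⟨g, hg, hg0, hgi⟩ := exists_local_inverse_potential hp hp' hr hρ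
  have hpos : ∀ᶠ σ in 𝓝 (potential p r ρ), 0 < g σ :=
    hg.continuousAt.eventually_const_lt (by rw [hg0]; exact hρ)
  have heq : ∀ᶠ σ in 𝓝 (potential p r ρ), densityOf p r σ = g σ := by
    filter_upwards [hpos, hgi] with σ h1 h2
    rw [← densityOf_potential hp hp' hr h1, h2]
  refine ⟨hg.congr_of_eventuallyEq heq, ?_⟩
  filter_upwards [hpos, hgi, heq] with σ h1 h2 h3
  rw [h3]
  exact ⟨h1, h2⟩

theorem contDiffAt_densityOf {ρ : ℝ} (hρ : 0 < ρ) :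
    ContDiffAt ℝ ∞ (densityOf p r) (potential p r ρ) := (densityOf_eventually hp hp' hr hρ).1

theorem hasDerivAt_densityOf {ρ : ℝ} (hρ : 0 < ρ) :
    HasDerivAt (densityOf p r) (ρ / soundSpeed p ρ) (potential p r ρ) := by
  have h := HasDerivAt.of_local_left_inverse (f := potential p r) (g := densityOf p r)
    (f' := soundSpeed p ρ / ρ) (a := potential p r ρ)
    (contDiffAt_densityOf hp hp' hr hρ).continuousAt
    (by rw [densityOf_potential hp hp' hr hρ]; exact hasDerivAt_potential hp hp' hr hρ)
    (div_pos (soundSpeed_pos hp' hρ) hρ).ne'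
    ((densityOf_eventually hp hp' hr hρ).2.mono fun σ h => h.2)
  rwa [inv_div] at h

theorem contDiffAt_speedOf {ρ : ℝ} (hρ : 0 < ρ) :
    ContDiffAt ℝ ∞ (speedOf p r) (potential p r ρ) := by
  refine ContDiffAt.comp (g := soundSpeed p) _ ?_ (contDiffAt_densityOf hp hp' hr hρ)
  rw [densityOf_potential hp hp' hr hρ]
  exact (contDiffOn_soundSpeed hp hp').contDiffAt (Ioi_mem_nhds hρ)

theorem speedOf_potential {ρ : ℝ} (hρ : 0 < ρ) :
    speedOf p r (potential p r ρ) = soundSpeed p ρ := by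
  rw [speedOf, densityOf_potential hp hp' hr hρ]

theorem contDiffAt_pressure_densityOf {ρ : ℝ} (hρ : 0 < ρ) :
    ContDiffAt ℝ ∞ (fun σ => p (densityOf p r σ)) (potential p r ρ) := by
  refine ContDiffAt.comp (g := p) _ ?_ (contDiffAt_densityOf hp hp' hr hρ)
  rw [densityOf_potential hp hp' hr hρ]
  exact hp.contDiffAt (Ioi_mem_nhds hρ)

/-! ### The jump function at the reflection point -/

theorem contDiffAt_jumpJ {ρ₁ ρ₂ α₁ β₁ α₂ β₂ : ℝ} (hρ₁ : 0 < ρ₁) (hρ₂ : 0 < ρ₂)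
    (h₁ : (α₁ + β₁) / 2 = potential p r ρ₁) (h₂ : (α₂ + β₂) / 2 = potential p r ρ₂) :
    ContDiffAt ℝ ∞ (fun y : ℝ × ℝ × ℝ × ℝ => jumpJ p r y.1 y.2.1 y.2.2.1 y.2.2.2)
      (α₁, β₁, α₂, β₂) := by
  have s₁ : ContDiffAt ℝ ∞ (fun y : ℝ × ℝ × ℝ × ℝ => (y.1 + y.2.1) / 2) (α₁, β₁, α₂, β₂) := by
    fun_prop
  have s₂ : ContDiffAt ℝ ∞ (fun y : ℝ × ℝ × ℝ × ℝ => (y.2.2.1 + y.2.2.2) / 2)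
      (α₁, β₁, α₂, β₂) := by fun_prop
  have d₁ : ContDiffAt ℝ ∞ (fun y : ℝ × ℝ × ℝ × ℝ => densityOf p r ((y.1 + y.2.1) / 2))
      (α₁, β₁, α₂, β₂) :=
    ContDiffAt.comp (g := densityOf p r) _
      (by simp only [h₁]; exact contDiffAt_densityOf hp hp' hr hρ₁) s₁
  have d₂ : ContDiffAt ℝ ∞ (fun y : ℝ × ℝ × ℝ × ℝ => densityOf p r ((y.2.2.1 + y.2.2.2) / 2))
      (α₁, β₁, α₂, β₂) :=
    ContDiffAt.comp (g := densityOf p r) _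
      (by simp only [h₂]; exact contDiffAt_densityOf hp hp' hr hρ₂) s₂
  have e₁ : ContDiffAt ℝ ∞ (fun y : ℝ × ℝ × ℝ × ℝ => p (densityOf p r ((y.1 + y.2.1) / 2)))
      (α₁, β₁, α₂, β₂) :=
    ContDiffAt.comp (g := fun σ => p (densityOf p r σ)) _
      (by simp only [h₁]; exact contDiffAt_pressure_densityOf hp hp' hr hρ₁) s₁
  have e₂ : ContDiffAt ℝ ∞ (fun y : ℝ × ℝ × ℝ × ℝ => p (densityOf p r ((y.2.2.1 + y.2.2.2) / 2)))
      (α₁, β₁, α₂, β₂) :=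
    ContDiffAt.comp (g := fun σ => p (densityOf p r σ)) _
      (by simp only [h₂]; exact contDiffAt_pressure_densityOf hp hp' hr hρ₂) s₂
  have v₁ : ContDiffAt ℝ ∞ (fun y : ℝ × ℝ × ℝ × ℝ => (y.1 - y.2.1) / 2)
      (α₁, β₁, α₂, β₂) := by fun_prop
  have v₂ : ContDiffAt ℝ ∞ (fun y : ℝ × ℝ × ℝ × ℝ => (y.2.2.1 - y.2.2.2) / 2)
      (α₁, β₁, α₂, β₂) := by fun_prop
  exact (((d₁.mul v₁).sub (d₂.mul v₂)).pow 2).sub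
    ((((d₁.mul (v₁.pow 2)).add e₁).sub ((d₂.mul (v₂.pow 2)).add e₂)).mul (d₁.sub d₂))

theorem contDiffAt_shockSpeed {ρ₁ ρ₂ α₁ β₁ α₂ β₂ : ℝ} (hρ₁ : 0 < ρ₁) (hρ₂ : 0 < ρ₂)
    (hne : ρ₁ ≠ ρ₂)
    (h₁ : (α₁ + β₁) / 2 = potential p r ρ₁) (h₂ : (α₂ + β₂) / 2 = potential p r ρ₂) :
    ContDiffAt ℝ ∞ (fun y : ℝ × ℝ × ℝ × ℝ => shockSpeed p r y.1 y.2.1 y.2.2.1 y.2.2.2)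
      (α₁, β₁, α₂, β₂) := by
  have s₁ : ContDiffAt ℝ ∞ (fun y : ℝ × ℝ × ℝ × ℝ => (y.1 + y.2.1) / 2) (α₁, β₁, α₂, β₂) := by
    fun_prop
  have s₂ : ContDiffAt ℝ ∞ (fun y : ℝ × ℝ × ℝ × ℝ => (y.2.2.1 + y.2.2.2) / 2)
      (α₁, β₁, α₂, β₂) := by fun_prop
  have d₁ : ContDiffAt ℝ ∞ (fun y : ℝ × ℝ × ℝ × ℝ => densityOf p r ((y.1 + y.2.1) / 2))
      (α₁, β₁, α₂, β₂) :=
    ContDiffAt.comp (g := densityOf p r) _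
      (by simp only [h₁]; exact contDiffAt_densityOf hp hp' hr hρ₁) s₁
  have d₂ : ContDiffAt ℝ ∞ (fun y : ℝ × ℝ × ℝ × ℝ => densityOf p r ((y.2.2.1 + y.2.2.2) / 2))
      (α₁, β₁, α₂, β₂) :=
    ContDiffAt.comp (g := densityOf p r) _
      (by simp only [h₂]; exact contDiffAt_densityOf hp hp' hr hρ₂) s₂
  have v₁ : ContDiffAt ℝ ∞ (fun y : ℝ × ℝ × ℝ × ℝ => (y.1 - y.2.1) / 2)
      (α₁, β₁, α₂, β₂) := by fun_prop
  have v₂ : ContDiffAt ℝ ∞ (fun y : ℝ × ℝ × ℝ × ℝ => (y.2.2.1 - y.2.2.2) / 2)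
      (α₁, β₁, α₂, β₂) := by fun_prop
  refine ((d₁.mul v₁).sub (d₂.mul v₂)).div (d₁.sub d₂) ?_
  simp only [density_eq, h₁, h₂, densityOf_potential hp hp' hr hρ₁, densityOf_potential hp hp' hr hρ₂]
  exact sub_ne_zero.2 hne

end Gas

/-- The derivative of the jump function along a curve of states behind the shock, issuing from the
state `(ρ₀, 0)`. -/
theorem hasDerivAt_jumpI {p ρf wf : ℝ → ℝ} {ρm wm ρ₀ V₀ p' ρ' w' z : ℝ}
    (hρf : HasDerivAt ρf ρ' z) (hwf : HasDerivAt wf w' z) (hp : HasDerivAt p p' ρ₀)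
    (hρ : ρf z = ρ₀) (hw : wf z = 0) (hmass : (ρ₀ - ρm) * V₀ = ρ₀ * 0 - ρm * wm)
    (hmom : (ρ₀ * 0 - ρm * wm) * V₀ = (ρ₀ * 0 ^ 2 + p ρ₀) - (ρm * wm ^ 2 + p ρm)) :
    HasDerivAt (fun s => jumpI p (ρf s) ρm (wf s) wm)
      ((ρ₀ - ρm) * (2 * V₀ * ρ₀ * w' - (p' + V₀ ^ 2) * ρ')) z := by
  have hpf : HasDerivAt (fun s => p (ρf s)) (p' * ρ') z := by
    rw [← hρ] at hp
    exact hp.comp z hρf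
  have h1 : HasDerivAt (fun s => (ρf s * wf s - ρm * wm) ^ 2 -
      ((ρf s * wf s ^ 2 + p (ρf s)) - (ρm * wm ^ 2 + p ρm)) * (ρf s - ρm)) _ z :=
    (((hρf.fun_mul hwf).sub_const (ρm * wm)).fun_pow 2).fun_sub
      ((((hρf.fun_mul (hwf.fun_pow 2)).fun_add hpf).sub_const (ρm * wm ^ 2 + p ρm)).fun_mul
        (hρf.sub_const ρm))
  refine h1.congr_deriv ?_
  simp only [hρ, hw]
  have e : (ρ₀ * 0 ^ 2 + p ρ₀) - (ρm * wm ^ 2 + p ρm) = (ρ₀ - ρm) * V₀ * V₀ := by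
    rw [← hmom, hmass]
  rw [e]
  have e2 : ρ₀ * 0 - ρm * wm = (ρ₀ - ρm) * V₀ := hmass.symm
  rw [e2]
  push_cast
  ring

/-! ### The inverse of a plane map on a compact set -/

/-- The linear automorphism of the plane with rows `(A, B)` and `(C, D)`. -/
def planeEquiv (A B C D : ℝ) (h : A * D - B * C ≠ 0) : (ℝ × ℝ) ≃L[ℝ] (ℝ × ℝ) :=
  ContinuousLinearEquiv.equivOfInverse ((planeForm A B).prod (planeForm C D))
    ((planeForm (D / (A * D - B * C)) (-B / (A * D - B * C))).prod
      (planeForm (-C / (A * D - B * C)) (A / (A * D - B * C))))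
    (fun y => by
      ext <;> simp only [ContinuousLinearMap.prod_apply, planeForm_apply, div_mul_eq_mul_div,
        ← add_div] <;> rw [div_eq_iff h] <;> ring)
    (fun y => by
      ext <;> simp only [ContinuousLinearMap.prod_apply, planeForm_apply, div_mul_eq_mul_div,
        ← add_div, ← mul_div_assoc] <;> rw [div_eq_iff h] <;> ring)

/-- An injective map of class `C²` with invertible derivative on a compact set of the plane, whose
points need not be interior, has an inverse of class `C²` on the image. -/
theorem exists_contDiffOn_inverse {s : Set (ℝ × ℝ)} (hs : IsCompact s)
    {t x A B C D : ℝ × ℝ → ℝ}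
    (ht : ∀ z ∈ s, HasFDerivWithinAt t (planeForm (A z) (B z)) s z)
    (hx : ∀ z ∈ s, HasFDerivWithinAt x (planeForm (C z) (D z)) s z)
    (hA : ContDiffOn ℝ 1 A s) (hB : ContDiffOn ℝ 1 B s) (hC : ContDiffOn ℝ 1 C s)
    (hD : ContDiffOn ℝ 1 D s) (hdet : ∀ z ∈ s, A z * D z - B z * C z ≠ 0)
    (hinj : InjOn (fun z => (t z, x z)) s) :
    ∃ g : ℝ × ℝ → ℝ × ℝ, ContDiffOn ℝ 2 g ((fun z => (t z, x z)) '' s) ∧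
      ∀ z ∈ s, g (t z, x z) = z := by
  set f : ℝ × ℝ → ℝ × ℝ := fun z => (t z, x z) with hf
  have hfd : ∀ z ∈ s, HasFDerivWithinAt f ((planeForm (A z) (B z)).prod (planeForm (C z) (D z)))
      s z := fun z hz => (ht z hz).prodMk (hx z hz)
  have hfc : ContinuousOn f s := fun z hz => (hfd z hz).continuousWithinAt
  set g := Function.invFunOn f s with hg
  have hgf : ∀ z ∈ s, g (f z) = z := fun z hz => hinj.leftInvOn_invFunOn hz
  have hmaps : MapsTo g (f '' s) s := by
    rintro _ ⟨z, hz, rfl⟩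
    rw [hgf z hz]; exact hz
  have hfg : ∀ y ∈ f '' s, f (g y) = y := by
    rintro _ ⟨z, hz, rfl⟩
    rw [hgf z hz]
  have hgc : ContinuousOn g (f '' s) := by
    rw [continuousOn_iff_isClosed]
    intro c hc
    refine ⟨f '' (s ∩ c), ((hs.inter_right hc).image_of_continuousOn
      (hfc.mono inter_subset_left)).isClosed, ?_⟩
    ext y
    constructor
    · rintro ⟨hyc, hy⟩
      exact ⟨⟨g y, ⟨hmaps hy, hyc⟩, hfg y hy⟩, hy⟩
    · rintro ⟨⟨z, ⟨hz, hzc⟩, rfl⟩, hy⟩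
      exact ⟨by change g (f z) ∈ c; rwa [hgf z hz], hy⟩
  set E : ℝ × ℝ → ℝ := fun z => A z * D z - B z * C z with hE
  have hEc : ContDiffOn ℝ 1 E s := (hA.mul hD).sub (hB.mul hC)
  set f' : ℝ × ℝ → (ℝ × ℝ →L[ℝ] ℝ × ℝ) := fun z =>
    (planeForm (D z / E z) (-B z / E z)).prod (planeForm (-C z / E z) (A z / E z)) with hf'
  have hf'c : ContDiffOn ℝ 1 f' s :=
    (ContinuousLinearMap.prodₗᵢ (𝕜 := ℝ) (E := ℝ × ℝ) (F := ℝ) (G := ℝ) ℝ).contDiff.comp_contDiffOn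
      ((contDiffOn_planeForm (hD.div hEc hdet) (hB.neg.div hEc hdet)).prodMk
        (contDiffOn_planeForm (hC.neg.div hEc hdet) (hA.div hEc hdet)))
  have hgd : ∀ y ∈ f '' s, HasFDerivWithinAt g (f' (g y)) (f '' s) y := by
    intro y hy
    have hz := hmaps hy
    have := HasFDerivWithinAt.of_local_left_inverse (f := f) (g := g) (s := f '' s) (t := s)
      (f' := planeEquiv (A (g y)) (B (g y)) (C (g y)) (D (g y)) (hdet _ hz)) (a := y)
      (tendsto_nhdsWithin_iff.2 ⟨hgc y hy,
        eventually_nhdsWithin_of_forall fun y hy => hmaps hy⟩) (hfd _ hz) hy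
      (eventually_nhdsWithin_of_forall hfg)
    exact this
  have h1 : ContDiffOn ℝ 1 g (f '' s) := by
    have := contDiffOn_succ_of_hasFDerivWithinAt 0 hgd
      (contDiffOn_zero.2 (hf'c.continuousOn.comp hgc hmaps))
    simpa using this
  have h2 := contDiffOn_succ_of_hasFDerivWithinAt 1 hgd (hf'c.comp h1 hmaps)
  exact ⟨g, by simpa [one_add_one_eq_two] using h2, hgf⟩

/-! ### Injectivity on the square -/

theorem hasDerivWithinAt_fst_of_planeForm {ε : ℝ} {f : ℝ × ℝ → ℝ} {A B u v : ℝ}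
    (h : HasFDerivWithinAt f (planeForm A B) (Icc 0 ε ×ˢ Icc 0 ε) (u, v)) (hv : v ∈ Icc 0 ε) :
    HasDerivWithinAt (fun s => f (s, v)) A (Icc 0 ε) u := by
  have hg : HasDerivWithinAt (fun u : ℝ => (u, v)) (1, 0) (Icc 0 ε) u :=
    ((hasDerivAt_id u).prodMk (hasDerivAt_const u v)).hasDerivWithinAt
  have := h.comp_hasDerivWithinAt (f := fun u : ℝ => (u, v)) u hg fun s hs => ⟨hs, hv⟩
  simpa [Function.comp_def] using this

theorem hasDerivWithinAt_snd_of_planeForm {ε : ℝ} {f : ℝ × ℝ → ℝ} {A B u v : ℝ}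
    (h : HasFDerivWithinAt f (planeForm A B) (Icc 0 ε ×ˢ Icc 0 ε) (u, v)) (hu : u ∈ Icc 0 ε) :
    HasDerivWithinAt (fun s => f (u, s)) B (Icc 0 ε) v := by
  have hg : HasDerivWithinAt (fun v : ℝ => (u, v)) (0, 1) (Icc 0 ε) v :=
    ((hasDerivAt_const v u).prodMk (hasDerivAt_id v)).hasDerivWithinAt
  have := h.comp_hasDerivWithinAt (f := fun v : ℝ => (u, v)) v hg fun s hs => ⟨hu, hs⟩
  simpa [Function.comp_def] using this

theorem strictMonoOn_Icc_of_hasDerivWithinAt {ε : ℝ} {f f' : ℝ → ℝ}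
    (hf : ∀ s ∈ Icc 0 ε, HasDerivWithinAt f (f' s) (Icc 0 ε) s) (hpos : ∀ s ∈ Icc 0 ε, 0 < f' s) :
    StrictMonoOn f (Icc 0 ε) := by
  refine strictMonoOn_of_deriv_pos (convex_Icc 0 ε) (fun s hs => (hf s hs).continuousWithinAt) ?_
  intro s hs
  rw [interior_Icc] at hs
  rw [((hf s (Ioo_subset_Icc_self hs)).hasDerivAt (Icc_mem_nhds hs.1 hs.2)).deriv]
  exact hpos s (Ioo_subset_Icc_self hs)

/-- A plane map `(t, x)` on a square is injective if `t` is increasing in both variables, while `x`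
is decreasing in the first and increasing in the second one: points on an ascending line are
separated by `t`, those on a descending line by `x`. -/
theorem injOn_square {ε : ℝ} {t x A B C D : ℝ × ℝ → ℝ}
    (ht : ∀ z ∈ Icc 0 ε ×ˢ Icc 0 ε,
      HasFDerivWithinAt t (planeForm (A z) (B z)) (Icc 0 ε ×ˢ Icc 0 ε) z)
    (hx : ∀ z ∈ Icc 0 ε ×ˢ Icc 0 ε,
      HasFDerivWithinAt x (planeForm (C z) (D z)) (Icc 0 ε ×ˢ Icc 0 ε) z)
    (hA : ∀ z ∈ Icc 0 ε ×ˢ Icc 0 ε, 0 < A z) (hB : ∀ z ∈ Icc 0 ε ×ˢ Icc 0 ε, 0 < B z)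
    (hC : ∀ z ∈ Icc 0 ε ×ˢ Icc 0 ε, C z < 0) (hD : ∀ z ∈ Icc 0 ε ×ˢ Icc 0 ε, 0 < D z) :
    InjOn (fun z => (t z, x z)) (Icc 0 ε ×ˢ Icc 0 ε) := by
  have t1 : ∀ v ∈ Icc 0 ε, StrictMonoOn (fun u => t (u, v)) (Icc 0 ε) := fun v hv =>
    strictMonoOn_Icc_of_hasDerivWithinAt (f' := fun u => A (u, v))
      (fun u hu => hasDerivWithinAt_fst_of_planeForm (ht (u, v) ⟨hu, hv⟩) hv)
      fun u hu => hA (u, v) ⟨hu, hv⟩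
  have t2 : ∀ u ∈ Icc 0 ε, StrictMonoOn (fun v => t (u, v)) (Icc 0 ε) := fun u hu =>
    strictMonoOn_Icc_of_hasDerivWithinAt (f' := fun v => B (u, v))
      (fun v hv => hasDerivWithinAt_snd_of_planeForm (ht (u, v) ⟨hu, hv⟩) hu)
      fun v hv => hB (u, v) ⟨hu, hv⟩
  have x1 : ∀ v ∈ Icc 0 ε, StrictMonoOn (fun u => -x (u, v)) (Icc 0 ε) := fun v hv =>
    strictMonoOn_Icc_of_hasDerivWithinAt (f' := fun u => -C (u, v))
      (fun u hu => (hasDerivWithinAt_fst_of_planeForm (hx (u, v) ⟨hu, hv⟩) hv).fun_neg)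
      fun u hu => neg_pos.2 (hC (u, v) ⟨hu, hv⟩)
  have x2 : ∀ u ∈ Icc 0 ε, StrictMonoOn (fun v => x (u, v)) (Icc 0 ε) := fun u hu =>
    strictMonoOn_Icc_of_hasDerivWithinAt (f' := fun v => D (u, v))
      (fun v hv => hasDerivWithinAt_snd_of_planeForm (hx (u, v) ⟨hu, hv⟩) hu)
      fun v hv => hD (u, v) ⟨hu, hv⟩
  -- it suffices to treat `u < u'` and, separately, `u = u'`
  have key : ∀ u ∈ Icc 0 ε, ∀ v ∈ Icc 0 ε, ∀ u' ∈ Icc 0 ε, ∀ v' ∈ Icc 0 ε, u < u' →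
      t (u, v) = t (u', v') → x (u, v) = x (u', v') → False := by
    intro u hu v hv u' hu' v' hv' huu h1 h2
    rcases le_total v v' with hvv | hvv
    · have e1 := t1 v hv hu hu' huu
      have e2 := (t2 u' hu').monotoneOn hv hv' hvv
      simp only at e1 e2
      linarith
    · have e1 := x1 v hv hu hu' huu
      have e2 := (x2 u' hu').monotoneOn hv' hv hvv
      simp only at e1 e2
      linarith
  rintro ⟨u, v⟩ ⟨hu, hv⟩ ⟨u', v'⟩ ⟨hu', hv'⟩ h
  simp only [Prod.mk.injEq] at h
  rcases lt_trichotomy u u' with huu | huu | huu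
  · exact (key u hu v hv u' hu' v' hv' huu h.1 h.2).elim
  · subst huu
    exact Prod.ext rfl ((t2 u hu).injOn hv hv' h.1)
  · exact (key u' hu' v' hv' u hu v hv huu h.1.symm h.2.symm).elim

/-! ### The triangle -/

section Triangle

variable {a ε : ℝ} (ha : 0 < a) (ha' : a < 1) (hε : 0 < ε)

include ha in
theorem triangle_subset_square (ha' : a < 1) : triangle a ε ⊆ Icc 0 ε ×ˢ Icc 0 ε := by
  rintro ⟨u, v⟩ ⟨h1, h2, h3, h4⟩
  simp only at h1 h2 h3 h4
  have : u ≤ u / a := by rw [le_div_iff₀ ha]; nlinarith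
  exact ⟨⟨h1, by linarith⟩, ⟨by simp only; linarith, by simp only; linarith⟩⟩

theorem convex_triangle : Convex ℝ (triangle a ε) := by
  have h1 : Convex ℝ {q : ℝ × ℝ | 0 ≤ q.1} :=
    convex_halfSpace_ge (f := fun q : ℝ × ℝ => q.1) ⟨fun _ _ => rfl, fun _ _ => rfl⟩ 0
  have h2 : Convex ℝ {q : ℝ × ℝ | q.1 - q.2 ≤ 0} :=
    convex_halfSpace_le (f := fun q : ℝ × ℝ => q.1 - q.2)
      ⟨fun _ _ => by simp; ring, fun _ _ => by simp; ring⟩ 0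
  have h3 : Convex ℝ {q : ℝ × ℝ | q.2 - q.1 / a ≤ 0} :=
    convex_halfSpace_le (f := fun q : ℝ × ℝ => q.2 - q.1 / a)
      ⟨fun _ _ => by simp; ring, fun _ _ => by simp; ring⟩ 0
  have h4 : Convex ℝ {q : ℝ × ℝ | q.1 / a ≤ ε} :=
    convex_halfSpace_le (f := fun q : ℝ × ℝ => q.1 / a)
      ⟨fun _ _ => by simp; ring, fun _ _ => by simp; ring⟩ ε
  convert h1.inter (h2.inter (h3.inter h4)) using 1
  ext q
  simp [triangle]

theorem isClosed_triangle : IsClosed (triangle a ε) :=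
  (isClosed_le (by fun_prop : Continuous fun _ : ℝ × ℝ => (0 : ℝ)) (by fun_prop)).inter
    ((isClosed_le (by fun_prop : Continuous fun q : ℝ × ℝ => q.1) (by fun_prop)).inter
      ((isClosed_le (by fun_prop : Continuous fun q : ℝ × ℝ => q.2) (by fun_prop)).inter
        (isClosed_le (by fun_prop : Continuous fun q : ℝ × ℝ => q.1 / a) (by fun_prop))))

include ha ha'

theorem isCompact_triangle : IsCompact (triangle a ε) :=
  (isCompact_Icc.prod isCompact_Icc).of_isClosed_subset isClosed_triangle
    (triangle_subset_square ha ha')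

include hε

theorem uniqueDiffOn_triangle : UniqueDiffOn ℝ (triangle a ε) := by
  refine uniqueDiffOn_convex convex_triangle
    ⟨(a * ε / 2, a * ε / 2 + (ε / 2 - a * ε / 2) / 2), mem_interior.2
    ⟨{q : ℝ × ℝ | 0 < q.1} ∩ ({q : ℝ × ℝ | q.1 < q.2} ∩ ({q : ℝ × ℝ | q.2 < q.1 / a} ∩
      {q : ℝ × ℝ | q.1 / a < ε})), ?_, ?_, ?_⟩⟩
  · exact fun q hq => ⟨hq.1.le, hq.2.1.le, hq.2.2.1.le, hq.2.2.2.le⟩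
  · exact (isOpen_lt (by fun_prop) (by fun_prop)).inter ((isOpen_lt (by fun_prop)
      (by fun_prop)).inter ((isOpen_lt (by fun_prop) (by fun_prop)).inter
        (isOpen_lt (by fun_prop) (by fun_prop))))
  · have e : a * ε / 2 / a = ε / 2 := by field_simp
    have h1 : 0 < a * ε := by positivity
    have h2 : a * ε < ε := by nlinarith
    refine ⟨?_, ?_, ?_, ?_⟩ <;> simp only [mem_ofPred_eq, e] <;> linarith

omit ha' hε in
theorem shock_mem_triangle (ha' : a < 1) {v : ℝ} (hv : v ∈ Icc 0 ε) :
    (a * v, v) ∈ triangle a ε := by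
  have e : a * v / a = v := by field_simp
  exact ⟨mul_nonneg ha.le hv.1, by simp only; nlinarith [hv.1], by simp only [e, le_refl],
    by simp only [e]; exact hv.2⟩

end Triangle

/-! ### The free boundary problem in characteristic coordinates -/

/-- The cone `0 ≤ t`, `m₁ t ≤ x ≤ m₂ t` in the `(t, x)`-plane. -/
def planeCone (m₁ m₂ : ℝ) : Set (ℝ × ℝ) := {z | 0 ≤ z.1 ∧ m₁ * z.1 ≤ z.2 ∧ z.2 ≤ m₂ * z.1}

/-- The quadruples `(β₊, α₊, t, x)` whose position lies in the cone. -/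
def stateCone (m₁ m₂ : ℝ) : Set (ℝ × ℝ × ℝ × ℝ) := univ ×ˢ univ ×ˢ planeCone m₁ m₂

theorem uniqueDiffOn_planeCone {m₁ m₂ : ℝ} (hm : m₁ < m₂) : UniqueDiffOn ℝ (planeCone m₁ m₂) := by
  have hconv : Convex ℝ (planeCone m₁ m₂) := by
    intro X hX Y hY s r hs hr _
    obtain ⟨h1, h2, h3⟩ := hX
    obtain ⟨g1, g2, g3⟩ := hY
    refine ⟨?_, ?_, ?_⟩ <;> simp only [Prod.fst_add, Prod.snd_add, Prod.smul_fst, Prod.smul_snd,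
      smul_eq_mul]
    · positivity
    · nlinarith [mul_le_mul_of_nonneg_left h2 hs, mul_le_mul_of_nonneg_left g2 hr]
    · nlinarith [mul_le_mul_of_nonneg_left h3 hs, mul_le_mul_of_nonneg_left g3 hr]
  refine uniqueDiffOn_convex hconv ⟨(1, (m₁ + m₂) / 2), mem_interior.2
    ⟨{z : ℝ × ℝ | 0 < z.1} ∩ ({z : ℝ × ℝ | m₁ * z.1 < z.2} ∩ {z : ℝ × ℝ | z.2 < m₂ * z.1}),
      fun z hz => ⟨hz.1.le, hz.2.1.le, hz.2.2.le⟩,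
      (isOpen_lt (by fun_prop) (by fun_prop)).inter ((isOpen_lt (by fun_prop) (by fun_prop)).inter
        (isOpen_lt (by fun_prop) (by fun_prop))), ?_⟩⟩
  refine ⟨?_, ?_, ?_⟩ <;> simp only [mem_ofPred_eq] <;> linarith

theorem uniqueDiffOn_stateCone {m₁ m₂ : ℝ} (hm : m₁ < m₂) : UniqueDiffOn ℝ (stateCone m₁ m₂) :=
  uniqueDiffOn_univ.prod (uniqueDiffOn_univ.prod (uniqueDiffOn_planeCone hm))

theorem fst_mem_stateCone {m₁ m₂ : ℝ} {X : ShockVar} (hX : X ∈ shockCone m₁ m₂) :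
    X.1 ∈ stateCone m₁ m₂ := ⟨mem_univ _, mem_univ _, hX⟩

/-- `dt₊/dv = (a + γ) p`, where `γ = (∂t/∂v) / (∂t/∂u)` on the shock. -/
def timeCoeff (a : ℝ) (γ : ℝ × ℝ × ℝ × ℝ → ℝ) (X : ShockVar) : ℝ := (a + γ X.1) * X.2.2

/-- `dx₊/dv = V dt₊/dv`. -/
def positionCoeff (a : ℝ) (γ V : ℝ × ℝ × ℝ × ℝ → ℝ) (X : ShockVar) : ℝ := V X.1 * timeCoeff a γ X

/-- The derivative `dβ₊/dv` obtained by differentiating `J = 0` along the shock. -/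
def invariantCoeff (a m₁ m₂ : ℝ) (J γ V : ℝ × ℝ × ℝ × ℝ → ℝ) (X : ShockVar) : ℝ :=
  -(fderivWithin ℝ J (stateCone m₁ m₂) X.1
      (0, a * X.2.1, timeCoeff a γ X, positionCoeff a γ V X)) /
    fderivWithin ℝ J (stateCone m₁ m₂) X.1 (1, 0, 0, 0)

/-- `∂²t/∂u∂v`, from the compatibility of the two characteristic equations; here `e` is the sound
speed as a function of half the sum of the Riemann invariants. -/
def mixedCoeff (e : ℝ → ℝ) (Z : BulkVar) : ℝ :=
  -(1 + deriv e ((Z.1 + Z.2.1) / 2)) / (4 * e ((Z.1 + Z.2.1) / 2)) *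
    (Z.2.2.2.1 * Z.2.2.2.2.1 + Z.2.2.1 * Z.2.2.2.2.2)

/-- Incoming characteristic speed for the sound speed law `e`. -/
def speedIn (e : ℝ → ℝ) (α β : ℝ) : ℝ := (α - β) / 2 - e ((α + β) / 2)

/-- Outgoing characteristic speed for the sound speed law `e`. -/
def speedOut (e : ℝ → ℝ) (α β : ℝ) : ℝ := (α - β) / 2 + e ((α + β) / 2)

theorem hasFDerivWithinAt_planeForm_mul {f g : ℝ × ℝ → ℝ} {A B C D : ℝ} {s : Set (ℝ × ℝ)}
    {z : ℝ × ℝ} (hf : HasFDerivWithinAt f (planeForm A B) s z)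
    (hg : HasFDerivWithinAt g (planeForm C D) s z) :
    HasFDerivWithinAt (fun y => f y * g y) (planeForm (A * g z + f z * C) (B * g z + f z * D)) s
      z := by
  refine (hf.fun_mul hg).congr_fderiv ?_
  ext <;> simp <;> ring

theorem clm_apply_split (L : ℝ × ℝ × ℝ × ℝ →L[ℝ] ℝ) (y₁ y₂ t x : ℝ) :
    L (y₁, y₂, t, x) = y₁ * L (1, 0, 0, 0) + y₂ * L (0, 1, 0, 0) + L (0, 0, t, x) := by
  have : (y₁, y₂, t, x) = y₁ • ((1, 0, 0, 0) : ℝ × ℝ × ℝ × ℝ) +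
      y₂ • ((0, 1, 0, 0) : ℝ × ℝ × ℝ × ℝ) + (0, 0, t, x) := by simp
  rw [this, map_add, map_add, map_smul, map_smul, smul_eq_mul, smul_eq_mul]

/-- The data of the free boundary problem at the reflection point: the jump function `J`, the ratio
`γ` of the derivatives of `t` on the shock, the shock speed `V`, all as functions of
`(β₊, α₊, t, x)`, and the sound speed law `e`. The condition `slope_eq` singles out the slope `k₀` of
`β` for which the jump condition holds to first order, and `γ_eq` is `dx = V dt` on the shock combined
with the characteristic equations. -/
structure ReflectionData (a b₀ k₀ p₀ V₀ m₁ m₂ : ℝ) (J γ V : ℝ × ℝ × ℝ × ℝ → ℝ) (e : ℝ → ℝ) :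
    Prop where
  a_pos : 0 < a
  a_lt : a < 1
  p_pos : 0 < p₀
  lt_V : m₁ < V₀
  V_lt : V₀ < m₂
  smooth_J : ContDiffWithinAt ℝ ∞ J (stateCone m₁ m₂) (b₀, b₀, 0, 0)
  smooth_γ : ContDiffWithinAt ℝ ∞ γ (stateCone m₁ m₂) (b₀, b₀, 0, 0)
  smooth_V : ContDiffWithinAt ℝ ∞ V (stateCone m₁ m₂) (b₀, b₀, 0, 0)
  smooth_e : ContDiffAt ℝ ∞ e b₀
  e_pos : 0 < e b₀
  J_zero : J (b₀, b₀, 0, 0) = 0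
  γ_zero : γ (b₀, b₀, 0, 0) = 1
  V_zero : V (b₀, b₀, 0, 0) = V₀
  deriv_ne : fderivWithin ℝ J (stateCone m₁ m₂) (b₀, b₀, 0, 0) (1, 0, 0, 0) ≠ 0
  deriv_eq : fderivWithin ℝ J (stateCone m₁ m₂) (b₀, b₀, 0, 0) (0, 1, 0, 0) =
    a ^ 2 * fderivWithin ℝ J (stateCone m₁ m₂) (b₀, b₀, 0, 0) (1, 0, 0, 0)
  slope_eq : -(fderivWithin ℝ J (stateCone m₁ m₂) (b₀, b₀, 0, 0)
      (0, 0, (1 + a) * p₀, V₀ * ((1 + a) * p₀))) /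
    fderivWithin ℝ J (stateCone m₁ m₂) (b₀, b₀, 0, 0) (1, 0, 0, 0) = (1 + a ^ 3) * k₀
  γ_eq : ∀ᶠ q in 𝓝[stateCone m₁ m₂] (b₀, b₀, 0, 0),
    a * speedIn e q.2.1 q.1 + γ q * speedOut e q.2.1 q.1 = V q * (a + γ q)

namespace ReflectionData

variable {a b₀ k₀ p₀ V₀ m₁ m₂ : ℝ} {J γ V : ℝ × ℝ × ℝ × ℝ → ℝ} {e : ℝ → ℝ}
  (h : ReflectionData a b₀ k₀ p₀ V₀ m₁ m₂ J γ V e)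

theorem tendsto_fst : Tendsto (fun X : ShockVar => X.1)
    (𝓝[shockCone m₁ m₂] ((b₀, b₀, 0, 0), k₀, p₀)) (𝓝[stateCone m₁ m₂] (b₀, b₀, 0, 0)) :=
  tendsto_nhdsWithin_iff.2 ⟨continuous_fst.continuousWithinAt,
    eventually_nhdsWithin_of_forall fun _ => fst_mem_stateCone⟩

theorem contDiffWithinAt_comp_fst {F : Type*} [NormedAddCommGroup F] [NormedSpace ℝ F]
    {f : ℝ × ℝ × ℝ × ℝ → F}
    (hf : ContDiffWithinAt ℝ ∞ f (stateCone m₁ m₂) (b₀, b₀, 0, 0)) :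
    ContDiffWithinAt ℝ ∞ (fun X : ShockVar => f X.1) (shockCone m₁ m₂) ((b₀, b₀, 0, 0), k₀, p₀) :=
  ContDiffWithinAt.comp (g := f) (f := Prod.fst) (t := stateCone m₁ m₂) _ hf
    contDiff_fst.contDiffWithinAt fun _ => fst_mem_stateCone

theorem zero_mem_stateCone : ((b₀, b₀, 0, 0) : ℝ × ℝ × ℝ × ℝ) ∈ stateCone m₁ m₂ := by
  simp [stateCone, planeCone]

include h

theorem contDiffWithinAt_timeCoeff : ContDiffWithinAt ℝ ∞ (timeCoeff a γ) (shockCone m₁ m₂)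
    ((b₀, b₀, 0, 0), k₀, p₀) :=
  (contDiffWithinAt_const.add (contDiffWithinAt_comp_fst h.smooth_γ)).mul
    (by fun_prop)

theorem contDiffWithinAt_positionCoeff : ContDiffWithinAt ℝ ∞ (positionCoeff a γ V)
    (shockCone m₁ m₂) ((b₀, b₀, 0, 0), k₀, p₀) :=
  (contDiffWithinAt_comp_fst h.smooth_V).mul h.contDiffWithinAt_timeCoeff

theorem contDiffWithinAt_fderivWithin : ContDiffWithinAt ℝ ∞
    (fun q => fderivWithin ℝ J (stateCone m₁ m₂) q) (stateCone m₁ m₂) (b₀, b₀, 0, 0) :=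
  h.smooth_J.fderivWithin_right (uniqueDiffOn_stateCone (h.lt_V.trans h.V_lt)) (by simp)
    zero_mem_stateCone

theorem contDiffWithinAt_invariantCoeff : ContDiffWithinAt ℝ ∞ (invariantCoeff a m₁ m₂ J γ V)
    (shockCone m₁ m₂) ((b₀, b₀, 0, 0), k₀, p₀) := by
  have h1 := contDiffWithinAt_comp_fst (k₀ := k₀) (p₀ := p₀) h.contDiffWithinAt_fderivWithin
  refine ContDiffWithinAt.div (ContDiffWithinAt.neg (h1.clm_apply ?_))
    (h1.clm_apply contDiffWithinAt_const) h.deriv_ne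
  exact contDiffWithinAt_const.prodMk ((by fun_prop : ContDiffWithinAt ℝ ∞ (fun X : ShockVar =>
    a * X.2.1) _ _).prodMk (h.contDiffWithinAt_timeCoeff.prodMk h.contDiffWithinAt_positionCoeff))

theorem contDiffAt_mixedCoeff :
    ContDiffAt ℝ ∞ (mixedCoeff e) (b₀, b₀, k₀, k₀, p₀, p₀) := by
  have hσ : ContDiffAt ℝ ∞ (fun Z : BulkVar => (Z.1 + Z.2.1) / 2) (b₀, b₀, k₀, k₀, p₀, p₀) := by
    fun_prop
  have hb : (b₀ + b₀) / 2 = b₀ := by ring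
  have he : ContDiffAt ℝ ∞ (fun Z : BulkVar => e ((Z.1 + Z.2.1) / 2))
      (b₀, b₀, k₀, k₀, p₀, p₀) :=
    ContDiffAt.comp (g := e) _ (by simpa only [hb] using h.smooth_e) hσ
  have he' : ContDiffAt ℝ ∞ (fun Z : BulkVar => deriv e ((Z.1 + Z.2.1) / 2))
      (b₀, b₀, k₀, k₀, p₀, p₀) :=
    ContDiffAt.comp (g := deriv e) _
      (by simpa only [hb] using h.smooth_e.derivWithin (by simp)) hσ
  refine ContDiffAt.mul (ContDiffAt.div (contDiffAt_const.add he').neg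
    (contDiffAt_const.mul he) ?_) (by fun_prop)
  simp only [hb]
  exact (mul_pos four_pos h.e_pos).ne'

theorem timeCoeff_zero : timeCoeff a γ ((b₀, b₀, 0, 0), k₀, p₀) = (1 + a) * p₀ := by
  simp only [timeCoeff, h.γ_zero]; ring

theorem positionCoeff_zero :
    positionCoeff a γ V ((b₀, b₀, 0, 0), k₀, p₀) = V₀ * ((1 + a) * p₀) := by
  simp only [positionCoeff, h.timeCoeff_zero, h.V_zero]

/-- The differentiated jump condition in terms of the unknown slope: its coefficient is `-a ^ 3`. -/
theorem invariantCoeff_line (k : ℝ) :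
    invariantCoeff a m₁ m₂ J γ V ((b₀, b₀, 0, 0), k, p₀) = -a ^ 3 * k + (1 + a ^ 3) * k₀ := by
  have h1 : timeCoeff a γ ((b₀, b₀, 0, 0), k, p₀) = (1 + a) * p₀ := by
    simp only [timeCoeff, h.γ_zero]; ring
  have h2 : positionCoeff a γ V ((b₀, b₀, 0, 0), k, p₀) = V₀ * ((1 + a) * p₀) := by
    simp only [positionCoeff, h1, h.V_zero]
  rw [← h.slope_eq]
  simp only [invariantCoeff, h1, h2]
  rw [clm_apply_split _ 0 (a * k), h.deriv_eq]
  field_simp [h.deriv_ne]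
  ring

end ReflectionData

/-- A `C²` solution of the free boundary problem on the square `[0, ε]²`, with `α(u, v) = b(u)`,
`β(u, v) = b(v)`, `∂t/∂u = p(u, v)` and `∂t/∂v = p(v, u)`. The shock is `u = a v`. -/
structure IsCharacteristicSolution (a b₀ k₀ p₀ : ℝ) (J V : ℝ × ℝ × ℝ × ℝ → ℝ) (e : ℝ → ℝ)
    (ε : ℝ) (b k : ℝ → ℝ) (t x p : ℝ × ℝ → ℝ) : Prop where
  hasDerivAt_b : ∀ v, HasDerivAt b (k v) v
  contDiff_b : ContDiff ℝ 2 b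
  b_zero : b 0 = b₀
  k_zero : k 0 = k₀
  t_zero : t (0, 0) = 0
  x_zero : x (0, 0) = 0
  p_zero : p (0, 0) = p₀
  contDiffOn_t : ContDiffOn ℝ 2 t (Icc 0 ε ×ˢ Icc 0 ε)
  contDiffOn_x : ContDiffOn ℝ 2 x (Icc 0 ε ×ˢ Icc 0 ε)
  hasFDerivWithinAt_t : ∀ z ∈ Icc 0 ε ×ˢ Icc 0 ε,
    HasFDerivWithinAt t (planeForm (p z) (p z.swap)) (Icc 0 ε ×ˢ Icc 0 ε) z
  hasFDerivWithinAt_x : ∀ z ∈ Icc 0 ε ×ˢ Icc 0 ε,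
    HasFDerivWithinAt x (planeForm (speedIn e (b z.1) (b z.2) * p z)
      (speedOut e (b z.1) (b z.2) * p z.swap)) (Icc 0 ε ×ˢ Icc 0 ε) z
  contDiffOn_tu : ContDiffOn ℝ 1 p (Icc 0 ε ×ˢ Icc 0 ε)
  contDiffOn_tv : ContDiffOn ℝ 1 (fun z => p z.swap) (Icc 0 ε ×ˢ Icc 0 ε)
  contDiffOn_xu : ContDiffOn ℝ 1 (fun z => speedIn e (b z.1) (b z.2) * p z)
    (Icc 0 ε ×ˢ Icc 0 ε)
  contDiffOn_xv : ContDiffOn ℝ 1 (fun z => speedOut e (b z.1) (b z.2) * p z.swap)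
    (Icc 0 ε ×ˢ Icc 0 ε)
  p_pos : ∀ z ∈ Icc 0 ε ×ˢ Icc 0 ε, 0 < p z
  speedIn_neg : ∀ z ∈ Icc 0 ε ×ˢ Icc 0 ε, speedIn e (b z.1) (b z.2) < 0
  speedOut_pos : ∀ z ∈ Icc 0 ε ×ˢ Icc 0 ε, 0 < speedOut e (b z.1) (b z.2)
  wall : ∀ u ∈ Icc 0 ε, x (u, u) = 0
  shock_speed : ∀ v ∈ Icc 0 ε, ∃ d,
    HasDerivWithinAt (fun s => t (a * s, s)) d (Icc 0 ε) v ∧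
    HasDerivWithinAt (fun s => x (a * s, s))
      (V (b v, b (a * v), t (a * v, v), x (a * v, v)) * d) (Icc 0 ε) v
  jump : ∀ v ∈ Icc 0 ε, J (b v, b (a * v), t (a * v, v), x (a * v, v)) = 0

theorem two_le_infty : (2 : WithTop ℕ∞) ≤ ∞ := 
  WithTop.coe_le_coe.2 (le_top : (2 : ℕ∞) ≤ ⊤)

theorem hasFDerivWithinAt_swap {ε : ℝ} {f : ℝ × ℝ → ℝ} {A B : ℝ} {z : ℝ × ℝ}
    (hf : HasFDerivWithinAt f (planeForm A B) (Icc 0 ε ×ˢ Icc 0 ε) z.swap) :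
    HasFDerivWithinAt (fun y => f y.swap) (planeForm B A) (Icc 0 ε ×ˢ Icc 0 ε) z := by
  have h1 : HasFDerivWithinAt (Prod.swap : ℝ × ℝ → ℝ × ℝ)
      ((ContinuousLinearMap.snd ℝ ℝ ℝ).prod (ContinuousLinearMap.fst ℝ ℝ ℝ))
      (Icc 0 ε ×ˢ Icc 0 ε) z :=
    (hasFDerivAt_snd.prodMk hasFDerivAt_fst).hasFDerivWithinAt
  have h2 := hf.comp z h1 fun y hy => ⟨hy.2, hy.1⟩
  refine h2.congr_fderiv ?_
  ext <;> simp

theorem contDiffOn_one_of_planeForm {f A B : ℝ × ℝ → ℝ} {s : Set (ℝ × ℝ)}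
    (hf : ∀ z ∈ s, HasFDerivWithinAt f (planeForm (A z) (B z)) s z)
    (hA : ContinuousOn A s) (hB : ContinuousOn B s) : ContDiffOn ℝ 1 f s := by
  have := contDiffOn_succ_of_hasFDerivWithinAt 0 hf
    (contDiffOn_planeForm (contDiffOn_zero.2 hA) (contDiffOn_zero.2 hB))
  simpa using this

/-- The derivative along the shock line. -/
theorem hasDerivWithinAt_shock_of_planeForm {a ε A B v : ℝ} {f : ℝ × ℝ → ℝ} (ha : 0 ≤ a)
    (ha' : a ≤ 1) (hf : HasFDerivWithinAt f (planeForm A B) (Icc 0 ε ×ˢ Icc 0 ε) (a * v, v)) :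
    HasDerivWithinAt (fun s => f (a * s, s)) (a * A + B) (Icc 0 ε) v := by
  have hg : HasDerivWithinAt (fun s : ℝ => (a * s, s)) (a, 1) (Icc 0 ε) v := by
    simpa using (((hasDerivAt_id v).const_mul a).prodMk (hasDerivAt_id v)).hasDerivWithinAt
  have := hf.comp_hasDerivWithinAt (f := fun s : ℝ => (a * s, s)) v hg fun s hs =>
    ⟨⟨mul_nonneg ha hs.1, by simp only; nlinarith [hs.1, hs.2]⟩, hs⟩
  simpa [Function.comp_def, mul_comm] using this

section Speeds

variable {e b k : ℝ → ℝ} (hb : ∀ v, HasDerivAt b (k v) v)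
include hb

theorem hasFDerivWithinAt_half_add (s : Set (ℝ × ℝ)) (z : ℝ × ℝ) :
    HasFDerivWithinAt (fun y : ℝ × ℝ => (b y.1 + b y.2) / 2) (planeForm (k z.1 / 2) (k z.2 / 2))
      s z := by
  have h1 := (hb z.1).comp_hasFDerivAt z (hasFDerivAt_fst (𝕜 := ℝ) (E := ℝ) (F := ℝ) (p := z))
  have h2 := (hb z.2).comp_hasFDerivAt z (hasFDerivAt_snd (𝕜 := ℝ) (E := ℝ) (F := ℝ) (p := z))
  refine (((h1.add h2).mul_const (2⁻¹ : ℝ)).hasFDerivWithinAt (s := s)).congr_fderiv ?_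
  ext <;> simp <;> ring

theorem hasFDerivWithinAt_half_sub (s : Set (ℝ × ℝ)) (z : ℝ × ℝ) :
    HasFDerivWithinAt (fun y : ℝ × ℝ => (b y.1 - b y.2) / 2)
      (planeForm (k z.1 / 2) (-(k z.2) / 2)) s z := by
  have h1 := (hb z.1).comp_hasFDerivAt z (hasFDerivAt_fst (𝕜 := ℝ) (E := ℝ) (F := ℝ) (p := z))
  have h2 := (hb z.2).comp_hasFDerivAt z (hasFDerivAt_snd (𝕜 := ℝ) (E := ℝ) (F := ℝ) (p := z))
  refine (((h1.sub h2).mul_const (2⁻¹ : ℝ)).hasFDerivWithinAt (s := s)).congr_fderiv ?_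
  ext <;> simp <;> ring

variable {s : Set (ℝ × ℝ)} {z : ℝ × ℝ} (he : DifferentiableAt ℝ e ((b z.1 + b z.2) / 2))
include he

theorem hasFDerivWithinAt_sound :
    HasFDerivWithinAt (fun y : ℝ × ℝ => e ((b y.1 + b y.2) / 2))
      (planeForm (deriv e ((b z.1 + b z.2) / 2) * (k z.1 / 2))
        (deriv e ((b z.1 + b z.2) / 2) * (k z.2 / 2))) s z := by
  refine (HasDerivAt.comp_hasFDerivWithinAt z he.hasDerivAt
    (hasFDerivWithinAt_half_add hb s z)).congr_fderiv ?_
  ext <;> simp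

theorem hasFDerivWithinAt_speedIn :
    HasFDerivWithinAt (fun y : ℝ × ℝ => speedIn e (b y.1) (b y.2))
      (planeForm (k z.1 / 2 * (1 - deriv e ((b z.1 + b z.2) / 2)))
        (-(k z.2) / 2 * (1 + deriv e ((b z.1 + b z.2) / 2)))) s z := by
  refine ((hasFDerivWithinAt_half_sub hb s z).sub (hasFDerivWithinAt_sound hb he)).congr_fderiv ?_
  ext <;> simp <;> ring

theorem hasFDerivWithinAt_speedOut :
    HasFDerivWithinAt (fun y : ℝ × ℝ => speedOut e (b y.1) (b y.2))
      (planeForm (k z.1 / 2 * (1 + deriv e ((b z.1 + b z.2) / 2)))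
        (-(k z.2) / 2 * (1 - deriv e ((b z.1 + b z.2) / 2)))) s z := by
  refine ((hasFDerivWithinAt_half_sub hb s z).add (hasFDerivWithinAt_sound hb he)).congr_fderiv ?_
  ext <;> simp <;> ring

end Speeds

theorem contDiff_two_of_hasDerivAt {b k κ : ℝ → ℝ} (hb : ∀ v, HasDerivAt b (k v) v)
    (hk : ∀ v, HasDerivAt k (κ v) v) (hκ : Continuous κ) : ContDiff ℝ 2 b := by
  have hk1 : ContDiff ℝ 1 k := contDiff_one_iff_deriv.2
    ⟨fun v => (hk v).differentiableAt, by rwa [funext fun v => (hk v).deriv]⟩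
  have : ContDiff ℝ (1 + 1) b := contDiff_succ_iff_deriv.2
    ⟨fun v => (hb v).differentiableAt, by simp, by rwa [funext fun v => (hb v).deriv]⟩
  simpa [one_add_one_eq_two] using this

namespace ReflectionData

variable {a b₀ k₀ p₀ V₀ m₁ m₂ : ℝ} {J γ V : ℝ × ℝ × ℝ × ℝ → ℝ} {e : ℝ → ℝ}
  (h : ReflectionData a b₀ k₀ p₀ V₀ m₁ m₂ J γ V e)

include h

/-- The system attached to the free boundary problem is solvable: its top order coefficients at the
base point are `-a ^ 3` and `1`. -/
theorem exists_system {U : Set (ℝ × ℝ × ℝ × ℝ)} (hU : U ∈ 𝓝[stateCone m₁ m₂] (b₀, b₀, 0, 0))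
    {U' : Set BulkVar} (hU' : U' ∈ 𝓝 (b₀, b₀, k₀, k₀, p₀, p₀)) :
    ∃ ε₀ : ℝ, 0 < ε₀ ∧ ∀ ε, 0 < ε → ε ≤ ε₀ →
      ∃ (b k κ t x : ℝ → ℝ) (p P W : ℝ → ℝ → ℝ),
        IsSystemSolution a b₀ k₀ p₀ (invariantCoeff a m₁ m₂ J γ V) (fun X => γ X.1 * X.2.2)
          (timeCoeff a γ) (positionCoeff a γ V) (mixedCoeff e) ε b k κ t x p P W ∧
        (∀ v ∈ Icc 0 ε, (b v, b (a * v), t v, x v) ∈ U ∩ stateCone m₁ m₂) ∧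
        ∀ u ∈ Icc 0 ε, ∀ v ∈ Icc 0 ε, (b u, b v, k u, k v, p u v, p v u) ∈ U' := by
  have hm := h.lt_V.trans h.V_lt
  have hap : 0 < (1 + a) * p₀ := mul_pos (by linarith [h.a_pos]) h.p_pos
  have hG : ContDiffWithinAt ℝ ∞ (fun X : ShockVar => γ X.1 * X.2.2) (shockCone m₁ m₂)
      ((b₀, b₀, 0, 0), k₀, p₀) := (contDiffWithinAt_comp_fst h.smooth_γ).mul (by fun_prop)
  have ha3 : a ^ 3 ≤ 1 := pow_le_one₀ h.a_pos.le h.a_lt.le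
  have hmem (X : ShockVar) : X.1 = (b₀, b₀, 0, 0) → X ∈ shockCone m₁ m₂ := by
    intro hX; simp [shockCone, hX]
  obtain ⟨ε₀, hε₀, hsol⟩ := exists_isSystemSolution h.a_pos h.a_lt hm
    (Ψ := invariantCoeff a m₁ m₂ J γ V) (G := fun X => γ X.1 * X.2.2) (τ := timeCoeff a γ)
    (χ := positionCoeff a γ V) (w := mixedCoeff e)
    (h.contDiffWithinAt_invariantCoeff.of_le two_le_infty)
    (hG.of_le two_le_infty)
    (h.contDiffWithinAt_timeCoeff.of_le two_le_infty)
    (h.contDiffWithinAt_positionCoeff.of_le two_le_infty)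
    (h.contDiffAt_mixedCoeff.of_le two_le_infty)
    (by
      rw [fderivWithin_apply_of_line (d := -a ^ 3)
        (h.contDiffWithinAt_invariantCoeff.differentiableWithinAt (by simp))
        (fun r => hmem _ (by simp))]
      · rw [abs_neg, abs_of_pos (pow_pos h.a_pos 3)]; exact ha3
      · have : (fun r : ℝ => invariantCoeff a m₁ m₂ J γ V
            ((((b₀, b₀, 0, 0), k₀, p₀) : ShockVar) + r • ((0, 1, 0) : ShockVar))) =
            fun r => -a ^ 3 * (k₀ + r) + (1 + a ^ 3) * k₀ := by
          funext r
          rw [← h.invariantCoeff_line]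
          simp
        rw [this]
        simpa using (((hasDerivAt_id (0 : ℝ)).const_add k₀).const_mul (-a ^ 3)).add_const
          ((1 + a ^ 3) * k₀))
    (by
      rw [fderivWithin_apply_of_line (d := 1) (hG.differentiableWithinAt (by simp))
        (fun r => hmem _ (by simp))]
      · simp
      · have : (fun r : ℝ => γ ((((b₀, b₀, 0, 0), k₀, p₀) : ShockVar) +
            r • ((0, 0, 1) : ShockVar)).1 * ((((b₀, b₀, 0, 0), k₀, p₀) : ShockVar) +
            r • ((0, 0, 1) : ShockVar)).2.2) = fun r => p₀ + r := by
          funext r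
          simp [h.γ_zero]
        rw [this]
        exact (hasDerivAt_id (0 : ℝ)).const_add p₀)
    (fun q k k' p => rfl) (by rw [h.timeCoeff_zero]; exact hap)
    (by rw [h.timeCoeff_zero, h.positionCoeff_zero]; exact mul_lt_mul_of_pos_right h.lt_V hap)
    (by rw [h.timeCoeff_zero, h.positionCoeff_zero]; exact mul_lt_mul_of_pos_right h.V_lt hap)
    (by rw [h.invariantCoeff_line]; ring) (by simp [h.γ_zero])
    (tendsto_fst (k₀ := k₀) (p₀ := p₀) hU) hU'
  refine ⟨ε₀, hε₀, fun ε hε hle => ?_⟩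
  obtain ⟨b, k, κ, t, x, p, P, W, hs, hX, hZ⟩ := hsol ε hε hle
  exact ⟨b, k, κ, t, x, p, P, W, hs,
    fun v hv => ⟨(hX v hv).1, fst_mem_stateCone (hX v hv).2⟩, hZ⟩

/-- Conditions on the shock variables that hold near the reflection point: `J` is differentiable, it can
be solved for `β₊`, and `γ` has its meaning. -/
theorem eventually_shock : ∀ᶠ q in 𝓝[stateCone m₁ m₂] (b₀, b₀, 0, 0),
    DifferentiableWithinAt ℝ J (stateCone m₁ m₂) q ∧
    fderivWithin ℝ J (stateCone m₁ m₂) q (1, 0, 0, 0) ≠ 0 ∧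
    a * speedIn e q.2.1 q.1 + γ q * speedOut e q.2.1 q.1 = V q * (a + γ q) := by
  have h1 : ∀ᶠ q in 𝓝[stateCone m₁ m₂] (b₀, b₀, 0, 0),
      ContDiffWithinAt ℝ 2 J (stateCone m₁ m₂) q := by
    have := (h.smooth_J.of_le two_le_infty).eventually (by simp)
    rwa [insert_eq_of_mem zero_mem_stateCone] at this
  have h2 : ContinuousWithinAt (fun q => fderivWithin ℝ J (stateCone m₁ m₂) q (1, 0, 0, 0))
      (stateCone m₁ m₂) (b₀, b₀, 0, 0) :=
    h.contDiffWithinAt_fderivWithin.continuousWithinAt.clm_apply continuousWithinAt_const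
  filter_upwards [h1, h2.eventually_ne h.deriv_ne, h.γ_eq] with q g1 g2 g3
  exact ⟨g1.differentiableWithinAt (by norm_num), g2, g3⟩

/-- Conditions on the bulk variables that hold near the reflection point, where the velocity vanishes
and so the characteristic speeds have opposite signs. -/
theorem eventually_bulk : ∀ᶠ Z : BulkVar in 𝓝 (b₀, b₀, k₀, k₀, p₀, p₀),
    ContDiffAt ℝ 2 e ((Z.1 + Z.2.1) / 2) ∧ 0 < e ((Z.1 + Z.2.1) / 2) ∧
    speedIn e Z.1 Z.2.1 < 0 ∧ 0 < speedOut e Z.1 Z.2.1 ∧ 0 < Z.2.2.2.2.1 := by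
  have hσ : ContinuousAt (fun Z : BulkVar => (Z.1 + Z.2.1) / 2) (b₀, b₀, k₀, k₀, p₀, p₀) := by
    fun_prop
  have hδ : ContinuousAt (fun Z : BulkVar => (Z.1 - Z.2.1) / 2) (b₀, b₀, k₀, k₀, p₀, p₀) := by
    fun_prop
  have hp : ContinuousAt (fun Z : BulkVar => Z.2.2.2.2.1) (b₀, b₀, k₀, k₀, p₀, p₀) := by
    fun_prop
  have hb : (b₀ + b₀) / 2 = b₀ := by ring
  have hσ' : Tendsto (fun Z : BulkVar => (Z.1 + Z.2.1) / 2) (𝓝 (b₀, b₀, k₀, k₀, p₀, p₀)) (𝓝 b₀) := by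
    simpa only [ContinuousAt, hb] using hσ
  have he : ContinuousAt (fun Z : BulkVar => e ((Z.1 + Z.2.1) / 2)) (b₀, b₀, k₀, k₀, p₀, p₀) := by
    have := h.smooth_e.continuousAt.tendsto.comp hσ'
    simpa only [ContinuousAt, hb, Function.comp_def] using this
  have h1 := hσ'.eventually ((h.smooth_e.of_le two_le_infty).eventually (by simp))
  filter_upwards [h1, he.eventually_const_lt (by simpa only [hb] using h.e_pos),
    (hδ.fun_sub he).eventually_lt_const (u := 0) (by simpa only [hb, sub_self, zero_div, zero_sub,
      Left.neg_neg_iff] using h.e_pos),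
    (hδ.fun_add he).eventually_const_lt (u := 0) (by simpa only [hb, sub_self, zero_div, zero_add]
      using h.e_pos), hp.eventually_const_lt h.p_pos] with Z g1 g2 g3 g4 g5
  exact ⟨g1, g2, g3, g4, g5⟩

omit h in
/-- The symmetry of `w` is the symmetry of the second derivatives of `t`. -/
theorem mixedCoeff_symm (b₁ b₂ k₁ k₂ p₁ p₂ : ℝ) :
    mixedCoeff e (b₁, b₂, k₁, k₂, p₁, p₂) = mixedCoeff e (b₂, b₁, k₂, k₁, p₂, p₁) := by
  simp only [mixedCoeff, add_comm b₁ b₂, add_comm (k₂ * p₁)]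

/-- Along the solution of the system the jump function has derivative zero, by the choice of the
coefficient `Ψ`, and it vanishes at the reflection point. -/
theorem jump_eq_zero {ε : ℝ} {b k κ t x : ℝ → ℝ} {p P W : ℝ → ℝ → ℝ}
    (hs : IsSystemSolution a b₀ k₀ p₀ (invariantCoeff a m₁ m₂ J γ V) (fun X => γ X.1 * X.2.2)
      (timeCoeff a γ) (positionCoeff a γ V) (mixedCoeff e) ε b k κ t x p P W)
    (hX : ∀ v ∈ Icc 0 ε, (b v, b (a * v), t v, x v) ∈ {q |
      DifferentiableWithinAt ℝ J (stateCone m₁ m₂) q ∧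
      fderivWithin ℝ J (stateCone m₁ m₂) q (1, 0, 0, 0) ≠ 0} ∩ stateCone m₁ m₂) :
    ∀ v ∈ Icc 0 ε, J (b v, b (a * v), t v, x v) = 0 := by
  refine eq_of_hasDerivWithinAt_Icc (g := fun _ => 0) (f' := fun _ => 0) ?_
    (fun s _ => hasDerivWithinAt_const _ _ _)
    (by simp only [mul_zero, hs.b_zero, hs.t_zero, hs.x_zero]; exact h.J_zero)
  intro v hv
  have hba : HasDerivAt (fun s => b (a * s)) (a * k (a * v)) v := by
    have := (hs.hasDerivAt_b (a * v)).comp v ((hasDerivAt_id v).const_mul a)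
    simpa [Function.comp_def, mul_comm] using this
  have hq := (hs.hasDerivAt_b v).prodMk (hba.prodMk
    ((hs.hasDerivAt_t v hv).prodMk (hs.hasDerivAt_x v hv)))
  have := (hX v hv).1.1.hasFDerivWithinAt.comp_hasDerivWithinAt
    (f := fun s => (b s, b (a * s), t s, x s)) v (hq.hasDerivWithinAt (s := Icc 0 ε))
    fun s hs => (hX s hs).2
  refine this.congr_deriv ?_
  have hk := hs.k_eq v hv
  rw [invariantCoeff, eq_div_iff (hX v hv).1.2] at hk
  rw [clm_apply_split _ 0 (a * k (a * v))] at hk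
  rw [clm_apply_split _ (k v)]
  linarith

/-- The free boundary problem is solvable: the primitives of the two closed forms built from a
solution of the system are the sought functions `t` and `x`. -/
theorem exists_characteristicSolution {U : Set (ℝ × ℝ × ℝ × ℝ)}
    (hU : U ∈ 𝓝[stateCone m₁ m₂] (b₀, b₀, 0, 0)) {S : Set ℝ} (hS : S ∈ 𝓝 b₀) :
    ∃ ε₀ : ℝ, 0 < ε₀ ∧ ∀ ε, 0 < ε → ε ≤ ε₀ →
      ∃ (b k : ℝ → ℝ) (t x p : ℝ × ℝ → ℝ),
        IsCharacteristicSolution a b₀ k₀ p₀ J V e ε b k t x p ∧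
        (∀ v ∈ Icc 0 ε, (b v, b (a * v), t (a * v, v), x (a * v, v)) ∈ U) ∧
        ∀ u ∈ Icc 0 ε, ∀ v ∈ Icc 0 ε, (b u + b v) / 2 ∈ S := by
  have hS' : ∀ᶠ Z : BulkVar in 𝓝 (b₀, b₀, k₀, k₀, p₀, p₀), (Z.1 + Z.2.1) / 2 ∈ S := by
    have hσ : ContinuousAt (fun Z : BulkVar => (Z.1 + Z.2.1) / 2) (b₀, b₀, k₀, k₀, p₀, p₀) := by
      fun_prop
    exact hσ (by simpa only [add_self_div_two] using hS)
  obtain ⟨ε₀, hε₀, hsol⟩ := h.exists_system (inter_mem hU h.eventually_shock)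
    (h.eventually_bulk.and hS')
  refine ⟨ε₀, hε₀, fun ε hε hle => ?_⟩
  obtain ⟨b, k, κ, ts, xs, p, P, W, hs, hX, hZ⟩ := hsol ε hε hle
  set Q := Icc (0 : ℝ) ε ×ˢ Icc (0 : ℝ) ε with hQ
  have hQc : Convex ℝ Q := (convex_Icc 0 ε).prod (convex_Icc 0 ε)
  have h0 : (0 : ℝ) ∈ Icc 0 ε := ⟨le_rfl, hε.le⟩
  have ha := h.a_pos
  have hav : ∀ v ∈ Icc 0 ε, a * v ∈ Icc 0 ε := fun v hv =>
    ⟨mul_nonneg ha.le hv.1, by nlinarith [hv.1, hv.2, h.a_lt]⟩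
  have hswap : ∀ z ∈ Q, z.swap ∈ Q := fun z hz => ⟨hz.2, hz.1⟩
  have hWs : ∀ z ∈ Q, W z.2 z.1 = W z.1 z.2 := fun z hz => by
    rw [hs.W_eq _ hz.2 _ hz.1, hs.W_eq _ hz.1 _ hz.2, mixedCoeff_symm]
  have hk : Continuous k := continuous_iff_continuousAt.2 fun v => (hs.hasDerivAt_k v).continuousAt
  have hb2 := contDiff_two_of_hasDerivAt hs.hasDerivAt_b hs.hasDerivAt_k hs.cont_κ
  -- the derivatives of `t`
  have hM : ∀ z ∈ Q, HasFDerivWithinAt (fun y : ℝ × ℝ => p y.1 y.2)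
      (planeForm (P z.1 z.2) (W z.1 z.2)) Q z := hs.hasFDerivWithinAt_p
  have hN : ∀ z ∈ Q, HasFDerivWithinAt (fun y : ℝ × ℝ => p y.2 y.1)
      (planeForm (W z.1 z.2) (P z.2 z.1)) Q z := fun z hz => by
    have := hasFDerivWithinAt_swap (f := fun y : ℝ × ℝ => p y.1 y.2) (z := z) (hM _ (hswap z hz))
    simpa only [Prod.fst_swap, Prod.snd_swap, hWs z hz] using this
  have cP' : Continuous fun y : ℝ × ℝ => P y.2 y.1 := hs.cont_P.comp continuous_swap
  have hM1 : ContDiffOn ℝ 1 (fun y : ℝ × ℝ => p y.1 y.2) Q :=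
    contDiffOn_one_of_planeForm hM hs.cont_P.continuousOn hs.cont_W.continuousOn
  have hN1 : ContDiffOn ℝ 1 (fun y : ℝ × ℝ => p y.2 y.1) Q :=
    contDiffOn_one_of_planeForm hN hs.cont_W.continuousOn cP'.continuousOn
  obtain ⟨t, ht0, ht2, ht⟩ := exists_primitive_of_closed hQc hM hN hM1 hN1 (0, 0)
  -- the derivatives of `x`
  have he : ∀ z ∈ Q, ContDiffAt ℝ 2 e ((b z.1 + b z.2) / 2) := fun z hz =>
    (hZ z.1 hz.1 z.2 hz.2).1.1
  have hed : ∀ z ∈ Q, DifferentiableAt ℝ e ((b z.1 + b z.2) / 2) := fun z hz =>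
    (he z hz).differentiableAt (by norm_num)
  have hσ2 : ContDiff ℝ 2 fun y : ℝ × ℝ => (b y.1 + b y.2) / 2 := by fun_prop
  have hδ2 : ContDiff ℝ 2 fun y : ℝ × ℝ => (b y.1 - b y.2) / 2 := by fun_prop
  have heσ : ContDiffOn ℝ 1 (fun y : ℝ × ℝ => e ((b y.1 + b y.2) / 2)) Q := fun z hz =>
    ((he z hz).comp_contDiffWithinAt z hσ2.contDiffWithinAt).of_le (by norm_num)
  have hin1 : ContDiffOn ℝ 1 (fun y : ℝ × ℝ => speedIn e (b y.1) (b y.2)) Q :=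
    (hδ2.of_le (by norm_num)).contDiffOn.sub heσ
  have hout1 : ContDiffOn ℝ 1 (fun y : ℝ × ℝ => speedOut e (b y.1) (b y.2)) Q :=
    (hδ2.of_le (by norm_num)).contDiffOn.add heσ
  have hXM : ∀ z ∈ Q, HasFDerivWithinAt
      (fun y : ℝ × ℝ => speedIn e (b y.1) (b y.2) * p y.1 y.2) _ Q z := fun z hz =>
    hasFDerivWithinAt_planeForm_mul (hasFDerivWithinAt_speedIn hs.hasDerivAt_b (hed z hz)) (hM z hz)
  have hXN : ∀ z ∈ Q, HasFDerivWithinAt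
      (fun y : ℝ × ℝ => speedOut e (b y.1) (b y.2) * p y.2 y.1) (planeForm
        (k z.1 / 2 * (1 + deriv e ((b z.1 + b z.2) / 2)) * p z.2 z.1 +
          speedOut e (b z.1) (b z.2) * W z.1 z.2) _) Q z := fun z hz =>
    hasFDerivWithinAt_planeForm_mul (hasFDerivWithinAt_speedOut hs.hasDerivAt_b (hed z hz))
      (hN z hz)
  -- compatibility of the characteristic equations
  have hcompat : ∀ z ∈ Q, k z.1 / 2 * (1 + deriv e ((b z.1 + b z.2) / 2)) * p z.2 z.1 +
        speedOut e (b z.1) (b z.2) * W z.1 z.2 =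
      -k z.2 / 2 * (1 + deriv e ((b z.1 + b z.2) / 2)) * p z.1 z.2 +
        speedIn e (b z.1) (b z.2) * W z.1 z.2 := by
    intro z hz
    have hW := hs.W_eq z.1 hz.1 z.2 hz.2
    have hepos : 0 < e ((b z.1 + b z.2) / 2) := (hZ z.1 hz.1 z.2 hz.2).1.2.1
    simp only [mixedCoeff] at hW
    rw [div_mul_eq_mul_div, eq_div_iff (by positivity)] at hW
    simp only [speedOut, speedIn]
    linear_combination hW / 2
  obtain ⟨x, hx0, hx2, hx⟩ := exists_primitive_of_closed hQc hXM
    (fun z hz => by rw [← hcompat z hz]; exact hXN z hz) (hin1.mul hM1) (hout1.mul hN1) (0, 0)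
  -- the shock
  have htd : ∀ v ∈ Icc 0 ε, HasDerivWithinAt (fun s => t (a * s, s))
      (timeCoeff a γ ((b v, b (a * v), ts v, xs v), k (a * v), p (a * v) v)) (Icc 0 ε) v := by
    intro v hv
    refine (hasDerivWithinAt_shock_of_planeForm ha.le h.a_lt.le
      (ht (a * v, v) ⟨hav v hv, hv⟩)).congr_deriv ?_
    simp only [timeCoeff, hs.p_eq v hv]; ring
  have hxd : ∀ v ∈ Icc 0 ε, HasDerivWithinAt (fun s => x (a * s, s))
      (positionCoeff a γ V ((b v, b (a * v), ts v, xs v), k (a * v), p (a * v) v))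
      (Icc 0 ε) v := by
    intro v hv
    refine (hasDerivWithinAt_shock_of_planeForm ha.le h.a_lt.le
      (hx (a * v, v) ⟨hav v hv, hv⟩)).congr_deriv ?_
    have hγ := (hX v hv).1.2.2.2
    simp only at hγ
    simp only [positionCoeff, timeCoeff, hs.p_eq v hv]
    linear_combination p (a * v) v * hγ
  have hts := eq_of_hasDerivWithinAt_Icc htd (fun v hv => (hs.hasDerivAt_t v hv).hasDerivWithinAt)
    (by rw [mul_zero, ht0, hs.t_zero])
  have hxs := eq_of_hasDerivWithinAt_Icc hxd (fun v hv => (hs.hasDerivAt_x v hv).hasDerivWithinAt)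
    (by rw [mul_zero, hx0, hs.x_zero])
  have hjump := h.jump_eq_zero hs fun v hv => ⟨⟨(hX v hv).1.2.1, (hX v hv).1.2.2.1⟩, (hX v hv).2⟩
  refine ⟨b, k, t, x, fun z => p z.1 z.2, ?_, fun v hv => ?_, fun u hu v hv => (hZ u hu v hv).2⟩
  · refine ⟨hs.hasDerivAt_b, hb2, hs.b_zero, hs.k_zero, ht0, hx0, hs.p_zero, ht2, hx2, ht, hx, hM1,
      hN1, hin1.mul hM1, hout1.mul hN1, fun z hz => (hZ z.1 hz.1 z.2 hz.2).1.2.2.2.2,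
      fun z hz => (hZ z.1 hz.1 z.2 hz.2).1.2.2.1, fun z hz => (hZ z.1 hz.1 z.2 hz.2).1.2.2.2.1,
      ?_, fun v hv => ⟨_, htd v hv, ?_⟩, fun v hv => ?_⟩
    · refine eq_of_hasDerivWithinAt_Icc (g := fun _ => 0) (f' := fun _ => 0) (fun u hu => ?_)
        (fun s _ => hasDerivWithinAt_const _ _ _) hx0
      have h1 := hasDerivWithinAt_shock_of_planeForm (a := 1) (v := u) zero_le_one le_rfl
        (f := x) (hx (1 * u, u) ⟨by rwa [one_mul], hu⟩)
      simp only [one_mul] at h1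
      refine h1.congr_deriv ?_
      simp only [speedIn, speedOut]
      ring
    · have e1 : t (a * v, v) = ts v := hts v hv
      have e2 : x (a * v, v) = xs v := hxs v hv
      rw [e1, e2]
      exact hxd v hv
    · have e1 : t (a * v, v) = ts v := hts v hv
      have e2 : x (a * v, v) = xs v := hxs v hv
      rw [e1, e2]
      exact hjump v hv
  · have e1 : t (a * v, v) = ts v := hts v hv
    have e2 : x (a * v, v) = xs v := hxs v hv
    rw [e1, e2]
    exact (hX v hv).1.1

end ReflectionData

/-! ### The state ahead near the reflection point -/

section Ahead

variable {p ρd wd : ℝ → ℝ} {r T : ℝ} {ξ : ℝ → ℝ} {ρs ws : ℝ × ℝ → ℝ}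
  (hdev : IsFutureDevelopment p ρd wd T ξ ρs ws)

include hdev

theorem zero_mem_devRegion : ((0, 0) : ℝ × ℝ) ∈ devRegion T ξ :=
  ⟨le_rfl, hdev.time_pos.le, hdev.char_zero.le⟩

/-- A cone to the right of the outgoing characteristic lies in the development, near its vertex. -/
theorem devRegion_mem_nhdsWithin {m₁ m₂ : ℝ} (hm : ws (0, 0) + soundSpeed p (ρs (0, 0)) < m₁) :
    devRegion T ξ ∈ 𝓝[planeCone m₁ m₂] (0, 0) := by
  have hξ := hdev.char_outgoing 0 ⟨le_rfl, hdev.time_pos.le⟩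
  rw [hdev.char_zero] at hξ
  have h1 : ∀ᶠ s in 𝓝[Icc 0 T \ {0}] 0, _root_.slope ξ 0 s < m₁ := hξ.limsup_slope_le hm
  have h2 : ∀ᶠ s in 𝓝[Icc 0 T] 0, ξ s ≤ m₁ * s := by
    rw [eventually_nhdsWithin_iff] at h1 ⊢
    filter_upwards [h1] with s hs hsI
    rcases eq_or_lt_of_le hsI.1 with h0 | h0
    · rw [← h0, hdev.char_zero, mul_zero]
    · have := hs ⟨hsI, h0.ne'⟩
      rw [slope_def_field, hdev.char_zero, sub_zero, sub_zero, div_lt_iff₀ h0] at this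
      exact this.le
  have ht : Tendsto (fun z : ℝ × ℝ => z.1) (𝓝[planeCone m₁ m₂] (0, 0)) (𝓝[Icc 0 T] 0) := by
    refine tendsto_nhdsWithin_iff.2 ⟨continuous_fst.continuousWithinAt, ?_⟩
    have : ∀ᶠ z : ℝ × ℝ in 𝓝[planeCone m₁ m₂] (0, 0), z.1 < T :=
      (continuous_fst.continuousWithinAt (x := ((0, 0) : ℝ × ℝ))).eventually_lt_const hdev.time_pos
    filter_upwards [this, self_mem_nhdsWithin] with z hz hzc
    exact ⟨hzc.1, hz.le⟩
  filter_upwards [ht.eventually h2, ht.eventually self_mem_nhdsWithin, self_mem_nhdsWithin]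
    with z h1 h2 h3
  exact ⟨h2.1, h2.2, h1.trans h3.2.1⟩

variable (hp : ContDiffOn ℝ ∞ p (Ioi 0)) (hp' : ∀ ρ : ℝ, 0 < ρ → 0 < deriv p ρ) (hr : 0 < r)

include hp hp' hr

theorem contDiffWithinAt_alphaStar :
    ContDiffWithinAt ℝ ∞ (alphaStar p r ρs ws) (devRegion T ξ) (0, 0) := by
  have h0 := zero_mem_devRegion hdev
  exact (((contDiffOn_potential hp hp' hr).contDiffAt
    (Ioi_mem_nhds (hdev.density_pos _ h0))).comp_contDiffWithinAt _
      (hdev.smooth_density _ h0)).add (hdev.smooth_velocity _ h0)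

theorem contDiffWithinAt_betaStar :
    ContDiffWithinAt ℝ ∞ (betaStar p r ρs ws) (devRegion T ξ) (0, 0) := by
  have h0 := zero_mem_devRegion hdev
  exact (((contDiffOn_potential hp hp' hr).contDiffAt
    (Ioi_mem_nhds (hdev.density_pos _ h0))).comp_contDiffWithinAt _
      (hdev.smooth_density _ h0)).sub (hdev.smooth_velocity _ h0)

end Ahead

theorem half_alphaStar_add_betaStar (p : ℝ → ℝ) (r : ℝ) (ρs ws : ℝ × ℝ → ℝ) (z : ℝ × ℝ) :
    (alphaStar p r ρs ws z + betaStar p r ρs ws z) / 2 = potential p r (ρs z) := by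
  simp only [alphaStar, betaStar]; ring

theorem velocity_star (p : ℝ → ℝ) (r : ℝ) (ρs ws : ℝ × ℝ → ℝ) (z : ℝ × ℝ) :
    velocity (alphaStar p r ρs ws z) (betaStar p r ρs ws z) = ws z := by
  simp only [velocity, alphaStar, betaStar]; ring

theorem fderiv_apply_eq_sum {F : ℝ × ℝ × ℝ × ℝ → ℝ} {y₁ y₂ y₃ y₄ : ℝ}
    (hF : DifferentiableAt ℝ F (y₁, y₂, y₃, y₄)) (z₁ z₂ z₃ z₄ : ℝ) :
    fderiv ℝ F (y₁, y₂, y₃, y₄) (z₁, z₂, z₃, z₄) =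
      z₁ * deriv (fun s => F (s, y₂, y₃, y₄)) y₁ + z₂ * deriv (fun s => F (y₁, s, y₃, y₄)) y₂ +
      z₃ * deriv (fun s => F (y₁, y₂, s, y₄)) y₃ + z₄ * deriv (fun s => F (y₁, y₂, y₃, s)) y₄ := by
  have c (s y : ℝ) := hasDerivAt_const (𝕜 := ℝ) s y
  have e₁ : deriv (fun s => F (s, y₂, y₃, y₄)) y₁ = fderiv ℝ F (y₁, y₂, y₃, y₄) (1, 0, 0, 0) :=
    (HasFDerivAt.comp_hasDerivAt (f := fun s : ℝ => (s, y₂, y₃, y₄)) y₁ hF.hasFDerivAt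
      ((hasDerivAt_id y₁).prodMk ((c _ y₂).prodMk ((c _ y₃).prodMk (c _ y₄))))).deriv
  have e₂ : deriv (fun s => F (y₁, s, y₃, y₄)) y₂ = fderiv ℝ F (y₁, y₂, y₃, y₄) (0, 1, 0, 0) :=
    (HasFDerivAt.comp_hasDerivAt (f := fun s : ℝ => (y₁, s, y₃, y₄)) y₂ hF.hasFDerivAt
      ((c _ y₁).prodMk ((hasDerivAt_id y₂).prodMk ((c _ y₃).prodMk (c _ y₄))))).deriv
  have e₃ : deriv (fun s => F (y₁, y₂, s, y₄)) y₃ = fderiv ℝ F (y₁, y₂, y₃, y₄) (0, 0, 1, 0) :=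
    (HasFDerivAt.comp_hasDerivAt (f := fun s : ℝ => (y₁, y₂, s, y₄)) y₃ hF.hasFDerivAt
      ((c _ y₁).prodMk ((c _ y₂).prodMk ((hasDerivAt_id y₃).prodMk (c _ y₄))))).deriv
  have e₄ : deriv (fun s => F (y₁, y₂, y₃, s)) y₄ = fderiv ℝ F (y₁, y₂, y₃, y₄) (0, 0, 0, 1) :=
    (HasFDerivAt.comp_hasDerivAt (f := fun s : ℝ => (y₁, y₂, y₃, s)) y₄ hF.hasFDerivAt
      ((c _ y₁).prodMk ((c _ y₂).prodMk ((c _ y₃).prodMk (hasDerivAt_id y₄))))).deriv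
  have : (z₁, z₂, z₃, z₄) = z₁ • ((1, 0, 0, 0) : ℝ × ℝ × ℝ × ℝ) +
      z₂ • ((0, 1, 0, 0) : ℝ × ℝ × ℝ × ℝ) + z₃ • ((0, 0, 1, 0) : ℝ × ℝ × ℝ × ℝ) +
      z₄ • ((0, 0, 0, 1) : ℝ × ℝ × ℝ × ℝ) := by simp
  rw [this, e₁, e₂, e₃, e₄]
  simp only [map_add, map_smul, smul_eq_mul]

/-- The Riemann invariants `(α₊, β₊, α₋, β₋)` on both sides of the shock, as functions of
`(β₊, α₊, t, x)`. -/
def shockStates (p : ℝ → ℝ) (r : ℝ) (ρs ws : ℝ × ℝ → ℝ) (q : ℝ × ℝ × ℝ × ℝ) : ℝ × ℝ × ℝ × ℝ :=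
  (q.2.1, q.1, alphaStar p r ρs ws q.2.2, betaStar p r ρs ws q.2.2)

/-- `J` as a function of `(β₊, α₊, t, x)`. -/
def jumpAt (p : ℝ → ℝ) (r : ℝ) (ρs ws : ℝ × ℝ → ℝ) (q : ℝ × ℝ × ℝ × ℝ) : ℝ :=
  jumpJ p r q.2.1 q.1 (alphaStar p r ρs ws q.2.2) (betaStar p r ρs ws q.2.2)

/-- `V` as a function of `(β₊, α₊, t, x)`. -/
def speedAt (p : ℝ → ℝ) (r : ℝ) (ρs ws : ℝ × ℝ → ℝ) (q : ℝ × ℝ × ℝ × ℝ) : ℝ :=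
  shockSpeed p r q.2.1 q.1 (alphaStar p r ρs ws q.2.2) (betaStar p r ρs ws q.2.2)

/-- The ratio `(∂t/∂v) / (∂t/∂u)` on the shock `u = a v`, forced by the characteristic equations
together with `dx₊ = V dt₊`. -/
def ratioAt (p : ℝ → ℝ) (r : ℝ) (ρs ws : ℝ × ℝ → ℝ) (a : ℝ) (q : ℝ × ℝ × ℝ × ℝ) : ℝ :=
  a * (speedAt p r ρs ws q - speedIn (speedOf p r) q.2.1 q.1) /
    (speedOut (speedOf p r) q.2.1 q.1 - speedAt p r ρs ws q)

/-! ### The reflection point -/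

section Point

variable {p : ℝ → ℝ} {r ρ₀ V₀ ρm wm : ℝ} (hrefl : IsReflectionPoint p ρm wm ρ₀ V₀)

include hrefl

/-- The density jumps: otherwise mass conservation would give `w₋ = 0`. -/
theorem density_ne (hρm : 0 < ρm) : ρ₀ ≠ ρm := by
  intro h
  have h1 := hrefl.mass_jump
  rw [h, sub_self, zero_mul, mul_zero, zero_sub] at h1
  exact mul_ne_zero hρm.ne' hrefl.incompatible (by linarith)

variable (hp : ContDiffOn ℝ ∞ p (Ioi 0)) (hp' : ∀ ρ : ℝ, 0 < ρ → 0 < deriv p ρ) (hr : 0 < r)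

include hp'

theorem slope_pos : 0 < slope p ρ₀ V₀ :=
  div_pos (by linarith [hrefl.subsonic_behind])
    (by linarith [soundSpeed_pos hp' hrefl.density_pos, hrefl.speed_pos])

theorem slope_lt_one : slope p ρ₀ V₀ < 1 := by
  have := soundSpeed_pos hp' hrefl.density_pos
  rw [slope, div_lt_one (by linarith [hrefl.speed_pos])]
  linarith [hrefl.speed_pos]

theorem slope_mul : slope p ρ₀ V₀ * (soundSpeed p ρ₀ + V₀) = soundSpeed p ρ₀ - V₀ :=
  div_mul_cancel₀ _ (by linarith [soundSpeed_pos hp' hrefl.density_pos, hrefl.speed_pos])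

include hp hr

variable {αm βm : ℝ} (hαβ : (αm + βm) / 2 = potential p r ρm) (hw : velocity αm βm = wm)
  (hρm : 0 < ρm)

include hαβ hw hρm

theorem jumpJ_reflection :
    jumpJ p r (beta₀ p r ρ₀) (beta₀ p r ρ₀) αm βm = 0 := by
  have h1 : density p r αm βm = ρm := by rw [density_eq, hαβ, densityOf_potential hp hp' hr hρm]
  have h2 : density p r (beta₀ p r ρ₀) (beta₀ p r ρ₀) = ρ₀ := by
    rw [density_eq, add_self_div_two, beta₀, densityOf_potential hp hp' hr hrefl.density_pos]
  have h3 : velocity (beta₀ p r ρ₀) (beta₀ p r ρ₀) = 0 := by simp [velocity]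
  rw [jumpJ, h1, h2, h3, hw, jumpI]
  linear_combination (-(ρ₀ * 0 - ρm * wm)) * hrefl.mass_jump + (ρ₀ - ρm) * hrefl.momentum_jump

theorem shockSpeed_reflection :
    shockSpeed p r (beta₀ p r ρ₀) (beta₀ p r ρ₀) αm βm = V₀ := by
  have h1 : density p r αm βm = ρm := by rw [density_eq, hαβ, densityOf_potential hp hp' hr hρm]
  have h2 : density p r (beta₀ p r ρ₀) (beta₀ p r ρ₀) = ρ₀ := by
    rw [density_eq, add_self_div_two, beta₀, densityOf_potential hp hp' hr hrefl.density_pos]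
  have h3 : velocity (beta₀ p r ρ₀) (beta₀ p r ρ₀) = 0 := by simp [velocity]
  rw [shockSpeed, h1, h2, h3, hw, div_eq_iff (sub_ne_zero.2 (density_ne hrefl hρm))]
  linear_combination -hrefl.mass_jump

/-- The derivative of `J` in `α₊` at the reflection point. -/
theorem hasDerivAt_jumpJ_fst : HasDerivAt (fun z => jumpJ p r z (beta₀ p r ρ₀) αm βm)
    (-((ρ₀ - ρm) * ρ₀ / (2 * soundSpeed p ρ₀)) * (soundSpeed p ρ₀ - V₀) ^ 2) (beta₀ p r ρ₀) := by
  have h1 : density p r αm βm = ρm := by rw [density_eq, hαβ, densityOf_potential hp hp' hr hρm]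
  have hη := soundSpeed_pos hp' hrefl.density_pos
  have hσ : HasDerivAt (fun z : ℝ => (z + beta₀ p r ρ₀) / 2) (1 / 2) (beta₀ p r ρ₀) :=
    ((hasDerivAt_id _).add_const _).div_const 2
  have hd : HasDerivAt (fun z => density p r z (beta₀ p r ρ₀)) (ρ₀ / soundSpeed p ρ₀ * (1 / 2))
      (beta₀ p r ρ₀) := by
    refine HasDerivAt.comp (h₂ := densityOf p r) _ ?_ hσ
    rw [add_self_div_two]
    exact hasDerivAt_densityOf hp hp' hr hrefl.density_pos
  have hv : HasDerivAt (fun z => velocity z (beta₀ p r ρ₀)) (1 / 2) (beta₀ p r ρ₀) :=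
    ((hasDerivAt_id _).sub_const _).div_const 2
  have := hasDerivAt_jumpI hd hv (hasDerivAt_pressure hp hrefl.density_pos)
    (by rw [density_eq, add_self_div_two, beta₀, densityOf_potential hp hp' hr hrefl.density_pos])
    (by simp [velocity]) hrefl.mass_jump hrefl.momentum_jump
  simp only [jumpJ, h1, hw]
  refine this.congr_deriv ?_
  rw [← soundSpeed_sq hp' hrefl.density_pos]
  field_simp
  ring

/-- The derivative of `J` in `β₊` at the reflection point. -/
theorem hasDerivAt_jumpJ_snd : HasDerivAt (fun z => jumpJ p r (beta₀ p r ρ₀) z αm βm)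
    (-((ρ₀ - ρm) * ρ₀ / (2 * soundSpeed p ρ₀)) * (soundSpeed p ρ₀ + V₀) ^ 2) (beta₀ p r ρ₀) := by
  have h1 : density p r αm βm = ρm := by rw [density_eq, hαβ, densityOf_potential hp hp' hr hρm]
  have hη := soundSpeed_pos hp' hrefl.density_pos
  have hσ : HasDerivAt (fun z : ℝ => (beta₀ p r ρ₀ + z) / 2) (1 / 2) (beta₀ p r ρ₀) :=
    ((hasDerivAt_id _).const_add _).div_const 2
  have hd : HasDerivAt (fun z => density p r (beta₀ p r ρ₀) z) (ρ₀ / soundSpeed p ρ₀ * (1 / 2))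
      (beta₀ p r ρ₀) := by
    refine HasDerivAt.comp (h₂ := densityOf p r) _ ?_ hσ
    rw [add_self_div_two]
    exact hasDerivAt_densityOf hp hp' hr hrefl.density_pos
  have hv : HasDerivAt (fun z => velocity (beta₀ p r ρ₀) z) (-1 / 2) (beta₀ p r ρ₀) :=
    ((hasDerivAt_id _).const_sub _).div_const 2
  have := hasDerivAt_jumpI hd hv (hasDerivAt_pressure hp hrefl.density_pos)
    (by rw [density_eq, add_self_div_two, beta₀, densityOf_potential hp hp' hr hrefl.density_pos])
    (by simp [velocity]) hrefl.mass_jump hrefl.momentum_jump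
  simp only [jumpJ, h1, hw]
  refine this.congr_deriv ?_
  rw [← soundSpeed_sq hp' hrefl.density_pos]
  field_simp
  ring

end Point

/-! ### The reflection problem for a gas -/

section Instance

variable {p ρd wd : ℝ → ℝ} {r T ρ₀ V₀ m₁ m₂ : ℝ} {ξ : ℝ → ℝ} {ρs ws : ℝ × ℝ → ℝ}
  (hp : ContDiffOn ℝ ∞ p (Ioi 0)) (hp' : ∀ ρ : ℝ, 0 < ρ → 0 < deriv p ρ) (hr : 0 < r)
  (hdev : IsFutureDevelopment p ρd wd T ξ ρs ws)

include hp hp' hr hdev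

/-- The state ahead is smooth at the reflection point within the cone, where it is defined near the
vertex. -/
theorem contDiffWithinAt_shockStates (hm : ws (0, 0) + soundSpeed p (ρs (0, 0)) < m₁) (b₀ : ℝ) :
    ContDiffWithinAt ℝ ∞ (shockStates p r ρs ws) (stateCone m₁ m₂) (b₀, b₀, 0, 0) := by
  have hD := devRegion_mem_nhdsWithin hdev (m₂ := m₂) hm
  have hs : ContDiffWithinAt ℝ ∞ (fun q : ℝ × ℝ × ℝ × ℝ => q.2.2) (stateCone m₁ m₂)
    (b₀, b₀, 0, 0) := by fun_prop
  have hmaps : MapsTo (fun q : ℝ × ℝ × ℝ × ℝ => q.2.2) (stateCone m₁ m₂) (planeCone m₁ m₂) :=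
    fun q hq => hq.2.2
  have hα := ContDiffWithinAt.comp ((b₀, b₀, 0, 0) : ℝ × ℝ × ℝ × ℝ)
    ((contDiffWithinAt_alphaStar hdev hp hp' hr).mono_of_mem_nhdsWithin hD) hs hmaps
  have hβ := ContDiffWithinAt.comp ((b₀, b₀, 0, 0) : ℝ × ℝ × ℝ × ℝ)
    ((contDiffWithinAt_betaStar hdev hp hp' hr).mono_of_mem_nhdsWithin hD) hs hmaps
  have h1 : ContDiffWithinAt ℝ ∞ (fun q : ℝ × ℝ × ℝ × ℝ => q.2.1) (stateCone m₁ m₂)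
    (b₀, b₀, 0, 0) := by fun_prop
  have h2 : ContDiffWithinAt ℝ ∞ (fun q : ℝ × ℝ × ℝ × ℝ => q.1) (stateCone m₁ m₂)
    (b₀, b₀, 0, 0) := by fun_prop
  exact h1.prodMk (h2.prodMk (hα.prodMk hβ))

/-- The derivative of `J` along the shock, in terms of the partial derivatives of `J` and of those
of the Riemann invariants of the state ahead. -/
theorem fderivWithin_jumpAt (hm : ws (0, 0) + soundSpeed p (ρs (0, 0)) < m₁) (hm' : m₁ < m₂)
    {b₀ : ℝ} (hJ : DifferentiableAt ℝ
      (fun y : ℝ × ℝ × ℝ × ℝ => jumpJ p r y.1 y.2.1 y.2.2.1 y.2.2.2)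
      (b₀, b₀, alphaStar p r ρs ws (0, 0), betaStar p r ρs ws (0, 0))) (z₁ z₂ t x : ℝ) :
    fderivWithin ℝ (jumpAt p r ρs ws) (stateCone m₁ m₂) (b₀, b₀, 0, 0) (z₁, z₂, t, x) =
      z₂ * deriv (fun s => jumpJ p r s b₀ (alphaStar p r ρs ws (0, 0))
        (betaStar p r ρs ws (0, 0))) b₀ +
      z₁ * deriv (fun s => jumpJ p r b₀ s (alphaStar p r ρs ws (0, 0))
        (betaStar p r ρs ws (0, 0))) b₀ +
      (t * partialFst (alphaStar p r ρs ws) (devRegion T ξ) (0, 0) +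
        x * partialSnd (alphaStar p r ρs ws) (devRegion T ξ) (0, 0)) *
        deriv (fun s => jumpJ p r b₀ b₀ s (betaStar p r ρs ws (0, 0))) (alphaStar p r ρs ws (0, 0)) +
      (t * partialFst (betaStar p r ρs ws) (devRegion T ξ) (0, 0) +
        x * partialSnd (betaStar p r ρs ws) (devRegion T ξ) (0, 0)) *
        deriv (fun s => jumpJ p r b₀ b₀ (alphaStar p r ρs ws (0, 0)) s)
          (betaStar p r ρs ws (0, 0)) := by
  have hD := devRegion_mem_nhdsWithin hdev (m₂ := m₂) hm
  have hα := (((contDiffWithinAt_alphaStar hdev hp hp' hr).differentiableWithinAt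
    (by simp)).hasFDerivWithinAt).mono_of_mem_nhdsWithin hD
  have hβ := (((contDiffWithinAt_betaStar hdev hp hp' hr).differentiableWithinAt
    (by simp)).hasFDerivWithinAt).mono_of_mem_nhdsWithin hD
  set Lα := fderivWithin ℝ (alphaStar p r ρs ws) (devRegion T ξ) (0, 0) with hLα
  set Lβ := fderivWithin ℝ (betaStar p r ρs ws) (devRegion T ξ) (0, 0) with hLβ
  have hmaps : MapsTo (fun q : ℝ × ℝ × ℝ × ℝ => q.2.2) (stateCone m₁ m₂) (planeCone m₁ m₂) :=
    fun q hq => hq.2.2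
  have s2 : HasFDerivWithinAt (fun q : ℝ × ℝ × ℝ × ℝ => q.2) (ContinuousLinearMap.snd ℝ ℝ _)
      (stateCone m₁ m₂) (b₀, b₀, 0, 0) := hasFDerivWithinAt_snd
  have s22 : HasFDerivWithinAt (fun q : ℝ × ℝ × ℝ × ℝ => q.2.2)
      ((ContinuousLinearMap.snd ℝ ℝ _).comp (ContinuousLinearMap.snd ℝ ℝ _))
      (stateCone m₁ m₂) (b₀, b₀, 0, 0) := s2.snd
  have hY : HasFDerivWithinAt (shockStates p r ρs ws) _ (stateCone m₁ m₂) (b₀, b₀, 0, 0) :=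
    s2.fst.prodMk (hasFDerivWithinAt_fst.prodMk
      ((HasFDerivWithinAt.comp (g := alphaStar p r ρs ws) ((b₀, b₀, 0, 0) : ℝ × ℝ × ℝ × ℝ) hα s22
        hmaps).prodMk
        (HasFDerivWithinAt.comp (g := betaStar p r ρs ws) ((b₀, b₀, 0, 0) : ℝ × ℝ × ℝ × ℝ) hβ s22
          hmaps)))
  have hcomp := HasFDerivAt.comp_hasFDerivWithinAt
    (g := fun y : ℝ × ℝ × ℝ × ℝ => jumpJ p r y.1 y.2.1 y.2.2.1 y.2.2.2)
    ((b₀, b₀, 0, 0) : ℝ × ℝ × ℝ × ℝ) hJ.hasFDerivAt hY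
  have huniq := uniqueDiffOn_stateCone hm' (b₀, b₀, 0, 0) ReflectionData.zero_mem_stateCone
  have hfd : fderivWithin ℝ (jumpAt p r ρs ws) (stateCone m₁ m₂) (b₀, b₀, 0, 0) = _ :=
    hcomp.fderivWithin huniq
  have hsplit (L : ℝ × ℝ →L[ℝ] ℝ) : L (t, x) = t * L (1, 0) + x * L (0, 1) := by
    have : (t, x) = t • ((1, 0) : ℝ × ℝ) + x • ((0, 1) : ℝ × ℝ) := by simp
    rw [this, map_add, map_smul, map_smul, smul_eq_mul, smul_eq_mul]
  rw [hfd]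
  refine Eq.trans ?_ ((fderiv_apply_eq_sum hJ z₂ z₁ (Lα (t, x)) (Lβ (t, x))).trans ?_)
  · simp
  · rw [hsplit Lα, hsplit Lβ]
    rfl

variable (hrefl : IsReflectionPoint p (ρs (0, 0)) (ws (0, 0)) ρ₀ V₀)

include hrefl

/-- The reflection problem for a gas is a free boundary problem of the type solved above. -/
theorem reflectionData (hm : ws (0, 0) + soundSpeed p (ρs (0, 0)) < m₁) (hm₁ : m₁ < V₀)
    (hm₂ : V₀ < m₂) :
    ReflectionData (slope p ρ₀ V₀) (beta₀ p r ρ₀) (beta₀' p r T ξ ρs ws ρ₀ V₀)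
      (1 / soundSpeed p ρ₀) V₀ m₁ m₂ (jumpAt p r ρs ws)
      (ratioAt p r ρs ws (slope p ρ₀ V₀)) (speedAt p r ρs ws) (speedOf p r) := by
  have hρ₀ := hrefl.density_pos
  have hρm := hdev.density_pos _ (zero_mem_devRegion hdev)
  have hne := density_ne hrefl hρm
  have hη := soundSpeed_pos hp' hρ₀
  have hV := hrefl.speed_pos
  have ha := slope_pos hrefl hp'
  have hamul := slope_mul hrefl hp'
  have hαβ := half_alphaStar_add_betaStar p r ρs ws (0, 0)
  have hw := velocity_star p r ρs ws (0, 0)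
  have hb : (beta₀ p r ρ₀ + beta₀ p r ρ₀) / 2 = potential p r ρ₀ := add_self_div_two _
  have hY := contDiffWithinAt_shockStates hp hp' hr hdev (m₂ := m₂) hm (beta₀ p r ρ₀)
  have hJ := contDiffAt_jumpJ hp hp' hr hρ₀ hρm hb hαβ
  have hS := contDiffAt_shockSpeed hp hp' hr hρ₀ hρm hne hb hαβ
  have hsJ : ContDiffWithinAt ℝ ∞ (jumpAt p r ρs ws) (stateCone m₁ m₂)
      (beta₀ p r ρ₀, beta₀ p r ρ₀, 0, 0) :=
    ContDiffAt.comp_contDiffWithinAt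
      (g := fun y : ℝ × ℝ × ℝ × ℝ => jumpJ p r y.1 y.2.1 y.2.2.1 y.2.2.2)
      (f := shockStates p r ρs ws) (beta₀ p r ρ₀, beta₀ p r ρ₀, 0, 0) hJ hY
  have hsV : ContDiffWithinAt ℝ ∞ (speedAt p r ρs ws) (stateCone m₁ m₂)
      (beta₀ p r ρ₀, beta₀ p r ρ₀, 0, 0) :=
    ContDiffAt.comp_contDiffWithinAt
      (g := fun y : ℝ × ℝ × ℝ × ℝ => shockSpeed p r y.1 y.2.1 y.2.2.1 y.2.2.2)
      (f := shockStates p r ρs ws) (beta₀ p r ρ₀, beta₀ p r ρ₀, 0, 0) hS hY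
  have he : ContDiffAt ℝ ∞ (speedOf p r) (beta₀ p r ρ₀) := contDiffAt_speedOf hp hp' hr hρ₀
  have he0 : speedOf p r (beta₀ p r ρ₀) = soundSpeed p ρ₀ := speedOf_potential hp hp' hr hρ₀
  have hV0 : speedAt p r ρs ws (beta₀ p r ρ₀, beta₀ p r ρ₀, 0, 0) = V₀ :=
    shockSpeed_reflection hrefl hp hp' hr hαβ hw hρm
  have hse : ContDiffWithinAt ℝ ∞ (fun q : ℝ × ℝ × ℝ × ℝ => speedOf p r ((q.2.1 + q.1) / 2))
      (stateCone m₁ m₂) (beta₀ p r ρ₀, beta₀ p r ρ₀, 0, 0) :=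
    ContDiffAt.comp_contDiffWithinAt (g := speedOf p r)
      (f := fun q : ℝ × ℝ × ℝ × ℝ => (q.2.1 + q.1) / 2) (beta₀ p r ρ₀, beta₀ p r ρ₀, 0, 0)
      (by simpa only [add_self_div_two] using he) (by fun_prop)
  have hin : ContDiffWithinAt ℝ ∞ (fun q : ℝ × ℝ × ℝ × ℝ => speedIn (speedOf p r) q.2.1 q.1)
      (stateCone m₁ m₂) (beta₀ p r ρ₀, beta₀ p r ρ₀, 0, 0) :=
    ContDiffWithinAt.sub (f := fun q : ℝ × ℝ × ℝ × ℝ => (q.2.1 - q.1) / 2) (by fun_prop) hse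
  have hout : ContDiffWithinAt ℝ ∞ (fun q : ℝ × ℝ × ℝ × ℝ => speedOut (speedOf p r) q.2.1 q.1)
      (stateCone m₁ m₂) (beta₀ p r ρ₀, beta₀ p r ρ₀, 0, 0) :=
    ContDiffWithinAt.add (f := fun q : ℝ × ℝ × ℝ × ℝ => (q.2.1 - q.1) / 2) (by fun_prop) hse
  have hout0 : speedOut (speedOf p r) (beta₀ p r ρ₀) (beta₀ p r ρ₀) = soundSpeed p ρ₀ := by
    simp only [speedOut, sub_self, zero_div, zero_add, add_self_div_two, he0]
  have hin0 : speedIn (speedOf p r) (beta₀ p r ρ₀) (beta₀ p r ρ₀) = -soundSpeed p ρ₀ := by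
    simp only [speedIn, sub_self, zero_div, zero_sub, add_self_div_two, he0]
  have hsub : soundSpeed p ρ₀ - V₀ ≠ 0 := by linarith [hrefl.subsonic_behind]
  have hden0 : speedOut (speedOf p r) (beta₀ p r ρ₀) (beta₀ p r ρ₀) -
      speedAt p r ρs ws (beta₀ p r ρ₀, beta₀ p r ρ₀, 0, 0) ≠ 0 := by rwa [hout0, hV0]
  have hαp := (hasDerivAt_jumpJ_fst hrefl hp hp' hr hαβ hw hρm).deriv
  have hβp := (hasDerivAt_jumpJ_snd hrefl hp hp' hr hαβ hw hρm).deriv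
  have hc : (ρ₀ - ρs (0, 0)) * ρ₀ / (2 * soundSpeed p ρ₀) ≠ 0 :=
    div_ne_zero (mul_ne_zero (sub_ne_zero.2 hne) hρ₀.ne') (by positivity)
  have hβne : deriv (fun s => jumpJ p r (beta₀ p r ρ₀) s (alphaStar p r ρs ws (0, 0))
      (betaStar p r ρs ws (0, 0))) (beta₀ p r ρ₀) ≠ 0 := by
    rw [hβp]
    exact mul_ne_zero (neg_ne_zero.2 hc) (by positivity)
  have hD := fderivWithin_jumpAt hp hp' hr hdev hm (hm₁.trans hm₂)
    (hJ.differentiableAt (by simp))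
  refine ⟨ha, slope_lt_one hrefl hp', by positivity, hm₁, hm₂, hsJ, ?_, hsV, he, ?_,
    jumpJ_reflection hrefl hp hp' hr hαβ hw hρm, ?_, hV0, ?_, ?_, ?_, ?_⟩
  · exact (contDiffWithinAt_const.mul (hsV.sub hin)).div (hout.sub hsV) hden0
  · rw [he0]; exact hη
  · simp only [ratioAt, hV0, hin0, hout0]
    rw [div_eq_one_iff_eq hsub, ← hamul]
    ring
  · rw [hD]
    simpa using hβne
  · rw [hD, hD]
    simp only [zero_mul, one_mul, zero_add, add_zero]
    rw [hαp, hβp, ← hamul]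
    ring
  · have hχ : V₀ * ((1 + slope p ρ₀ V₀) * (1 / soundSpeed p ρ₀)) = 1 - slope p ρ₀ V₀ := by
      field_simp
      linear_combination hamul
    have h3 : (1 + slope p ρ₀ V₀ ^ 3) ≠ 0 := by positivity
    rw [hD, hD, hχ]
    simp only [beta₀', zero_mul, one_mul, zero_add, add_zero]
    field_simp
    ring
  · have := (hout.continuousWithinAt.sub hsV.continuousWithinAt).eventually_ne hden0
    filter_upwards [this] with q hq
    replace hq : speedOut (speedOf p r) q.2.1 q.1 - speedAt p r ρs ws q ≠ 0 := hq
    simp only [ratioAt]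
    field_simp
    ring

/-- Near the reflection point the position stays in the development, the density jumps, and the
determinism condition holds. -/
theorem eventually_determinism (hm : ws (0, 0) + soundSpeed p (ρs (0, 0)) < m₁) :
    ∀ᶠ q in 𝓝[stateCone m₁ m₂] ((beta₀ p r ρ₀, beta₀ p r ρ₀, 0, 0) : ℝ × ℝ × ℝ × ℝ),
      q.2.2 ∈ devRegion T ξ ∧
      density p r q.2.1 q.1 ≠
        density p r (alphaStar p r ρs ws q.2.2) (betaStar p r ρs ws q.2.2) ∧
      cOut p r (alphaStar p r ρs ws q.2.2) (betaStar p r ρs ws q.2.2) < speedAt p r ρs ws q ∧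
      speedAt p r ρs ws q < cOut p r q.2.1 q.1 := by
  have hρ₀ := hrefl.density_pos
  have hρm := hdev.density_pos _ (zero_mem_devRegion hdev)
  have hne := density_ne hrefl hρm
  have hαβ := half_alphaStar_add_betaStar p r ρs ws (0, 0)
  have hw := velocity_star p r ρs ws (0, 0)
  have hb : (beta₀ p r ρ₀ + beta₀ p r ρ₀) / 2 = potential p r ρ₀ := add_self_div_two _
  have hS := (contDiffAt_shockSpeed hp hp' hr hρ₀ hρm hne hb hαβ).continuousAt
  set y₀ : ℝ × ℝ × ℝ × ℝ := (beta₀ p r ρ₀, beta₀ p r ρ₀, alphaStar p r ρs ws (0, 0),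
    betaStar p r ρs ws (0, 0)) with hy₀
  have hY : Tendsto (shockStates p r ρs ws) (𝓝[stateCone m₁ m₂] (beta₀ p r ρ₀, beta₀ p r ρ₀, 0, 0))
      (𝓝 y₀) :=
    (contDiffWithinAt_shockStates hp hp' hr hdev (m₂ := m₂) hm (beta₀ p r ρ₀)).continuousWithinAt
  have hD : ∀ᶠ q in 𝓝[stateCone m₁ m₂] ((beta₀ p r ρ₀, beta₀ p r ρ₀, 0, 0) : ℝ × ℝ × ℝ × ℝ),
      q.2.2 ∈ devRegion T ξ := by
    have : Tendsto (fun q : ℝ × ℝ × ℝ × ℝ => q.2.2)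
        (𝓝[stateCone m₁ m₂] (beta₀ p r ρ₀, beta₀ p r ρ₀, 0, 0)) (𝓝[planeCone m₁ m₂] (0, 0)) :=
      tendsto_nhdsWithin_iff.2 ⟨(continuous_snd.comp continuous_snd).continuousWithinAt,
        eventually_nhdsWithin_of_forall fun q hq => hq.2.2⟩
    exact this (devRegion_mem_nhdsWithin hdev hm)
  have d₁ : ContinuousAt (fun y : ℝ × ℝ × ℝ × ℝ => density p r y.1 y.2.1) y₀ :=
    ContinuousAt.comp (g := densityOf p r) (f := fun y : ℝ × ℝ × ℝ × ℝ => (y.1 + y.2.1) / 2)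
      (by simpa only [hy₀, hb] using (contDiffAt_densityOf hp hp' hr hρ₀).continuousAt) (by fun_prop)
  have d₂ : ContinuousAt (fun y : ℝ × ℝ × ℝ × ℝ => density p r y.2.2.1 y.2.2.2) y₀ :=
    ContinuousAt.comp (g := densityOf p r) (f := fun y : ℝ × ℝ × ℝ × ℝ => (y.2.2.1 + y.2.2.2) / 2)
      (by simpa only [hy₀, hαβ] using (contDiffAt_densityOf hp hp' hr hρm).continuousAt)
      (by fun_prop)
  have e₁ : ContinuousAt (fun y : ℝ × ℝ × ℝ × ℝ => speedOf p r ((y.1 + y.2.1) / 2)) y₀ :=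
    ContinuousAt.comp (g := speedOf p r) (f := fun y : ℝ × ℝ × ℝ × ℝ => (y.1 + y.2.1) / 2)
      (by simpa only [hy₀, hb] using (contDiffAt_speedOf hp hp' hr hρ₀).continuousAt) (by fun_prop)
  have e₂ : ContinuousAt (fun y : ℝ × ℝ × ℝ × ℝ => speedOf p r ((y.2.2.1 + y.2.2.2) / 2)) y₀ :=
    ContinuousAt.comp (g := speedOf p r) (f := fun y : ℝ × ℝ × ℝ × ℝ => (y.2.2.1 + y.2.2.2) / 2)
      (by simpa only [hy₀, hαβ] using (contDiffAt_speedOf hp hp' hr hρm).continuousAt)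
      (by fun_prop)
  have c₁ : ContinuousAt (fun y : ℝ × ℝ × ℝ × ℝ => cOut p r y.1 y.2.1) y₀ :=
    ContinuousAt.add (f := fun y : ℝ × ℝ × ℝ × ℝ => (y.1 - y.2.1) / 2) (by fun_prop) e₁
  have c₂ : ContinuousAt (fun y : ℝ × ℝ × ℝ × ℝ => cOut p r y.2.2.1 y.2.2.2) y₀ :=
    ContinuousAt.add (f := fun y : ℝ × ℝ × ℝ × ℝ => (y.2.2.1 - y.2.2.2) / 2) (by fun_prop) e₂
  have hV0 := shockSpeed_reflection hrefl hp hp' hr hαβ hw hρm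
  have r₁ : density p r (beta₀ p r ρ₀) (beta₀ p r ρ₀) = ρ₀ := by
    rw [density_eq, hb, densityOf_potential hp hp' hr hρ₀]
  have r₂ : density p r (alphaStar p r ρs ws (0, 0)) (betaStar p r ρs ws (0, 0)) = ρs (0, 0) := by
    rw [density_eq, hαβ, densityOf_potential hp hp' hr hρm]
  have g₁ := (d₁.sub d₂).eventually_ne (y := 0) (by
    change density p r (beta₀ p r ρ₀) (beta₀ p r ρ₀) -
      density p r (alphaStar p r ρs ws (0, 0)) (betaStar p r ρs ws (0, 0)) ≠ 0
    rw [r₁, r₂]; exact sub_ne_zero.2 hne)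
  have g₂ := c₂.eventually_lt hS (by
    change cOut p r (alphaStar p r ρs ws (0, 0)) (betaStar p r ρs ws (0, 0)) <
      shockSpeed p r (beta₀ p r ρ₀) (beta₀ p r ρ₀) _ _
    rw [hV0, cOut, hw, r₂]; exact hrefl.supersonic_ahead)
  have g₃ := hS.eventually_lt c₁ (by
    change shockSpeed p r (beta₀ p r ρ₀) (beta₀ p r ρ₀) _ _ <
      cOut p r (beta₀ p r ρ₀) (beta₀ p r ρ₀)
    rw [hV0, cOut, r₁, velocity, sub_self, zero_div, zero_add]; exact hrefl.subsonic_behind)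
  filter_upwards [hD, hY.eventually g₁, hY.eventually g₂, hY.eventually g₃] with q h₁ h₂ h₃ h₄
  exact ⟨h₁, sub_ne_zero.1 h₂, h₃, h₄⟩

end Instance

/-! ### The solution of the reflection problem -/

section Solution

variable {p : ℝ → ℝ} {r T ρ₀ V₀ a ε : ℝ} {ξ : ℝ → ℝ} {ρs ws : ℝ × ℝ → ℝ}
  {b k : ℝ → ℝ} {t x P : ℝ × ℝ → ℝ}
  (hs : IsCharacteristicSolution a (beta₀ p r ρ₀) (beta₀' p r T ξ ρs ws ρ₀ V₀)
    (1 / soundSpeed p ρ₀) (jumpAt p r ρs ws) (speedAt p r ρs ws) (speedOf p r) ε b k t x P)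
  (ha : 0 < a) (ha' : a < 1) (hε : 0 < ε)

include hs ha ha'

theorem IsCharacteristicSolution.hasFDerivWithinAt_triangle {q : ℝ × ℝ} (hq : q ∈ triangle a ε) :
    HasFDerivWithinAt t (planeForm (P q) (P q.swap)) (triangle a ε) q ∧
    HasFDerivWithinAt x (planeForm (cIn p r (b q.1) (b q.2) * P q)
      (cOut p r (b q.1) (b q.2) * P q.swap)) (triangle a ε) q :=
  have hsub := triangle_subset_square (ε := ε) ha ha'
  ⟨(hs.hasFDerivWithinAt_t q (hsub hq)).mono hsub, (hs.hasFDerivWithinAt_x q (hsub hq)).mono hsub⟩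

/-- The Jacobian determinant is `∂t/∂u ∂t/∂v (c_out - c_in)`, a product of positive factors. -/
theorem IsCharacteristicSolution.det_pos {q : ℝ × ℝ} (hq : q ∈ triangle a ε) :
    0 < P q * (cOut p r (b q.1) (b q.2) * P q.swap) -
      P q.swap * (cIn p r (b q.1) (b q.2) * P q) := by
  have hq' := triangle_subset_square (ε := ε) ha ha' hq
  have h1 := hs.p_pos q hq'
  have h2 := hs.p_pos q.swap ⟨hq'.2, hq'.1⟩
  have h3 : cIn p r (b q.1) (b q.2) < 0 := hs.speedIn_neg q hq'
  have h4 : 0 < cOut p r (b q.1) (b q.2) := hs.speedOut_pos q hq'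
  have := mul_pos (mul_pos h1 h2) (by linarith : 0 < cOut p r (b q.1) (b q.2) -
    cIn p r (b q.1) (b q.2))
  linarith

include hε

theorem IsCharacteristicSolution.jacobian_ne_zero {q : ℝ × ℝ} (hq : q ∈ triangle a ε) :
    jacobian t x (triangle a ε) q ≠ 0 := by
  obtain ⟨ht, hx⟩ := hs.hasFDerivWithinAt_triangle ha ha' hq
  have hu := uniqueDiffOn_triangle ha ha' hε q hq
  have := hs.det_pos ha ha' hq
  simp only [jacobian, partialFst, partialSnd, ht.fderivWithin hu, hx.fderivWithin hu,
    planeForm_apply, mul_one, mul_zero, add_zero, zero_add]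
  exact this.ne'

omit hε in
/-- The map `(u, v) ↦ (t, x)` is invertible on the triangle, with an inverse of class `C²`. -/
theorem IsCharacteristicSolution.exists_inverse :
    ∃ A B : ℝ × ℝ → ℝ,
      ContDiffOn ℝ 2 A ((fun q => (t q, x q)) '' triangle a ε) ∧
      ContDiffOn ℝ 2 B ((fun q => (t q, x q)) '' triangle a ε) ∧
      ∀ q ∈ triangle a ε, b q.1 = A (t q, x q) ∧ b q.2 = B (t q, x q) := by
  have hsub := triangle_subset_square (ε := ε) ha ha'
  have hinj := injOn_square hs.hasFDerivWithinAt_t hs.hasFDerivWithinAt_x hs.p_pos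
    (fun z hz => hs.p_pos z.swap ⟨hz.2, hz.1⟩)
    (fun z hz => mul_neg_of_neg_of_pos (hs.speedIn_neg z hz) (hs.p_pos z hz))
    (fun z hz => mul_pos (hs.speedOut_pos z hz) (hs.p_pos z.swap ⟨hz.2, hz.1⟩))
  obtain ⟨g, hg, hgi⟩ := exists_contDiffOn_inverse (isCompact_triangle (ε := ε) ha ha')
    (fun z hz => (hs.hasFDerivWithinAt_triangle ha ha' hz).1)
    (fun z hz => (hs.hasFDerivWithinAt_triangle ha ha' hz).2)
    (hs.contDiffOn_tu.mono hsub) (hs.contDiffOn_tv.mono hsub) (hs.contDiffOn_xu.mono hsub)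
    (hs.contDiffOn_xv.mono hsub) (fun z hz => (hs.det_pos ha ha' hz).ne') (hinj.mono hsub)
  exact ⟨fun y => b (g y).1, fun y => b (g y).2,
    hs.contDiff_b.comp_contDiffOn hg.fst, hs.contDiff_b.comp_contDiffOn hg.snd,
    fun q hq => by simp only [hgi q hq, and_self]⟩

/-- The restriction to the triangle of a solution on the square. -/
theorem IsCharacteristicSolution.isReflectionSolution (hη : 0 < soundSpeed p ρ₀)
    (he : speedOf p r (beta₀ p r ρ₀) = soundSpeed p ρ₀)
    (hV : speedAt p r ρs ws (beta₀ p r ρ₀, beta₀ p r ρ₀, 0, 0) = V₀)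
    (hshock : ∀ v ∈ Icc 0 ε, (b v, b (a * v), t (a * v, v), x (a * v, v)) ∈
      {q : ℝ × ℝ × ℝ × ℝ | q.2.2 ∈ devRegion T ξ ∧
        density p r q.2.1 q.1 ≠
          density p r (alphaStar p r ρs ws q.2.2) (betaStar p r ρs ws q.2.2) ∧
        cOut p r (alphaStar p r ρs ws q.2.2) (betaStar p r ρs ws q.2.2) < speedAt p r ρs ws q ∧
        speedAt p r ρs ws q < cOut p r q.2.1 q.1})
    (hstate : ∀ u ∈ Icc 0 ε, ∀ v ∈ Icc 0 ε, (b u + b v) / 2 ∈ potential p r '' Ioi 0) :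
    IsReflectionSolution p r T ξ ρs ws ρ₀ V₀ a ε (fun q => b q.1) (fun q => b q.2) t x := by
  have hsub := triangle_subset_square (ε := ε) ha ha'
  have hu := uniqueDiffOn_triangle ha ha' hε
  have h0 : ((0, 0) : ℝ × ℝ) ∈ triangle a ε := by
    simpa using shock_mem_triangle (ε := ε) ha ha' (v := 0) ⟨le_rfl, hε.le⟩
  have hft (q) (hq : q ∈ triangle a ε) := (hs.hasFDerivWithinAt_triangle ha ha' hq).1.fderivWithin
    (hu q hq)
  have hfx (q) (hq : q ∈ triangle a ε) := (hs.hasFDerivWithinAt_triangle ha ha' hq).2.fderivWithin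
    (hu q hq)
  have hα (q) (hq : q ∈ triangle a ε) : fderivWithin ℝ (fun q : ℝ × ℝ => b q.1) (triangle a ε) q =
      k q.1 • ContinuousLinearMap.fst ℝ ℝ ℝ :=
    ((hs.hasDerivAt_b q.1).comp_hasFDerivWithinAt q hasFDerivWithinAt_fst).fderivWithin (hu q hq)
  have hβ (q) (hq : q ∈ triangle a ε) : fderivWithin ℝ (fun q : ℝ × ℝ => b q.2) (triangle a ε) q =
      k q.2 • ContinuousLinearMap.snd ℝ ℝ ℝ :=
    ((hs.hasDerivAt_b q.2).comp_hasFDerivWithinAt q hasFDerivWithinAt_snd).fderivWithin (hu q hq)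
  have hnorm : cOut p r (b 0) (b 0) * P (0, 0) = 1 := by
    rw [cOut_eq, hs.b_zero, hs.p_zero, sub_self, zero_div, zero_add, add_self_div_two, he,
      mul_one_div_cancel hη.ne']
  constructor
  case contDiff_α => exact (hs.contDiff_b.comp contDiff_fst).contDiffOn
  case contDiff_β => exact (hs.contDiff_b.comp contDiff_snd).contDiffOn
  case contDiff_t => exact hs.contDiffOn_t.mono hsub
  case contDiff_x => exact hs.contDiffOn_x.mono hsub
  case isState => exact fun q hq => hstate q.1 (hsub hq).1 q.2 (hsub hq).2
  case char_in => exact fun q hq => by simp [partialFst, hft q hq, hfx q hq]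
  case char_out => exact fun q hq => by simp [partialSnd, hft q hq, hfx q hq]
  case invariant_α => exact fun q hq => by simp [partialSnd, hα q hq]
  case invariant_β => exact fun q hq => by simp [partialFst, hβ q hq]
  case wall_velocity => exact fun u _ => rfl
  case wall_position => exact fun u hu => hs.wall u ⟨hu.1, by nlinarith [hu.2]⟩
  case shock_mem => exact fun v hv => (hshock v hv).1
  case shock_speed =>
    intro v hv
    obtain ⟨d, h1, h2⟩ := hs.shock_speed v hv
    have huv := uniqueDiffOn_Icc hε v hv
    rw [h1.derivWithin huv, h2.derivWithin huv]
    rfl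
  case density_jump => exact fun v hv => (hshock v hv).2.1
  case jump => exact hs.jump
  case supersonic_ahead => exact fun v hv => (hshock v hv).2.2.1
  case subsonic_behind => exact fun v hv => (hshock v hv).2.2.2
  case t_zero => exact hs.t_zero
  case x_zero => exact hs.x_zero
  case x_normalised => simpa [partialSnd, hfx _ h0] using hnorm
  case β_zero => exact hs.b_zero
  case dβ_zero => simpa [partialSnd, hβ _ h0] using hs.k_zero
  case speed_zero =>
    simp only [speedAlong, shockPt, mul_zero, hs.b_zero, hs.t_zero, hs.x_zero]
    exact hV

end Solution

end ShockReflection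

end

theorem mainTheorem1
    (p : ℝ → ℝ) (hp : ContDiffOn ℝ ∞ p (Set.Ioi 0)) (hp' : ∀ ρ : ℝ, 0 < ρ → 0 < deriv p ρ)
    (r : ℝ) (hr : 0 < r)
    (ρd wd : ℝ → ℝ) (T : ℝ) (ξ : ℝ → ℝ) (ρs ws : ℝ × ℝ → ℝ)
    (hdev : ShockReflection.IsFutureDevelopment p ρd wd T ξ ρs ws)
    (ρ₀ V₀ : ℝ) (hrefl : ShockReflection.IsReflectionPoint p (ρs (0, 0)) (ws (0, 0)) ρ₀ V₀)
    (a : ℝ) (ha : a = ShockReflection.slope p ρ₀ V₀) :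
    ∃ ε₀ : ℝ, 0 < ε₀ ∧ ∀ ε : ℝ, 0 < ε → ε ≤ ε₀ →
      ∃ α β t x : ℝ × ℝ → ℝ,
        ShockReflection.IsReflectionSolution p r T ξ ρs ws ρ₀ V₀ a ε α β t x ∧
        (∀ q ∈ ShockReflection.triangle a ε,
          ShockReflection.jacobian t x (ShockReflection.triangle a ε) q ≠ 0) ∧
        ∃ A B : ℝ × ℝ → ℝ,
          ContDiffOn ℝ 2 A ((fun q => (t q, x q)) '' ShockReflection.triangle a ε) ∧
          ContDiffOn ℝ 2 B ((fun q => (t q, x q)) '' ShockReflection.triangle a ε) ∧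
          ∀ q ∈ ShockReflection.triangle a ε, α q = A (t q, x q) ∧ β q = B (t q, x q) := by
  subst ha
  have hρ₀ := hrefl.density_pos
  have hη := ShockReflection.soundSpeed_pos hp' hρ₀
  have hpos := ShockReflection.slope_pos hrefl hp'
  have hlt := ShockReflection.slope_lt_one hrefl hp'
  obtain ⟨m₁, hm, hm₁⟩ := exists_between hrefl.supersonic_ahead
  have hdata := ShockReflection.reflectionData hp hp' hr hdev hrefl hm hm₁ (lt_add_one V₀)
  -- the values of the potential near its value at `ρ₀` come from states
  have hS : ShockReflection.potential p r '' Ioi 0 ∈ nhds (ShockReflection.beta₀ p r ρ₀) :=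
    Filter.mem_of_superset (ShockReflection.densityOf_eventually hp hp' hr hρ₀).2
      fun σ hσ => ⟨_, hσ.1, hσ.2⟩
  obtain ⟨ε₀, hε₀, hsol⟩ := hdata.exists_characteristicSolution
    (ShockReflection.eventually_determinism hp hp' hr hdev hrefl hm) hS
  refine ⟨ε₀, hε₀, fun ε hε hle => ?_⟩
  obtain ⟨b, k, t, x, P, hs, hshock, hstate⟩ := hsol ε hε hle
  exact ⟨fun q => b q.1, fun q => b q.2, t, x,
    hs.isReflectionSolution hpos hlt hε hη (ShockReflection.speedOf_potential hp hp' hr hρ₀)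
      hdata.V_zero hshock hstate,
    fun q hq => hs.jacobian_ne_zero hpos hlt hε hq, hs.exists_inverse hpos hlt⟩
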